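/- Let $f:\mathbb R^d\to\mathbb R$ be smooth and strictly convex, in the sense that $\nabla^2 f(x)$ is positive definite for every $x$, and let $\rho$ be a smooth, everywhere positive probability density on $\mathbb R^d$. Assume that the Euclidean Newton direction $-(\nabla^2 f)^{-1}\nabla f$ has finite energy, i.e. $\int \nabla f^{T}(\nabla^2 f)^{-1}\nabla f\,\rho\,dx<\infty$. A *potential* is a smooth function $\Phi:\mathbb R^d\to\mathbb R$ with $\int \nabla\Phi^{T}\,\nabla^2 f\,\nabla\Phi\,\rho\,dx<\infty$. For a smooth vector field $W$, "$\nabla\cdot W=0$" (in the sense below) means that the divergence vanishes at every point and that there is no flux at infinity: for every potential $\psi$, $\langle W,\nabla\psi\rangle$ is integrable and $\int\langle W,\nabla\psi\rangle\,dx=0$. (1) There exist a potential $\Phi$ and a vector field $\xi:\mathbb R^d\to\mathbb R^d$ with $\nabla\cdot(\rho\,\nabla^2 f\,\xi)=0$ in this sense such that $$-(\nabla^2 f(x))^{-1}\nabla f(x)=\nabla\Phi(x)+\xi(x)\qquad\text{for all }x\in\mathbb R^d .$$ Among all such pairs, $\Phi$ is unique up to an additive constant and $\xi$ is unique. Moreover,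 the potentials $\Phi'$ solving the Wasserstein Newton direction equation $-\nabla\cdot(\rho\,\nabla^2 f\,\nabla\Phi')-\nabla\cdot(\rho\,\nabla f)=0$ of $E(\rho)=\int f\rho\,dx$, in the sense that the smooth field $\rho\,\nabla^2 f\,\nabla\Phi'+\rho\,\nabla f$ has zero divergence in the above sense, are exactly the functions $\Phi+c$, $c\in\mathbb R$. (2) The Wasserstein Newton flow $\partial_t\rho_t+\nabla\cdot(\rho_t\nabla\Phi_t)=0$ of $E$, where $\Phi_t$ solves the Wasserstein Newton direction equation at $\rho_t$, differs in general from the density evolution $\partial_t\rho_t=\nabla\cdot(\rho_t(\nabla^2 f)^{-1}\nabla f)$ of the particle-wise Euclidean Newton flow: there are $f,\rho$ on $\mathbb R^2$ satisfying all the assumptions above, and a solution $\Phi$ of the Wasserstein Newton direction equation at $\rho$, such that the two equations prescribe different time derivatives at $\rho$, i.e. $-\nabla\cdot(\rho\nabla\Phi)\neq\nabla\cdot(\rho(\nabla^2 f)^{-1}\nabla f)$ at some point. -/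

import Mathlib

open MeasureTheory
open scoped ContDiff

noncomputable section

namespace NewtonDecomp

/-- The Euclidean space `ℝ^d`. -/
abbrev Space (d : ℕ) : Type := EuclideanSpace ℝ (Fin d)

/-- The divergence `∑ i, ∂ F_i / ∂ x_i` of a vector field on `ℝ^d`. -/
def divergence {d : ℕ} (F : Space d → Space d) (x : Space d) : ℝ :=
  ∑ i : Fin d, (fderiv ℝ F x (EuclideanSpace.single i 1)) i

/-- The Hessian `∇²f(x)`, as the linear operator `v ↦ ∇²f(x) v` on `ℝ^d`. -/
def hessian {d : ℕ} (f : Space d → ℝ) (x : Space d) : Space d →L[ℝ] Space d :=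
  fderiv ℝ (gradient f) x

/-- A smooth function whose Hessian is positive definite at every point. -/
structure IsSmoothStrictlyConvex {d : ℕ} (f : Space d → ℝ) : Prop where
  smooth : ContDiff ℝ ∞ f
  hessian_pos : ∀ x v : Space d, v ≠ 0 → 0 < inner ℝ (hessian f x v) v

/-- A smooth, everywhere positive probability density on `ℝ^d`. -/
structure IsSmoothDensity {d : ℕ} (ρ : Space d → ℝ) : Prop where
  smooth : ContDiff ℝ ∞ ρ
  pos : ∀ x, 0 < ρ x
  integral_eq_one : ∫ x, ρ x = 1

/-- The Euclidean Newton direction `-(∇²f(x))⁻¹ ∇f(x)`. -/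
def newtonDirection {d : ℕ} (f : Space d → ℝ) (x : Space d) : Space d :=
  -((hessian f x).inverse (gradient f x))

/-- The vector field `v` has finite energy `∫ v(x)ᵀ ∇²f(x) v(x) ρ(x) dx`. -/
def HasFiniteEnergy {d : ℕ} (f ρ : Space d → ℝ) (v : Space d → Space d) : Prop :=
  Integrable (fun x => ρ x * inner ℝ (hessian f x (v x)) (v x))

/-- `Φ` represents a cotangent vector at `ρ`: a smooth function (which matters only up to an
additive constant) for which the Hessian form `∫ ∇Φᵀ ∇²f ∇Φ ρ dx` is finite. -/
structure IsPotential {d : ℕ} (f ρ Φ : Space d → ℝ) : Prop where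
  smooth : ContDiff ℝ ∞ Φ
  finite_energy : HasFiniteEnergy f ρ (gradient Φ)

/-- The smooth field `W` satisfies `∇·W = 0`, both pointwise and without flux at infinity: the
integration by parts `∫ ψ ∇·W dx = -∫ ⟨W, ∇ψ⟩ dx` has no boundary term for any potential `ψ`. -/
structure IsDivergenceFree {d : ℕ} (f ρ : Space d → ℝ) (W : Space d → Space d) : Prop where
  smooth : ContDiff ℝ ∞ W
  divergence_eq_zero : ∀ x, divergence W x = 0
  integrable : ∀ ψ, IsPotential f ρ ψ → Integrable (fun x => inner ℝ (W x) (gradient ψ x))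
  no_flux : ∀ ψ, IsPotential f ρ ψ → ∫ x, inner ℝ (W x) (gradient ψ x) = 0

/-- `-(∇²f)⁻¹ ∇f = ∇Φ + ξ` with `Φ` a potential and `∇·(ρ ∇²f ξ) = 0`. -/
structure IsNewtonDecomposition {d : ℕ} (f ρ Φ : Space d → ℝ) (ξ : Space d → Space d) :
    Prop where
  potential : IsPotential f ρ Φ
  divergence_free : IsDivergenceFree f ρ (fun x => ρ x • hessian f x (ξ x))
  decomposition : ∀ x, newtonDirection f x = gradient Φ x + ξ x

/-- `Φ` solves the Wasserstein Newton direction equation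
`-∇·(ρ ∇²f ∇Φ) - ∇·(ρ ∇f) = 0` of the functional `E(ρ) = ∫ f ρ dx`. -/
structure IsWassersteinNewtonPotential {d : ℕ} (f ρ Φ : Space d → ℝ) : Prop where
  potential : IsPotential f ρ Φ
  equation : IsDivergenceFree f ρ
    (fun x => ρ x • hessian f x (gradient Φ x) + ρ x • gradient f x)

/-- The rate `∂ₜρ = -∇·(ρ v)` at which the density `ρ` changes when its particles move with
velocity field `v`. -/
def continuityRate {d : ℕ} (ρ : Space d → ℝ) (v : Space d → Space d) (x : Space d) : ℝ :=
  -divergence (fun y => ρ y • v y) x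

end NewtonDecomp

end

/-! Write N for the Newton direction and B = ρ ∇²f, a smooth field of symmetric positive definite
operators. Finite energy places N in the Hilbert space with form ∫ ⟨B v, w⟩. The decomposition is
the orthogonal splitting N = P + ξ, where P is the projection of N onto the closure of the gradients
of potentials (`exists_energy_projection`). Orthogonality of ξ to every ∇ψ is the no-flux condition;
restricted to compactly supported ψ it is the equation ∇·(B ξ) = 0 in the weak sense.

The difficulty is that P is only a limit of gradients. It solves the elliptic equation ∇·(B P - B N)
= 0 weakly, and interior regularity (`exists_smooth_potential`) makes it the gradient of a smooth
function. The argument uses difference quotients. The energy estimate `caccioppoli`, applied to the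
approximating potentials, bounds the quotients of P in L² of every ball. The quotient solves an
equation of the same kind, so the bound iterates (`unifSob_of_solution`). Iterates with a single
step and a single direction suffice: after a cutoff, the Fourier transform of P decays faster than
any power along each vector of an orthonormal basis, hence in norm, and Fourier inversion gives a
smooth representative. A smooth limit of gradients is curl free, hence a gradient.

Since ∇²f N = -∇f, the Wasserstein Newton equation for Φ says exactly that ξ = N - ∇Φ is admissible
(`isWassersteinNewtonPotential_iff`). Uniqueness follows by testing the difference of two equations
against the difference of the two potentials: its energy vanishes, and B is positive definite.

For the second claim, take an explicit quartic f and a Gaussian ρ on the plane. If the two rates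
agreed, ρ ξ would be divergence free along with ρ ∇²f ξ. The rotation field J equals 2 ∇²f ∇s + 2 ∇t
for two polynomials s and t (`inner_rotationField_eq`), so ξ would be orthogonal to J in L²(ρ). So
is ∇Φ, because ρ J is divergence free and tangential to circles. Thus N would be orthogonal to J,
which the explicit formula for N refutes (`integral_newtonDirection_rotationField_ne_zero`). -/

namespace NewtonDecomp

open Metric Set Filter Topology

set_option linter.unusedSectionVars false

/-! ### Difference quotients and local L² bounds uniform in the step. -/

section DifferenceQuotients

variable {E : Type*} [NormedAddCommGroup E] [InnerProductSpace ℝ E] [FiniteDimensional ℝ E]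
  [MeasurableSpace E] [BorelSpace E]
  {G : Type*} [NormedAddCommGroup G] [NormedSpace ℝ G]
  {G' : Type*} [NormedAddCommGroup G'] [NormedSpace ℝ G']

/-- Local square integrability on a Euclidean space. -/
structure LocL2 (w : E → G) : Prop where
  aesm : AEStronglyMeasurable w volume
  integrableOn : ∀ R : ℝ, IntegrableOn (fun x => ‖w x‖ ^ 2) (ball 0 R)

/-- The difference quotient with step `h` in the direction `e`. -/
noncomputable def diffQuot (h : ℝ) (e : E) (g : E → G) (x : E) : G := h⁻¹ • (g (x + h • e) - g x)

theorem norm_add_sq_le (a b : G) : ‖a + b‖ ^ 2 ≤ 2 * ‖a‖ ^ 2 + 2 * ‖b‖ ^ 2 := by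
  have h := norm_add_le a b
  have h0 := norm_nonneg (a + b)
  nlinarith [sq_nonneg (‖a‖ - ‖b‖)]

theorem LocL2.mono {w : E → G} {g : E → ℝ} (hw : AEStronglyMeasurable w volume)
    (hg : ∀ R, IntegrableOn g (ball 0 R)) (h : ∀ x, ‖w x‖ ^ 2 ≤ g x) : LocL2 w :=
  ⟨hw, fun R => (hg R).mono' ((hw.norm.pow 2).restrict)
    (Eventually.of_forall fun x => by simpa using h x)⟩

theorem LocL2.add {v w : E → G} (hv : LocL2 v) (hw : LocL2 w) : LocL2 (fun x => v x + w x) :=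
  LocL2.mono (g := fun x => 2 * ‖v x‖ ^ 2 + 2 * ‖w x‖ ^ 2) (hv.aesm.add hw.aesm)
    (fun R => ((hv.integrableOn R).const_mul 2).fun_add ((hw.integrableOn R).const_mul 2))
    (fun _ => norm_add_sq_le _ _)

theorem LocL2.const_smul {w : E → G} (hw : LocL2 w) (c : ℝ) : LocL2 (fun x => c • w x) :=
  LocL2.mono (g := fun x => c ^ 2 * ‖w x‖ ^ 2) (hw.aesm.const_smul c)
    (fun R => (hw.integrableOn R).const_mul _)
    (fun x => by rw [norm_smul, mul_pow]; simp)

theorem LocL2.sub {v w : E → G} (hv : LocL2 v) (hw : LocL2 w) : LocL2 (fun x => v x - w x) := by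
  simpa [sub_eq_add_neg] using hv.add (hw.const_smul (-1))

theorem LocL2.of_continuous {w : E → G} (hw : Continuous w) : LocL2 w := by
  refine ⟨hw.aestronglyMeasurable, fun R => ?_⟩
  have : Continuous fun x => ‖w x‖ ^ 2 := by fun_prop
  exact (this.locallyIntegrable.integrableOn_isCompact (isCompact_closedBall 0 R)).mono_set
    ball_subset_closedBall

theorem LocL2.comp_add {w : E → G} (hw : LocL2 w) (v : E) : LocL2 (fun x => w (x + v)) := by
  refine ⟨hw.aesm.comp_measurePreserving (measurePreserving_add_right volume v), fun R => ?_⟩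
  have h1 : IntegrableOn (fun x => ‖w x‖ ^ 2) (ball v R) :=
    (hw.integrableOn (R + ‖v‖)).mono_set
      (ball_subset_ball' (by simp))
  have := (MeasurePreserving.integrableOn_comp_preimage (measurePreserving_add_right volume v)
    (measurableEmbedding_addRight v)).2 h1
  simpa [Function.comp_def, preimage, mem_ball, dist_eq_norm, ball] using this

theorem LocL2.clm_apply {b : E → G →L[ℝ] G'} {w : E → G} (hb : Continuous b) (hw : LocL2 w) :
    LocL2 (fun x => b x (w x)) := by
  have hm : AEStronglyMeasurable (fun x => b x (w x)) volume :=
    (ContinuousLinearMap.aestronglyMeasurable_comp₂ (ContinuousLinearMap.id ℝ (G →L[ℝ] G'))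
      hb.aestronglyMeasurable hw.aesm)
  refine ⟨hm, fun R => ?_⟩
  obtain ⟨C, hC⟩ := (isCompact_closedBall (0 : E) R).exists_bound_of_continuousOn hb.continuousOn
  refine Integrable.mono' ((hw.integrableOn R).const_mul (C ^ 2)) (hm.norm.pow 2).restrict ?_
  refine (ae_restrict_iff' measurableSet_ball).2 (Eventually.of_forall fun x hx => ?_)
  have h1 := (b x).le_opNorm (w x)
  have h2 := hC x (ball_subset_closedBall hx)
  have : ‖b x (w x)‖ ≤ C * ‖w x‖ := h1.trans (by gcongr)
  simpa [mul_pow] using pow_le_pow_left₀ (norm_nonneg _) this 2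

theorem LocL2.diffQuot {w : E → G} (hw : LocL2 w) (h : ℝ) (e : E) : LocL2 (diffQuot h e w) :=
  ((hw.comp_add (h • e)).sub hw).const_smul _

theorem setIntegral_comp_add_le {g : E → ℝ} (hg : ∀ x, 0 ≤ g x) (v : E) (R R' : ℝ)
    (hR : R + ‖v‖ ≤ R') (hi : IntegrableOn g (ball 0 R')) :
    ∫ x in ball 0 R, g (x + v) ≤ ∫ x in ball 0 R', g x := by
  have h := (measurePreserving_add_right volume v).setIntegral_preimage_emb
    (measurableEmbedding_addRight v) g (ball v R)
  have e1 : (fun x => x + v) ⁻¹' ball v R = ball 0 R := by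
    ext x; simp [mem_ball, dist_eq_norm]
  rw [e1] at h
  rw [h]
  exact setIntegral_mono_set hi (Eventually.of_forall hg)
    (ball_subset_ball' (by simpa using hR)).eventuallyLE

/-- A family of functions, indexed by a step `h ∈ (0, 1]`, bounded in `L²` of every ball. -/
structure UnifL2 (w : ℝ → E → G) : Prop where
  locL2 : ∀ h ∈ Ioc (0 : ℝ) 1, LocL2 (w h)
  bound : ∀ R : ℝ, ∃ C : ℝ, ∀ h ∈ Ioc (0 : ℝ) 1, ∫ x in ball 0 R, ‖w h x‖ ^ 2 ≤ C

/-- A family whose difference quotients up to order `k` are bounded in `L²` of every ball. -/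
def UnifSob (e : E) : ℕ → (ℝ → E → G) → Prop
  | 0, w => UnifL2 w
  | k + 1, w => UnifL2 w ∧ UnifSob e k (fun h => diffQuot h e (w h))

/-- A family of continuous functions that are uniformly bounded on every ball. -/
structure UnifBdd (b : ℝ → E → G) : Prop where
  continuous : ∀ h ∈ Ioc (0 : ℝ) 1, Continuous (b h)
  bound : ∀ R : ℝ, ∃ C : ℝ, ∀ h ∈ Ioc (0 : ℝ) 1, ∀ x ∈ ball (0 : E) R, ‖b h x‖ ≤ C

/-- A family all of whose iterated difference quotients are uniformly bounded on every ball. -/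
def UnifSmooth (e : E) (b : ℝ → E → G) : Prop :=
  ∀ m : ℕ, UnifBdd (fun h => (diffQuot h e)^[m] (b h))

theorem UnifSob.unifL2 {e : E} {k : ℕ} {w : ℝ → E → G} (hw : UnifSob e k w) : UnifL2 w := by
  cases k with
  | zero => exact hw
  | succ k => exact hw.1

theorem UnifL2.add {v w : ℝ → E → G} (hv : UnifL2 v) (hw : UnifL2 w) :
    UnifL2 (fun h x => v h x + w h x) := by
  refine ⟨fun h hh => (hv.locL2 h hh).add (hw.locL2 h hh), fun R => ?_⟩
  obtain ⟨C, hC⟩ := hv.bound R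
  obtain ⟨D, hD⟩ := hw.bound R
  refine ⟨2 * C + 2 * D, fun h hh => ?_⟩
  have i1 := ((hv.locL2 h hh).integrableOn R).const_mul 2
  have i2 := ((hw.locL2 h hh).integrableOn R).const_mul 2
  calc ∫ x in ball 0 R, ‖v h x + w h x‖ ^ 2
      ≤ ∫ x in ball 0 R, (2 * ‖v h x‖ ^ 2 + 2 * ‖w h x‖ ^ 2) :=
        setIntegral_mono (((hv.locL2 h hh).add (hw.locL2 h hh)).integrableOn R)
          (i1.fun_add i2) (fun x => norm_add_sq_le _ _)
    _ = 2 * (∫ x in ball 0 R, ‖v h x‖ ^ 2) + 2 * ∫ x in ball 0 R, ‖w h x‖ ^ 2 := by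
        rw [integral_add i1 i2, integral_const_mul, integral_const_mul]
    _ ≤ 2 * C + 2 * D := by linarith [hC h hh, hD h hh]

theorem UnifL2.neg {w : ℝ → E → G} (hw : UnifL2 w) : UnifL2 (fun h x => -w h x) := by
  refine ⟨fun h hh => by simpa using (hw.locL2 h hh).const_smul (-1), fun R => ?_⟩
  simpa using hw.bound R

theorem UnifL2.clm_apply {b : ℝ → E → G →L[ℝ] G'} {w : ℝ → E → G} (hb : UnifBdd b)
    (hw : UnifL2 w) : UnifL2 (fun h x => b h x (w h x)) := by
  refine ⟨fun h hh => (hw.locL2 h hh).clm_apply (hb.continuous h hh), fun R => ?_⟩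
  obtain ⟨C, hC⟩ := hw.bound R
  obtain ⟨D, hD⟩ := hb.bound R
  refine ⟨D ^ 2 * C, fun h hh => ?_⟩
  calc ∫ x in ball 0 R, ‖b h x (w h x)‖ ^ 2
      ≤ ∫ x in ball 0 R, D ^ 2 * ‖w h x‖ ^ 2 := by
        refine setIntegral_mono_on (((hw.locL2 h hh).clm_apply (hb.continuous h hh)).integrableOn R)
          (((hw.locL2 h hh).integrableOn R).const_mul _) measurableSet_ball fun x hx => ?_
        rw [← mul_pow]
        refine pow_le_pow_left₀ (norm_nonneg _) (((b h x).le_opNorm _).trans ?_) 2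
        gcongr
        exact hD h hh x hx
    _ = D ^ 2 * ∫ x in ball 0 R, ‖w h x‖ ^ 2 := integral_const_mul _ _
    _ ≤ D ^ 2 * C := by gcongr; exact hC h hh

theorem UnifBdd.unifL2 {b : ℝ → E → G} (hb : UnifBdd b) : UnifL2 b := by
  refine ⟨fun h hh => .of_continuous (hb.continuous h hh), fun R => ?_⟩
  obtain ⟨D, hD⟩ := hb.bound R
  refine ⟨∫ x in ball (0 : E) R, D ^ 2, fun h hh => ?_⟩
  refine setIntegral_mono_on ((LocL2.of_continuous (hb.continuous h hh)).integrableOn R)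
    (integrableOn_const measure_ball_lt_top.ne) measurableSet_ball fun x hx => ?_
  exact pow_le_pow_left₀ (norm_nonneg _) (hD h hh x hx) 2

theorem UnifBdd.comp_add {b : ℝ → E → G} (hb : UnifBdd b) {e : E} (he : ‖e‖ ≤ 1) :
    UnifBdd (fun h x => b h (x + h • e)) := by
  refine ⟨fun h hh => (hb.continuous h hh).comp (by fun_prop), fun R => ?_⟩
  obtain ⟨C, hC⟩ := hb.bound (R + 1)
  refine ⟨C, fun h hh x hx => hC h hh _ ?_⟩
  rw [mem_ball_zero_iff] at hx ⊢
  have : ‖h • e‖ ≤ 1 := by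
    rw [norm_smul, Real.norm_of_nonneg hh.1.le]
    nlinarith [hh.1, hh.2, norm_nonneg e]
  linarith [norm_add_le x (h • e)]

theorem UnifSob.mono {e : E} {k : ℕ} : ∀ {w : ℝ → E → G}, UnifSob e (k + 1) w → UnifSob e k w := by
  induction k with
  | zero => intro w hw; exact hw.1
  | succ k ih => intro w hw; exact ⟨hw.1, ih hw.2⟩

theorem diffQuot_add (h : ℝ) (e : E) (v w : E → G) :
    diffQuot h e (fun x => v x + w x) = fun x => diffQuot h e v x + diffQuot h e w x := by
  ext x; simp only [diffQuot, ← smul_add]; congr 1; abel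

theorem diffQuot_neg (h : ℝ) (e : E) (v : E → G) :
    diffQuot h e (fun x => -v x) = fun x => -diffQuot h e v x := by
  ext x; simp only [diffQuot, ← smul_neg]; congr 1; abel

theorem diffQuot_comp_add (h : ℝ) (e a : E) (v : E → G) :
    diffQuot h e (fun x => v (x + a)) = fun x => diffQuot h e v (x + a) := by
  ext x; simp only [diffQuot, add_right_comm]

theorem iterate_diffQuot_comp_add (h : ℝ) (e a : E) (m : ℕ) (v : E → G) :
    (diffQuot h e)^[m] (fun x => v (x + a)) = fun x => (diffQuot h e)^[m] v (x + a) := by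
  induction m generalizing v with
  | zero => rfl
  | succ m ih => rw [Function.iterate_succ_apply, diffQuot_comp_add, ih]; rfl

/-- Discrete Leibniz rule. The shift is put on the coefficient, so that the quotient of `w` itself
appears and the rule can be iterated. -/
theorem diffQuot_clm_apply (h : ℝ) (e : E) (b : E → G →L[ℝ] G') (w : E → G) :
    diffQuot h e (fun x => b x (w x)) =
      fun x => b (x + h • e) (diffQuot h e w x) + diffQuot h e b x (w x) := by
  ext x
  simp only [diffQuot, map_smul, smul_apply, ← smul_add, map_sub,
    sub_apply]
  congr 1; abel

theorem UnifSob.add {e : E} {k : ℕ} : ∀ {v w : ℝ → E → G}, UnifSob e k v → UnifSob e k w →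
    UnifSob e k (fun h x => v h x + w h x) := by
  induction k with
  | zero => intro v w hv hw; exact UnifL2.add hv hw
  | succ k ih =>
    intro v w hv hw
    refine ⟨hv.1.add hw.1, ?_⟩
    simp only [diffQuot_add]
    exact ih hv.2 hw.2

theorem UnifSob.neg {e : E} {k : ℕ} : ∀ {w : ℝ → E → G}, UnifSob e k w →
    UnifSob e k (fun h x => -w h x) := by
  induction k with
  | zero => intro w hw; exact UnifL2.neg hw
  | succ k ih =>
    intro w hw
    refine ⟨hw.1.neg, ?_⟩
    simp only [diffQuot_neg]
    exact ih hw.2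

theorem UnifSob.sub {e : E} {k : ℕ} {v w : ℝ → E → G} (hv : UnifSob e k v) (hw : UnifSob e k w) :
    UnifSob e k (fun h x => v h x - w h x) := by
  simpa only [sub_eq_add_neg] using hv.add hw.neg

theorem UnifSmooth.comp_add {e : E} (he : ‖e‖ ≤ 1) {b : ℝ → E → G} (hb : UnifSmooth e b) :
    UnifSmooth e (fun h x => b h (x + h • e)) := by
  intro m
  simp only [iterate_diffQuot_comp_add]
  exact (hb m).comp_add he

theorem UnifSmooth.diffQuot {e : E} {b : ℝ → E → G} (hb : UnifSmooth e b) :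
    UnifSmooth e (fun h => diffQuot h e (b h)) := fun m => hb (m + 1)

theorem UnifSmooth.unifSob {e : E} {k : ℕ} : ∀ {b : ℝ → E → G}, UnifSmooth e b →
    UnifSob e k b := by
  induction k with
  | zero => intro b hb; exact (hb 0).unifL2
  | succ k ih => intro b hb; exact ⟨(hb 0).unifL2, ih hb.diffQuot⟩

/-- Induction through the discrete Leibniz rule. The term in which the quotient falls on `b`
contains `w` with one order to spare, whence `UnifSob.mono`. -/
theorem UnifSob.clm_apply {e : E} (he : ‖e‖ ≤ 1) {k : ℕ} :
    ∀ {b : ℝ → E → G →L[ℝ] G'} {w : ℝ → E → G}, UnifSmooth e b → UnifSob e k w →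
      UnifSob e k (fun h x => b h x (w h x)) := by
  induction k with
  | zero => intro b w hb hw; exact UnifL2.clm_apply (hb 0) hw
  | succ k ih =>
    intro b w hb hw
    refine ⟨hw.1.clm_apply (hb 0), ?_⟩
    simp only [diffQuot_clm_apply]
    exact (ih (hb.comp_add he) hw.2).add (ih hb.diffQuot hw.mono)

theorem contDiff_diffQuot {g : E → G} (hg : ContDiff ℝ ∞ g) (h : ℝ) (e : E) :
    ContDiff ℝ ∞ (diffQuot h e g) := by
  unfold diffQuot
  exact ((hg.comp (contDiff_id.add contDiff_const)).sub hg).const_smul _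

theorem fderiv_diffQuot {g : E → G} (hg : ContDiff ℝ ∞ g) (h : ℝ) (e : E) :
    fderiv ℝ (diffQuot h e g) = diffQuot h e (fderiv ℝ g) := by
  have hd : Differentiable ℝ g := hg.differentiable (by simp)
  ext1 x
  unfold diffQuot
  rw [fderiv_fun_const_smul (by fun_prop), fderiv_fun_sub (by fun_prop) (by fun_prop)]
  rw [fderiv_comp_add_right]

theorem contDiff_iterate_diffQuot {g : E → G} (hg : ContDiff ℝ ∞ g) (h : ℝ) (e : E) (m : ℕ) :
    ContDiff ℝ ∞ ((diffQuot h e)^[m] g) := by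
  induction m generalizing g with
  | zero => exact hg
  | succ m ih => exact ih (contDiff_diffQuot hg h e)

theorem fderiv_iterate_diffQuot {g : E → G} (hg : ContDiff ℝ ∞ g) (h : ℝ) (e : E) (m : ℕ) :
    fderiv ℝ ((diffQuot h e)^[m] g) = (diffQuot h e)^[m] (fderiv ℝ g) := by
  induction m generalizing g with
  | zero => rfl
  | succ m ih =>
    rw [Function.iterate_succ_apply, ih (contDiff_diffQuot hg h e), fderiv_diffQuot hg]
    rfl

/-- Mean value inequality; the unit enlargement of the ball makes room for the step `h • e`, of norm
at most one. -/
theorem norm_diffQuot_le {g : E → G} (hg : Differentiable ℝ g) {h : ℝ} (hh : h ∈ Ioc (0 : ℝ) 1)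
    {e : E} (he : ‖e‖ ≤ 1) {R C : ℝ} (hC : ∀ x ∈ ball (0 : E) (R + 1), ‖fderiv ℝ g x‖ ≤ C) :
    ∀ x ∈ ball (0 : E) R, ‖diffQuot h e g x‖ ≤ C := by
  intro x hx
  have hn : ‖h • e‖ ≤ h := by
    rw [norm_smul, Real.norm_of_nonneg hh.1.le]; nlinarith [hh.1]
  rw [mem_ball_zero_iff] at hx
  have hx1 : x ∈ ball (0 : E) (R + 1) := by rw [mem_ball_zero_iff]; linarith
  have hx2 : x + h • e ∈ ball (0 : E) (R + 1) := by
    rw [mem_ball_zero_iff]; linarith [norm_add_le x (h • e), hh.2]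
  have := (convex_ball (0 : E) (R + 1)).norm_image_sub_le_of_norm_fderiv_le
    (fun y _ => hg y) hC hx1 hx2
  have hC0 : 0 ≤ C := (norm_nonneg _).trans (hC x hx1)
  rw [diffQuot, norm_smul, norm_inv, Real.norm_of_nonneg hh.1.le, inv_mul_le_iff₀ hh.1]
  refine this.trans ?_
  rw [add_sub_cancel_left, mul_comm]
  gcongr

end DifferenceQuotients

/-- The outermost quotient is bounded by the derivative of the remaining `m` quotients, which is `m`
quotients of `fderiv ℝ g`. The induction therefore changes the target space to `E →L[ℝ] G`; it
quantifies over all `G`, kept in the universe of `E` so that this space stays in range. -/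
theorem exists_bound_iterate_diffQuot.{u} {E : Type u} [NormedAddCommGroup E]
    [InnerProductSpace ℝ E] [FiniteDimensional ℝ E] [MeasurableSpace E] [BorelSpace E]
    {e : E} (he : ‖e‖ ≤ 1) (m : ℕ) :
    ∀ {G : Type u} [NormedAddCommGroup G] [NormedSpace ℝ G] {g : E → G}, ContDiff ℝ ∞ g →
      ∀ R : ℝ, ∃ C : ℝ, ∀ h ∈ Ioc (0 : ℝ) 1, ∀ x ∈ ball (0 : E) R,
        ‖(diffQuot h e)^[m] g x‖ ≤ C := by
  induction m with
  | zero =>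
    intro G _ _ g hg R
    obtain ⟨C, hC⟩ := (isCompact_closedBall (0 : E) R).exists_bound_of_continuousOn
      hg.continuous.continuousOn
    exact ⟨C, fun h _ x hx => hC x (ball_subset_closedBall hx)⟩
  | succ m ih =>
    intro G _ _ g hg R
    obtain ⟨C, hC⟩ := ih (hg.fderiv_right (m := ∞) (by simp)) (R + 1)
    refine ⟨C, fun h hh => ?_⟩
    rw [Function.iterate_succ_apply']
    have hd := contDiff_iterate_diffQuot hg h e m
    refine norm_diffQuot_le (hd.differentiable (by simp)) hh he ?_
    rw [fderiv_iterate_diffQuot hg]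
    exact hC h hh

theorem unifSmooth_of_contDiff.{u} {E G : Type u} [NormedAddCommGroup E]
    [InnerProductSpace ℝ E] [FiniteDimensional ℝ E] [MeasurableSpace E] [BorelSpace E]
    [NormedAddCommGroup G] [NormedSpace ℝ G] {e : E} (he : ‖e‖ ≤ 1) {g : E → G} (hg : ContDiff ℝ ∞ g) :
    UnifSmooth e (fun _ => g) := fun m =>
  ⟨fun h _ => (contDiff_iterate_diffQuot hg h e m).continuous,
    exists_bound_iterate_diffQuot he m hg⟩

end NewtonDecomp

namespace NewtonDecomp

open Metric Set Filter Topology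

set_option linter.unusedSectionVars false

/-! ### Gradients and the interior energy estimate. -/

section Caccioppoli

variable {E : Type*} [NormedAddCommGroup E] [InnerProductSpace ℝ E] [FiniteDimensional ℝ E]
  [MeasurableSpace E] [BorelSpace E]

theorem contDiff_gradient {Φ : E → ℝ} (hΦ : ContDiff ℝ ∞ Φ) : ContDiff ℝ ∞ (gradient Φ) :=
  (InnerProductSpace.toDual ℝ E).symm.toContinuousLinearEquiv.contDiff.comp
    (hΦ.fderiv_right (m := ∞) (by simp))

theorem inner_gradient {Φ : E → ℝ} (x v : E) : inner ℝ (gradient Φ x) v = fderiv ℝ Φ x v := by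
  simp [gradient]

theorem gradient_fun_mul {a b : E → ℝ} (ha : Differentiable ℝ a) (hb : Differentiable ℝ b) (x : E) :
    gradient (fun x => a x * b x) x = a x • gradient b x + b x • gradient a x := by
  refine ext_inner_right ℝ fun v => ?_
  rw [inner_add_left, inner_smul_left, inner_smul_left, inner_gradient, inner_gradient,
    inner_gradient, fderiv_fun_mul (ha x) (hb x)]
  simp

theorem hasCompactSupport_gradient {Φ : E → ℝ} (hΦ : HasCompactSupport Φ) :
    HasCompactSupport (gradient Φ) :=
  (hΦ.fderiv (𝕜 := ℝ)).comp_left (g := (InnerProductSpace.toDual ℝ E).symm) (map_zero _)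

theorem integrable_inner_of_hasCompactSupport {w g : E → E} (hw : LocL2 w) (hg : Continuous g)
    (hs : HasCompactSupport g) : Integrable (fun x => inner ℝ (w x) (g x)) := by
  obtain ⟨R, hR⟩ := hs.isCompact.isBounded.subset_ball 0
  obtain ⟨C, hC⟩ := hg.bounded_above_of_compact_support hs
  have hm : AEStronglyMeasurable (fun x => inner ℝ (w x) (g x)) volume :=
    hw.aesm.inner hg.aestronglyMeasurable
  rw [← integrableOn_iff_integrable_of_support_subset (s := ball 0 R)]
  · refine Integrable.mono' ((hw.integrableOn R).fun_add
      (integrableOn_const (C := C ^ 2) measure_ball_lt_top.ne)) hm.restrict ?_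
    refine Eventually.of_forall fun x => ?_
    have h1 := abs_real_inner_le_norm (w x) (g x)
    have h2 := hC x
    rw [Real.norm_eq_abs]
    have h3 : ‖g x‖ ^ 2 ≤ C ^ 2 := pow_le_pow_left₀ (norm_nonneg _) h2 2
    nlinarith [sq_nonneg (‖w x‖ - ‖g x‖)]
  · refine subset_trans ?_ hR
    refine subset_trans (fun x hx => ?_) (subset_tsupport g)
    rw [Function.mem_support] at hx ⊢
    intro h; simp [h] at hx

/-- The variance of `g` on the unit interval is nonnegative. -/
theorem sq_integral_le_integral_sq {g : ℝ → ℝ} (hg : Continuous g) :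
    (∫ t in (0 : ℝ)..1, g t) ^ 2 ≤ ∫ t in (0 : ℝ)..1, g t ^ 2 := by
  set m := ∫ t in (0 : ℝ)..1, g t
  have h : 0 ≤ ∫ t in (0 : ℝ)..1, (g t - m) ^ 2 :=
    intervalIntegral.integral_nonneg (by norm_num) fun t _ => sq_nonneg _
  have e : ∫ t in (0 : ℝ)..1, (g t - m) ^ 2 =
      (∫ t in (0 : ℝ)..1, g t ^ 2) - 2 * m * (∫ t in (0 : ℝ)..1, g t) + m ^ 2 := by
    have : (fun t => (g t - m) ^ 2) = fun t => g t ^ 2 - 2 * m * g t + m ^ 2 := by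
      ext t; ring
    rw [this, intervalIntegral.integral_add, intervalIntegral.integral_sub,
      intervalIntegral.integral_const_mul]
    · simp
    all_goals exact Continuous.intervalIntegrable (by fun_prop) _ _
  rw [e] at h
  change 0 ≤ _ - 2 * m * m + m ^ 2 at h
  nlinarith

/-- The quotient is the average of the directional derivative over a segment; then Jensen. -/
theorem sq_diffQuot_le {Φ : E → ℝ} (hΦ : ContDiff ℝ ∞ Φ) {h : ℝ} (hh : h ∈ Ioc (0 : ℝ) 1)
    {e : E} (he : ‖e‖ ≤ 1) (x : E) :
    ‖diffQuot h e Φ x‖ ^ 2 ≤ ∫ t in (0 : ℝ)..1, ‖gradient Φ (x + (t * h) • e)‖ ^ 2 := by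
  have hc : Continuous (gradient Φ) := (contDiff_gradient hΦ).continuous
  have hd : Differentiable ℝ Φ := hΦ.differentiable (by simp)
  have ftc : ∫ t in (0 : ℝ)..1, h * inner ℝ (gradient Φ (x + (t * h) • e)) e =
      Φ (x + h • e) - Φ x := by
    have := intervalIntegral.integral_eq_sub_of_hasDerivAt (a := 0) (b := 1)
      (f := fun t : ℝ => Φ (x + (t * h) • e))
      (f' := fun t : ℝ => h * inner ℝ (gradient Φ (x + (t * h) • e)) e) (fun t _ => ?_)
      (Continuous.intervalIntegrable (by fun_prop) _ _)
    · simpa using this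
    · have h1 : HasDerivAt (fun t : ℝ => x + (t * h) • e) (h • e) t := by
        simpa using (((hasDerivAt_id t).mul_const h).smul_const e).const_add x
      have := (hd (x + (t * h) • e)).hasFDerivAt.comp_hasDerivAt t h1
      simpa [inner_gradient, Function.comp_def] using this
  rw [intervalIntegral.integral_const_mul] at ftc
  have : diffQuot h e Φ x = ∫ t in (0 : ℝ)..1, inner ℝ (gradient Φ (x + (t * h) • e)) e := by
    rw [diffQuot, ← ftc, smul_eq_mul, inv_mul_cancel_left₀ hh.1.ne']
  rw [this, Real.norm_eq_abs, sq_abs]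
  refine (sq_integral_le_integral_sq (by fun_prop)).trans ?_
  refine intervalIntegral.integral_mono_on (by norm_num)
    (Continuous.intervalIntegrable (by fun_prop) _ _)
    (Continuous.intervalIntegrable (by fun_prop) _ _) fun t _ => ?_
  have h1 := abs_real_inner_le_norm (gradient Φ (x + (t * h) • e)) e
  rw [← sq_abs]
  refine pow_le_pow_left₀ (abs_nonneg _) (h1.trans ?_) 2
  exact mul_le_of_le_one_right (norm_nonneg _) he

/-- Fubini applied to the pointwise bound, each translate of the ball lying in the ball of radius `R
+ 1`. This controls the zeroth order term of the energy estimate by gradients alone, so the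
approximating potentials need no normalisation. -/
theorem integral_sq_diffQuot_le {Φ : E → ℝ} (hΦ : ContDiff ℝ ∞ Φ) {h : ℝ}
    (hh : h ∈ Ioc (0 : ℝ) 1) {e : E} (he : ‖e‖ ≤ 1) (R : ℝ) :
    ∫ x in ball 0 R, ‖diffQuot h e Φ x‖ ^ 2 ≤ ∫ x in ball 0 (R + 1), ‖gradient Φ x‖ ^ 2 := by
  have hc : Continuous (gradient Φ) := (contDiff_gradient hΦ).continuous
  have hi : Integrable (Function.uncurry fun (x : E) (t : ℝ) => ‖gradient Φ (x + (t * h) • e)‖ ^ 2)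
      ((volume.restrict (ball 0 R)).prod (volume.restrict (Ioc (0 : ℝ) 1))) := by
    rw [Measure.prod_restrict]
    refine (Continuous.locallyIntegrable ?_).integrableOn_isCompact
      ((isCompact_closedBall (0 : E) R).prod (isCompact_Icc (a := (0 : ℝ)) (b := 1))) |>.mono_set
      (prod_mono ball_subset_closedBall Ioc_subset_Icc_self)
    unfold Function.uncurry
    fun_prop
  calc ∫ x in ball 0 R, ‖diffQuot h e Φ x‖ ^ 2
      ≤ ∫ x in ball 0 R, ∫ t in Ioc (0 : ℝ) 1, ‖gradient Φ (x + (t * h) • e)‖ ^ 2 := by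
        refine integral_mono
          ((LocL2.of_continuous (contDiff_diffQuot hΦ h e).continuous).integrableOn R)
          hi.integral_prod_left fun x => ?_
        simpa [intervalIntegral.integral_of_le] using sq_diffQuot_le hΦ hh he x
    _ = ∫ t in Ioc (0 : ℝ) 1, ∫ x in ball 0 R, ‖gradient Φ (x + (t * h) • e)‖ ^ 2 :=
        integral_integral_swap hi
    _ ≤ ∫ t in Ioc (0 : ℝ) 1, ∫ x in ball 0 (R + 1), ‖gradient Φ x‖ ^ 2 := by
        refine setIntegral_mono_on hi.integral_prod_right (by simp) measurableSet_Ioc fun t ht => ?_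
        refine setIntegral_comp_add_le (g := fun x => ‖gradient Φ x‖ ^ 2)
          (fun x => by positivity) _ _ _ ?_ ((LocL2.of_continuous hc).integrableOn _)
        rw [norm_smul, Real.norm_of_nonneg (mul_nonneg ht.1.le hh.1.le)]
        have : t * h ≤ 1 := mul_le_one₀ ht.2 hh.1.le hh.2
        nlinarith [norm_nonneg e]
    _ = ∫ x in ball 0 (R + 1), ‖gradient Φ x‖ ^ 2 := by simp

/-- The integrand of the energy estimate: `a` is the cutoff, `g` its gradient, `s` the potential and
`v` the gradient of the potential, so the second argument of the inner product is the gradient of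
the test function η²Ψ. Coercivity gives `c`; Young's inequality spends `c / 4` on each of the two
cross terms containing `v`, leaving `c / 2`. -/
theorem caccioppoli_pointwise {c M L : ℝ} (hc : 0 < c) {T : E →L[ℝ] E}
    (hT : ∀ v, c * ‖v‖ ^ 2 ≤ inner ℝ (T v) v) (hM : ‖T‖ ≤ M) {a s : ℝ} (ha : 0 ≤ a) (ha1 : a ≤ 1)
    {g : E} (hg : ‖g‖ ≤ L) (v H : E) :
    c / 2 * (a ^ 2 * ‖v‖ ^ 2) ≤ inner ℝ (T v + H) (a ^ 2 • v + (2 * a * s) • g) +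
      (4 * M ^ 2 * L ^ 2 / c + L ^ 2) * s ^ 2 + (1 / c + 1) * ‖H‖ ^ 2 := by
  have e : inner ℝ (T v + H) (a ^ 2 • v + (2 * a * s) • g) =
      a ^ 2 * inner ℝ (T v) v + 2 * a * s * inner ℝ (T v) g + a ^ 2 * inner ℝ H v +
        2 * a * s * inner ℝ H g := by
    simp only [inner_add_left, inner_add_right, inner_smul_right]; ring
  have M0 : 0 ≤ M := (norm_nonneg _).trans hM
  have b1 : |inner ℝ (T v) g| ≤ M * ‖v‖ * L :=
    (abs_real_inner_le_norm _ _).trans (by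
      have := (T.le_opNorm v).trans (mul_le_mul_of_nonneg_right hM (norm_nonneg v))
      gcongr)
  have b2 : |inner ℝ H v| ≤ ‖H‖ * ‖v‖ := abs_real_inner_le_norm _ _
  have b3 : |inner ℝ H g| ≤ ‖H‖ * L := (abs_real_inner_le_norm _ _).trans (by gcongr)
  have c0 : a ^ 2 * (c * ‖v‖ ^ 2) ≤ a ^ 2 * inner ℝ (T v) v := by gcongr; exact hT v
  set y := a * ‖v‖ with hy
  have y0 : 0 ≤ y := by positivity
  have c1 : -(2 * y * (|s| * M * L)) ≤ 2 * a * s * inner ℝ (T v) g := by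
    have : |2 * a * s * inner ℝ (T v) g| ≤ 2 * a * |s| * (M * ‖v‖ * L) := by
      rw [abs_mul, abs_mul, abs_of_nonneg (by positivity : (0 : ℝ) ≤ 2 * a)]; gcongr
    have := (abs_le.1 this).1
    rw [hy]; linarith
  have c2 : -(y * ‖H‖) ≤ a ^ 2 * inner ℝ H v := by
    have : |a ^ 2 * inner ℝ H v| ≤ a * (‖H‖ * ‖v‖) := by
      rw [abs_mul, abs_of_nonneg (by positivity : (0 : ℝ) ≤ a ^ 2)]
      gcongr
      nlinarith
    have := (abs_le.1 this).1
    rw [hy]; linarith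
  have c3 : -(2 * (|s| * L) * ‖H‖) ≤ 2 * a * s * inner ℝ H g := by
    have : |2 * a * s * inner ℝ H g| ≤ 2 * 1 * |s| * (‖H‖ * L) := by
      rw [abs_mul, abs_mul, abs_of_nonneg (by positivity : (0 : ℝ) ≤ 2 * a)]; gcongr
    have := (abs_le.1 this).1
    linarith
  have d1 : 2 * y * (|s| * M * L) ≤ c / 4 * y ^ 2 + 4 * M ^ 2 * L ^ 2 / c * s ^ 2 := by
    have : 0 ≤ (c * y / 2 - 2 * (|s| * M * L)) ^ 2 / c := by positivity
    have e2 : (c * y / 2 - 2 * (|s| * M * L)) ^ 2 / c =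
        c / 4 * y ^ 2 + 4 * M ^ 2 * L ^ 2 / c * |s| ^ 2 - 2 * y * (|s| * M * L) := by
      field_simp; ring
    rw [sq_abs] at e2
    linarith
  have d2 : y * ‖H‖ ≤ c / 4 * y ^ 2 + 1 / c * ‖H‖ ^ 2 := by
    have : 0 ≤ (c * y / 2 - ‖H‖) ^ 2 / c := by positivity
    have e2 : (c * y / 2 - ‖H‖) ^ 2 / c = c / 4 * y ^ 2 + 1 / c * ‖H‖ ^ 2 - y * ‖H‖ := by
      field_simp; ring
    linarith
  have d3 : 2 * (|s| * L) * ‖H‖ ≤ L ^ 2 * s ^ 2 + ‖H‖ ^ 2 := by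
    have : 0 ≤ (|s| * L - ‖H‖) ^ 2 := by positivity
    have e2 : (|s| * L - ‖H‖) ^ 2 = L ^ 2 * |s| ^ 2 + ‖H‖ ^ 2 - 2 * (|s| * L) * ‖H‖ := by ring
    rw [sq_abs] at e2
    linarith
  have ey : a ^ 2 * ‖v‖ ^ 2 = y ^ 2 := by rw [hy]; ring
  rw [e]
  have : a ^ 2 * (c * ‖v‖ ^ 2) = c * y ^ 2 := by rw [← ey]; ring
  rw [ey]
  nlinarith

/-- The interior energy estimate: a weak solution `q` of `∇·(B q - F) = 0` which is a limit of
gradients of functions `Ψ n` is controlled by `F` and the `Ψ n` on a larger ball. -/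
theorem caccioppoli {c M R : ℝ} (hc : 0 < c) (hR : 0 < R) :
    ∃ K, 0 ≤ K ∧ ∀ (B : E → E →L[ℝ] E) (q F : E → E) (Ψ : ℕ → E → ℝ) (D : ℕ → ℝ) (D' : ℝ),
      Continuous B → (∀ x ∈ ball (0 : E) (R + 1), ∀ v, c * ‖v‖ ^ 2 ≤ inner ℝ (B x v) v) →
      (∀ x ∈ ball (0 : E) (R + 1), ‖B x‖ ≤ M) → LocL2 q → LocL2 F →
      (∀ n, ContDiff ℝ ∞ (Ψ n)) →
      Tendsto (fun n => ∫ x in ball 0 (R + 1), ‖gradient (Ψ n) x - q x‖ ^ 2) atTop (𝓝 0) →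
      (∀ n, ∫ x in ball 0 (R + 1), ‖Ψ n x‖ ^ 2 ≤ D n) → Tendsto D atTop (𝓝 D') →
      (∀ ψ : E → ℝ, ContDiff ℝ ∞ ψ → HasCompactSupport ψ →
        ∫ x, inner ℝ (B x (q x) - F x) (gradient ψ x) = 0) →
      ∫ x in ball 0 R, ‖q x‖ ^ 2 ≤ K * (D' + ∫ x in ball 0 (R + 1), ‖F x‖ ^ 2) := by
  let η : ContDiffBump (0 : E) := ⟨R, R + 1, hR, by linarith⟩
  have hη : ContDiff ℝ ∞ η := η.contDiff
  have hηc : HasCompactSupport η := η.hasCompactSupport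
  have hηd : Differentiable ℝ η := hη.differentiable (by simp)
  obtain ⟨L, hL⟩ := (contDiff_gradient hη).continuous.bounded_above_of_compact_support
    (hasCompactSupport_gradient hηc)
  set K₁ := 4 * M ^ 2 * L ^ 2 / c + L ^ 2 with hK₁
  set K₂ := 1 / c + 1 with hK₂
  have hK₁0 : 0 ≤ K₁ := by positivity
  have hK₂0 : 0 ≤ K₂ := by positivity
  -- The constant sees only `c`, `M` and the cutoff, hence is uniform over all operators `B` with
  -- these bounds. The factor 2 comes from splitting `q`, and `2 / c` from the coercivity left after
  -- absorption.
  refine ⟨2 * (2 / c) * (K₁ + 2 * K₂), by positivity, ?_⟩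
  intro B q F Ψ D D' hB hell hM hq hF hΨ hlim hD hD' heq
  -- As `q` has no potential yet, the test function is built from `Ψ n`; the mismatch between its
  -- gradient and `q` is the last term, which disappears in the limit.
  have key : ∀ n, ∫ x in ball 0 R, ‖q x‖ ^ 2 ≤
      2 * (2 / c) * (K₁ * D n + 2 * K₂ * ∫ x in ball 0 (R + 1), ‖F x‖ ^ 2) +
      (2 * (2 / c) * (2 * K₂ * M ^ 2) + 2) *
        ∫ x in ball 0 (R + 1), ‖gradient (Ψ n) x - q x‖ ^ 2 := by
    intro n
    have hΨd : Differentiable ℝ (Ψ n) := (hΨ n).differentiable (by simp)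
    have hgc : Continuous (gradient (Ψ n)) := (contDiff_gradient (hΨ n)).continuous
    have hg2 : LocL2 (gradient (Ψ n)) := .of_continuous hgc
    have hr : LocL2 (fun x => gradient (Ψ n) x - q x) := hg2.sub hq
    set ψ : E → ℝ := fun x => (η x * η x) * Ψ n x with hψ
    have hψs : ContDiff ℝ ∞ ψ := (hη.mul hη).mul (hΨ n)
    have hψc : HasCompactSupport ψ := (hηc.mul_right (f' := η)).mul_right
    have hgrad : ∀ x, gradient ψ x =
        η x ^ 2 • gradient (Ψ n) x + (2 * η x * Ψ n x) • gradient η x := by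
      intro x
      rw [hψ, gradient_fun_mul (a := fun x => η x * η x) (hηd.mul hηd) hΨd, gradient_fun_mul hηd hηd]
      module
    set I : E → ℝ := fun x => inner ℝ (B x (q x) - F x) (gradient ψ x) with hI
    have hIint : Integrable I := integrable_inner_of_hasCompactSupport
      ((hq.clm_apply hB).sub hF) (contDiff_gradient hψs).continuous
      (hasCompactSupport_gradient hψc)
    have hI0 : ∫ x in ball 0 (R + 1), I x = 0 := by
      rw [setIntegral_eq_integral_of_forall_compl_eq_zero, heq ψ hψs hψc]
      intro x hx
      have : η x = 0 := by
        have := η.support_eq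
        by_contra h
        exact hx (by rw [← this]; exact h)
      simp [hI, hgrad, this]
    have pw : ∀ x ∈ ball (0 : E) (R + 1), η x ^ 2 * ‖gradient (Ψ n) x‖ ^ 2 ≤
        (2 / c) * (I x + (K₁ * ‖Ψ n x‖ ^ 2 +
          (2 * K₂ * M ^ 2 * ‖gradient (Ψ n) x - q x‖ ^ 2 + 2 * K₂ * ‖F x‖ ^ 2))) := by
      intro x hx
      have h1 := caccioppoli_pointwise hc (hell x hx) (hM x hx) (a := η x) η.nonneg η.le_one
        (s := Ψ n x)
        -- The perturbation `H` is chosen so that `B x (gradient (Ψ n) x) + H` is the actual flux `B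
        -- x (q x) - F x`, whose integral against the test gradient is zero.
        (hL x) (gradient (Ψ n) x) (-(B x (gradient (Ψ n) x - q x)) + -F x)
      have e1 : B x (gradient (Ψ n) x) + (-(B x (gradient (Ψ n) x - q x)) + -F x) =
          B x (q x) - F x := by rw [map_sub]; abel
      rw [e1, ← hgrad] at h1
      have h2 := norm_add_sq_le (-(B x (gradient (Ψ n) x - q x))) (-F x)
      rw [norm_neg, norm_neg] at h2
      have h3 : ‖B x (gradient (Ψ n) x - q x)‖ ^ 2 ≤ M ^ 2 * ‖gradient (Ψ n) x - q x‖ ^ 2 := by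
        rw [← mul_pow]
        exact pow_le_pow_left₀ (norm_nonneg _) (((B x).le_opNorm _).trans
          (mul_le_mul_of_nonneg_right (hM x hx) (norm_nonneg _))) 2
      have h4 : K₂ * ‖-(B x (gradient (Ψ n) x - q x)) + -F x‖ ^ 2 ≤
          K₂ * (2 * (M ^ 2 * ‖gradient (Ψ n) x - q x‖ ^ 2) + 2 * ‖F x‖ ^ 2) := by
        gcongr; linarith
      have h5 : ‖Ψ n x‖ ^ 2 = Ψ n x ^ 2 := by simp
      rw [h5]
      have h6 : η x ^ 2 * ‖gradient (Ψ n) x‖ ^ 2 =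
          2 / c * (c / 2 * (η x ^ 2 * ‖gradient (Ψ n) x‖ ^ 2)) := by field_simp
      rw [h6]
      gcongr
      linarith
    have i1 : IntegrableOn (fun x => ‖Ψ n x‖ ^ 2) (ball 0 (R + 1)) :=
      (LocL2.of_continuous (hΨ n).continuous).integrableOn _
    have i2 := hr.integrableOn (R + 1)
    have i3 := hF.integrableOn (R + 1)
    have i4 := ((i2.const_mul (2 * K₂ * M ^ 2)).fun_add (i3.const_mul (2 * K₂)))
    have i5 := (i1.const_mul K₁).fun_add i4
    have i6 : IntegrableOn (fun x => η x ^ 2 * ‖gradient (Ψ n) x‖ ^ 2) (ball 0 (R + 1)) := by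
      have : Continuous fun x => η x • gradient (Ψ n) x := hη.continuous.smul hgc
      have := (LocL2.of_continuous this).integrableOn (R + 1)
      simpa [norm_smul, mul_pow] using this
    have s1 : ∫ x in ball 0 (R + 1), η x ^ 2 * ‖gradient (Ψ n) x‖ ^ 2 ≤
        (2 / c) * (K₁ * (∫ x in ball 0 (R + 1), ‖Ψ n x‖ ^ 2) +
          (2 * K₂ * M ^ 2 * (∫ x in ball 0 (R + 1), ‖gradient (Ψ n) x - q x‖ ^ 2) +
            2 * K₂ * ∫ x in ball 0 (R + 1), ‖F x‖ ^ 2)) := by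
      refine (setIntegral_mono_on i6 ((hIint.integrableOn.fun_add i5).const_mul (2 / c))
        measurableSet_ball pw).trans_eq ?_
      rw [integral_const_mul, integral_add hIint.integrableOn i5, hI0,
        integral_add (i1.const_mul K₁) i4, integral_add (i2.const_mul _) (i3.const_mul _),
        integral_const_mul, integral_const_mul, integral_const_mul, zero_add]
    have s2 : ∫ x in ball 0 R, ‖q x‖ ^ 2 ≤
        2 * (∫ x in ball 0 R, η x ^ 2 * ‖gradient (Ψ n) x‖ ^ 2) +
          2 * ∫ x in ball 0 R, ‖gradient (Ψ n) x - q x‖ ^ 2 := by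
      have j1 := i6.mono_set (ball_subset_ball (by linarith : R ≤ R + 1))
      have j2 := hr.integrableOn R
      rw [← integral_const_mul, ← integral_const_mul,
        ← integral_add (j1.const_mul 2) (j2.const_mul 2)]
      refine setIntegral_mono_on (hq.integrableOn R) ((j1.const_mul 2).fun_add (j2.const_mul 2))
        measurableSet_ball fun x hx => ?_
      rw [η.one_of_mem_closedBall (ball_subset_closedBall hx)]
      have := norm_add_sq_le (gradient (Ψ n) x) (-(gradient (Ψ n) x - q x))
      rw [norm_neg] at this
      simpa using this
    have s3 : ∫ x in ball 0 R, η x ^ 2 * ‖gradient (Ψ n) x‖ ^ 2 ≤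
        ∫ x in ball 0 (R + 1), η x ^ 2 * ‖gradient (Ψ n) x‖ ^ 2 :=
      setIntegral_mono_set i6 (Eventually.of_forall fun x => by positivity)
        (ball_subset_ball (by linarith)).eventuallyLE
    have s4 : ∫ x in ball 0 R, ‖gradient (Ψ n) x - q x‖ ^ 2 ≤
        ∫ x in ball 0 (R + 1), ‖gradient (Ψ n) x - q x‖ ^ 2 :=
      setIntegral_mono_set i2 (Eventually.of_forall fun x => by positivity)
        (ball_subset_ball (by linarith)).eventuallyLE
    have s5 : K₁ * (∫ x in ball 0 (R + 1), ‖Ψ n x‖ ^ 2) ≤ K₁ * D n := by gcongr; exact hD n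
    have s6 : (2 / c) * (K₁ * (∫ x in ball 0 (R + 1), ‖Ψ n x‖ ^ 2) +
          (2 * K₂ * M ^ 2 * (∫ x in ball 0 (R + 1), ‖gradient (Ψ n) x - q x‖ ^ 2) +
            2 * K₂ * ∫ x in ball 0 (R + 1), ‖F x‖ ^ 2)) ≤
        (2 / c) * (K₁ * D n +
          (2 * K₂ * M ^ 2 * (∫ x in ball 0 (R + 1), ‖gradient (Ψ n) x - q x‖ ^ 2) +
            2 * K₂ * ∫ x in ball 0 (R + 1), ‖F x‖ ^ 2)) := by gcongr
    linarith
  have lim := ((hD'.const_mul K₁).add_const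
    (2 * K₂ * ∫ x in ball 0 (R + 1), ‖F x‖ ^ 2)).const_mul (2 * (2 / c)) |>.add
    (hlim.const_mul (2 * (2 / c) * (2 * K₂ * M ^ 2) + 2))
  have := ge_of_tendsto' lim key
  refine this.trans ?_
  have hD0 : 0 ≤ D' := ge_of_tendsto' hD' fun n =>
    (integral_nonneg fun x => by positivity).trans (hD n)
  have hF0 : 0 ≤ ∫ x in ball 0 (R + 1), ‖F x‖ ^ 2 := integral_nonneg fun x => by positivity
  rw [mul_zero, add_zero, mul_assoc (2 * (2 / c)) _ (D' + _)]
  gcongr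
  nlinarith [mul_nonneg hK₁0 hF0, mul_nonneg hK₂0 hD0]

end Caccioppoli

end NewtonDecomp

namespace NewtonDecomp

open Metric Set Filter Topology

set_option linter.unusedSectionVars false

/-! ### Iterating the energy estimate on difference quotients. -/

section InteriorRegularity

variable {E : Type*} [NormedAddCommGroup E] [InnerProductSpace ℝ E] [FiniteDimensional ℝ E]
  [MeasurableSpace E] [BorelSpace E]

/-- The field `p` is a limit, in `L²` of every ball, of gradients of smooth functions. -/
def IsGradLimit (p : E → E) : Prop :=
  ∃ Φ : ℕ → E → ℝ, (∀ n, ContDiff ℝ ∞ (Φ n)) ∧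
    ∀ R : ℝ, Tendsto (fun n => ∫ x in ball 0 R, ‖gradient (Φ n) x - p x‖ ^ 2) atTop (𝓝 0)

/-- The field `W` is divergence free in the sense of distributions. -/
def IsWeakDivFree (W : E → E) : Prop :=
  ∀ ψ : E → ℝ, ContDiff ℝ ∞ ψ → HasCompactSupport ψ → ∫ x, inner ℝ (W x) (gradient ψ x) = 0

/-- A family of operator fields that are coercive on every ball, uniformly in the step. -/
def UnifElliptic (B : ℝ → E → E →L[ℝ] E) : Prop :=
  ∀ R : ℝ, ∃ c > 0, ∀ h ∈ Ioc (0 : ℝ) 1, ∀ x ∈ ball (0 : E) R, ∀ v,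
    c * ‖v‖ ^ 2 ≤ inner ℝ (B h x v) v

theorem gradient_comp_add (ψ : E → ℝ) (a : E) :
    gradient (fun x => ψ (x + a)) = fun x => gradient ψ (x + a) := by
  ext1 x; simp only [gradient, fderiv_comp_add_right]

theorem gradient_diffQuot {Φ : E → ℝ} (hΦ : ContDiff ℝ ∞ Φ) (h : ℝ) (e : E) :
    gradient (diffQuot h e Φ) = diffQuot h e (gradient Φ) := by
  ext1 x
  simp only [gradient, fderiv_diffQuot hΦ, diffQuot, map_smul, map_sub]

/-- Translation invariance of the measure moves the shift onto the test function, which remains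
smooth and compactly supported. -/
theorem IsWeakDivFree.diffQuot {W : E → E} (hW : IsWeakDivFree W) (hl : LocL2 W) (h : ℝ) (e : E) :
    IsWeakDivFree (diffQuot h e W) := by
  intro ψ hψ hc
  have h1 : ∫ x, inner ℝ (W (x + h • e)) (gradient ψ x) = 0 := by
    have := hW (fun x => ψ (x + -(h • e))) (hψ.comp (contDiff_id.add contDiff_const))
      (hc.comp_homeomorph (Homeomorph.addRight (-(h • e))))
    rw [gradient_comp_add, ← integral_add_right_eq_self _ (h • e)] at this
    simpa using this
  have hg := (contDiff_gradient hψ).continuous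
  have hgc := hasCompactSupport_gradient hc
  have e1 : ∀ x, inner ℝ (NewtonDecomp.diffQuot h e W x) (gradient ψ x) =
      h⁻¹ * (inner ℝ (W (x + h • e)) (gradient ψ x) - inner ℝ (W x) (gradient ψ x)) := by
    intro x; rw [NewtonDecomp.diffQuot, real_inner_smul_left, inner_sub_left]
  simp only [e1]
  rw [integral_const_mul, integral_sub
    (integrable_inner_of_hasCompactSupport (hl.comp_add (h • e)) hg hgc)
    (integrable_inner_of_hasCompactSupport hl hg hgc), h1, hW ψ hψ hc]
  simp

theorem LocL2.integral_sq_add_le {G : Type*} [NormedAddCommGroup G] [NormedSpace ℝ G]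
    {v w : E → G} (hv : LocL2 v) (hw : LocL2 w) (R : ℝ) :
    ∫ x in ball 0 R, ‖v x + w x‖ ^ 2 ≤
      2 * (∫ x in ball 0 R, ‖v x‖ ^ 2) + 2 * ∫ x in ball 0 R, ‖w x‖ ^ 2 := by
  have i1 := (hv.integrableOn R).const_mul 2
  have i2 := (hw.integrableOn R).const_mul 2
  rw [← integral_const_mul, ← integral_const_mul, ← integral_add i1 i2]
  exact setIntegral_mono ((hv.add hw).integrableOn R) (i1.fun_add i2)
    (fun x => norm_add_sq_le _ _)

/-- The factor of order h⁻² is harmless: this bound serves only at fixed `h`, to pass the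
convergence of gradients to their quotients. -/
theorem LocL2.integral_sq_diffQuot_le {w : E → E} (hw : LocL2 w) {h : ℝ}
    (hh : h ∈ Ioc (0 : ℝ) 1) {e : E} (he : ‖e‖ ≤ 1) (R : ℝ) :
    ∫ x in ball 0 R, ‖NewtonDecomp.diffQuot h e w x‖ ^ 2 ≤
      4 * (h⁻¹) ^ 2 * ∫ x in ball 0 (R + 1), ‖w x‖ ^ 2 := by
  have h1 := (hw.comp_add (h • e)).integral_sq_add_le (hw.const_smul (-1)) R
  have h2 : ∫ x in ball 0 R, ‖w (x + h • e)‖ ^ 2 ≤ ∫ x in ball 0 (R + 1), ‖w x‖ ^ 2 := by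
    refine setIntegral_comp_add_le (g := fun x => ‖w x‖ ^ 2) (fun x => by positivity) _ _ _ ?_
      (hw.integrableOn _)
    rw [norm_smul, Real.norm_of_nonneg hh.1.le]
    nlinarith [hh.1, hh.2, norm_nonneg e]
  have h3 : ∫ x in ball 0 R, ‖w x‖ ^ 2 ≤ ∫ x in ball 0 (R + 1), ‖w x‖ ^ 2 :=
    setIntegral_mono_set (hw.integrableOn _) (Eventually.of_forall fun x => by positivity)
      (ball_subset_ball (by linarith)).eventuallyLE
  have e1 : ∀ x, ‖NewtonDecomp.diffQuot h e w x‖ ^ 2 =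
      (h⁻¹) ^ 2 * ‖w (x + h • e) + (-1 : ℝ) • w x‖ ^ 2 := by
    intro x
    rw [NewtonDecomp.diffQuot, norm_smul, mul_pow, Real.norm_eq_abs, sq_abs, neg_one_smul,
      sub_eq_add_neg]
  simp only [e1]
  rw [integral_const_mul]
  have h4 : ∫ x in ball 0 R, ‖(-1 : ℝ) • w x‖ ^ 2 = ∫ x in ball 0 R, ‖w x‖ ^ 2 := by simp
  rw [h4] at h1
  have : 0 ≤ (h⁻¹) ^ 2 := by positivity
  nlinarith

theorem IsGradLimit.diffQuot {p : E → E} (hp : IsGradLimit p) (hl : LocL2 p) {h : ℝ}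
    (hh : h ∈ Ioc (0 : ℝ) 1) {e : E} (he : ‖e‖ ≤ 1) : IsGradLimit (diffQuot h e p) := by
  obtain ⟨Φ, hΦ, hlim⟩ := hp
  refine ⟨fun n => NewtonDecomp.diffQuot h e (Φ n), fun n => contDiff_diffQuot (hΦ n) h e,
    fun R => ?_⟩
  refine squeeze_zero (fun n => integral_nonneg fun x => by positivity) (fun n => ?_)
    (by simpa using (hlim (R + 1)).const_mul (4 * (h⁻¹) ^ 2))
  have h1 : LocL2 fun x => gradient (Φ n) x - p x :=
    (LocL2.of_continuous (contDiff_gradient (hΦ n)).continuous).sub hl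
  have h2 := h1.integral_sq_diffQuot_le hh he R
  rw [gradient_diffQuot (hΦ n)]
  convert h2 using 5 with x
  simp only [NewtonDecomp.diffQuot, ← smul_sub]; congr 1; abel

theorem UnifElliptic.comp_add {B : ℝ → E → E →L[ℝ] E} (hB : UnifElliptic B) {e : E}
    (he : ‖e‖ ≤ 1) : UnifElliptic (fun h x => B h (x + h • e)) := by
  intro R
  obtain ⟨c, hc, H⟩ := hB (R + 1)
  refine ⟨c, hc, fun h hh x hx => H h hh _ ?_⟩
  rw [mem_ball_zero_iff] at hx ⊢
  have : ‖h • e‖ ≤ 1 := by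
    rw [norm_smul, Real.norm_of_nonneg hh.1.le]
    nlinarith [hh.1, hh.2, norm_nonneg e]
  linarith [norm_add_le x (h • e)]

/-- Differencing the equation reproduces its form: the coefficient is shifted, and the quotient of
`B`, acting on `p`, joins the right-hand side. -/
theorem diffQuot_flux (h : ℝ) (e : E) (B : E → E →L[ℝ] E) (p F : E → E) (x : E) :
    diffQuot h e (fun x => B x (p x) - F x) x =
      B (x + h • e) (diffQuot h e p x) - (diffQuot h e F x - diffQuot h e B x (p x)) := by
  simp only [diffQuot, map_smul, smul_apply, ← smul_sub, map_sub, sub_apply]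
  congr 1; abel

/-- One step of the regularity theory: difference quotients of solutions are bounded. -/
theorem unifL2_diffQuot_of_solution {e : E} (he : ‖e‖ ≤ 1) {p F : ℝ → E → E}
    {B : ℝ → E → E →L[ℝ] E} (hp : UnifL2 p) (hgl : ∀ h ∈ Ioc (0 : ℝ) 1, IsGradLimit (p h))
    (hB : UnifSmooth e B) (hell : UnifElliptic B) (hF : UnifSob e 1 F)
    (heq : ∀ h ∈ Ioc (0 : ℝ) 1, IsWeakDivFree (fun x => B h x (p h x) - F h x)) :
    UnifL2 (fun h => diffQuot h e (p h)) := by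
  refine ⟨fun h hh => (hp.locL2 h hh).diffQuot h e, fun R₀ => ?_⟩
  -- `caccioppoli` requires a positive radius. The constants that follow are all fixed before `h`.
  set R := max R₀ 1 with hR
  have hRpos : 0 < R := lt_max_of_lt_right one_pos
  obtain ⟨c, hc, hcoer⟩ := (hell.comp_add he) (R + 1)
  obtain ⟨M, hM⟩ := ((hB 0).comp_add he).bound (R + 1)
  obtain ⟨K, hK0, hK⟩ := caccioppoli (E := E) (M := M) hc hRpos
  obtain ⟨C, hC⟩ := hp.bound (R + 1 + 1)
  have hF' : UnifL2 (fun h x => diffQuot h e (F h) x - diffQuot h e (B h) x (p h x)) := by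
    have h1 : UnifL2 (fun h => diffQuot h e (F h)) := hF.2
    have h2 : UnifL2 (fun h x => diffQuot h e (B h) x (p h x)) := hp.clm_apply (hB 1)
    simpa only [sub_eq_add_neg] using h1.add h2.neg
  obtain ⟨C', hC'⟩ := hF'.bound (R + 1)
  refine ⟨K * (2 * C + C'), fun h hh => ?_⟩
  have hl := hp.locL2 h hh
  obtain ⟨Φ, hΦ, hlim⟩ := hgl h hh
  -- The right-hand side tends to twice the local energy of `p h`, which is bounded uniformly in
  -- `h`.
  have hD : ∀ n, ∫ x in ball 0 (R + 1), ‖diffQuot h e (Φ n) x‖ ^ 2 ≤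
      2 * (∫ x in ball 0 (R + 1 + 1), ‖gradient (Φ n) x - p h x‖ ^ 2) +
        2 * ∫ x in ball 0 (R + 1 + 1), ‖p h x‖ ^ 2 := by
    intro n
    refine (integral_sq_diffQuot_le (hΦ n) hh he (R + 1)).trans ?_
    have h1 : LocL2 fun x => gradient (Φ n) x - p h x :=
      (LocL2.of_continuous (contDiff_gradient (hΦ n)).continuous).sub hl
    simpa using h1.integral_sq_add_le hl (R + 1 + 1)
  have hgl' : Tendsto (fun n => ∫ x in ball 0 (R + 1),
      ‖gradient (diffQuot h e (Φ n)) x - diffQuot h e (p h) x‖ ^ 2) atTop (𝓝 0) := by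
    refine squeeze_zero (fun n => integral_nonneg fun x => by positivity) (fun n => ?_)
      (by simpa using (hlim (R + 1 + 1)).const_mul (4 * (h⁻¹) ^ 2))
    have h1 : LocL2 fun x => gradient (Φ n) x - p h x :=
      (LocL2.of_continuous (contDiff_gradient (hΦ n)).continuous).sub hl
    have h2 := h1.integral_sq_diffQuot_le hh he (R + 1)
    rw [gradient_diffQuot (hΦ n)]
    convert h2 using 5 with x
    simp only [NewtonDecomp.diffQuot, ← smul_sub]; congr 1; abel
  have hlimD := ((hlim (R + 1 + 1)).const_mul 2).add_const
    (2 * ∫ x in ball 0 (R + 1 + 1), ‖p h x‖ ^ 2)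
  have hBc : Continuous (B h) := (hB 0).continuous h hh
  have weak := (heq h hh).diffQuot ((hl.clm_apply hBc).sub (hF.1.locL2 h hh)) h e
  simp only [funext (diffQuot_flux h e (B h) (p h) (F h))] at weak
  have main := hK (fun x => B h (x + h • e)) (diffQuot h e (p h))
    (fun x => diffQuot h e (F h) x - diffQuot h e (B h) x (p h x))
    (fun n => diffQuot h e (Φ n)) _ _ (hBc.comp (by fun_prop)) (hcoer h hh) (hM h hh)
    (hl.diffQuot h e) (hF'.locL2 h hh) (fun n => contDiff_diffQuot (hΦ n) h e) hgl' hD hlimD weak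
  calc ∫ x in ball 0 R₀, ‖diffQuot h e (p h) x‖ ^ 2
      ≤ ∫ x in ball 0 R, ‖diffQuot h e (p h) x‖ ^ 2 :=
        setIntegral_mono_set ((hl.diffQuot h e).integrableOn _)
          (Eventually.of_forall fun x => by positivity)
          (ball_subset_ball (le_max_left _ _)).eventuallyLE
    _ ≤ _ := main
    _ ≤ K * (2 * C + C') := by
        gcongr
        · rw [mul_zero, zero_add]; gcongr; exact hC h hh
        · exact hC' h hh

/-- Interior regularity for `∇·(B p - F) = 0` in terms of difference quotients. -/
theorem unifSob_of_solution {e : E} (he : ‖e‖ ≤ 1) (k : ℕ) : ∀ {p F : ℝ → E → E}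
    {B : ℝ → E → E →L[ℝ] E}, UnifL2 p → (∀ h ∈ Ioc (0 : ℝ) 1, IsGradLimit (p h)) →
    UnifSmooth e B → UnifElliptic B → UnifSob e k F →
    (∀ h ∈ Ioc (0 : ℝ) 1, IsWeakDivFree (fun x => B h x (p h x) - F h x)) → UnifSob e k p := by
  induction k with
  | zero => intro p F B hp _ _ _ _ _; exact hp
  | succ k ih =>
    intro p F B hp hgl hB hell hF heq
    -- The differenced right-hand side involves `p` itself, so `k` orders for `p` are needed before
    -- passing to the equation of its quotient.
    have hpk : UnifSob e k p := ih hp hgl hB hell hF.mono heq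
    have hF1 : UnifSob e 1 F := ⟨hF.1, hF.2.unifL2⟩
    refine ⟨hp, ih (unifL2_diffQuot_of_solution he hp hgl hB hell hF1 heq)
      (fun h hh => (hgl h hh).diffQuot (hp.locL2 h hh) hh he) (hB.comp_add he)
      (hell.comp_add he) (hF.2.sub (UnifSob.clm_apply he hB.diffQuot hpk)) fun h hh => ?_⟩
    have weak := (heq h hh).diffQuot (((hp.locL2 h hh).clm_apply ((hB 0).continuous h hh)).sub
      (hF.1.locL2 h hh)) h e
    simpa only [funext (diffQuot_flux h e (B h) (p h) (F h))] using weak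

end InteriorRegularity

end NewtonDecomp

namespace NewtonDecomp

open Metric Set Filter Topology

set_option linter.unusedSectionVars false

/-! ### From bounded difference quotients to smoothness, through Fourier decay. -/

section FourierDecay

open FourierTransform

variable {E : Type*} [NormedAddCommGroup E] [InnerProductSpace ℝ E] [FiniteDimensional ℝ E]
  [MeasurableSpace E] [BorelSpace E]

theorem integral_fourier_smul_eq_of_integrable {u v : E → ℂ} (hu : Integrable u)
    (hv : Integrable v) : ∫ ξ, 𝓕 u ξ • v ξ = ∫ x, u x • 𝓕 v x := by
  simpa using! VectorFourier.integral_fourierIntegral_smul_eq_flip (L := innerₗ E)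
    Real.continuous_fourierChar continuous_inner hu hv

/-- An integrable function whose Fourier transform is integrable agrees almost everywhere with the
inverse transform of its transform. -/
theorem ae_eq_fourierInv_fourier {w : E → ℂ} (hw : Integrable w) (hw' : Integrable (𝓕 w)) :
    w =ᵐ[volume] 𝓕⁻ (𝓕 w) := by
  have hcont : Continuous (𝓕⁻ (𝓕 w)) := by
    have : 𝓕⁻ (𝓕 w) = fun x => 𝓕 (𝓕 w) (-x) := by
      ext x; exact Real.fourierInv_eq_fourier_neg _ _
    rw [this]
    exact (VectorFourier.fourierIntegral_continuous Real.continuous_fourierChar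
      (L := innerₗ E) continuous_inner hw').comp continuous_neg
  refine ae_eq_of_integral_contDiff_smul_eq hw.locallyIntegrable hcont.locallyIntegrable ?_
  intro g hg hgc
  have hgC : ContDiff ℝ ∞ fun x => (g x : ℂ) := Complex.ofRealCLM.contDiff.comp hg
  have hgcC : HasCompactSupport fun x => (g x : ℂ) := hgc.comp_left (g := Complex.ofReal) (by simp)
  -- Inversion is known for Schwartz functions, so it is applied to the test function; the
  -- transforms are then moved across by the exchange formula, twice.
  set s : SchwartzMap E ℂ := hgcC.toSchwartzMap hgC with hs
  have hs' : (s : E → ℂ) = fun x => (g x : ℂ) := by ext x; simp [hs]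
  have e1 : ∫ x, g x • w x = ∫ x, s x • w x := by simp [hs']
  have e2 : ∫ x, g x • 𝓕⁻ (𝓕 w) x = ∫ x, s x • 𝓕⁻ (𝓕 w) x := by simp [hs']
  rw [e1, e2]
  have hsi : Integrable (fun x => s (-x)) := s.integrable.comp_neg
  have f1 : 𝓕 (fun x => s (-x)) = 𝓕⁻ (s : E → ℂ) :=
    (Real.fourierInv_eq_fourier_comp_neg (s : E → ℂ)).symm
  have f2 : ((𝓕⁻ s : SchwartzMap E ℂ) : E → ℂ) = 𝓕⁻ (s : E → ℂ) := SchwartzMap.fourierInv_coe s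
  have f3 : 𝓕 (𝓕⁻ (s : E → ℂ)) = s := by
    rw [← f2, ← SchwartzMap.fourier_coe]; simp
  calc ∫ x, s x • w x = ∫ x, 𝓕 (𝓕⁻ (s : E → ℂ)) x • w x := by rw [f3]
    _ = ∫ x, 𝓕⁻ (s : E → ℂ) x • 𝓕 w x :=
        integral_fourier_smul_eq_of_integrable (by rw [← f2]; exact SchwartzMap.integrable _) hw
    _ = ∫ x, 𝓕 (fun x => s (-x)) x • 𝓕 w x := by rw [f1]
    _ = ∫ x, s (-x) • 𝓕 (𝓕 w) x := integral_fourier_smul_eq_of_integrable hsi hw'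
    _ = ∫ x, s x • 𝓕 (𝓕 w) (-x) := by
        rw [← integral_neg_eq_self]; simp
    _ = ∫ x, s x • 𝓕⁻ (𝓕 w) x := by simp_rw [Real.fourierInv_eq_fourier_neg]

theorem integrable_diffQuot {w : E → ℂ} (hw : Integrable w) (h : ℝ) (e : E) :
    Integrable (diffQuot h e w) := ((hw.comp_add_right (h • e)).sub hw).smul h⁻¹

theorem fourier_diffQuot {w : E → ℂ} (hw : Integrable w) (h : ℝ) (e ξ : E) :
    𝓕 (diffQuot h e w) ξ =
      ((h⁻¹ : ℝ) * (Complex.exp (2 * Real.pi * (h * inner ℝ e ξ : ℝ) * Complex.I) - 1)) * 𝓕 w ξ := by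
  have h1 : 𝓕 (fun x => w (x + h • e)) ξ =
      Complex.exp (2 * Real.pi * (h * inner ℝ e ξ : ℝ) * Complex.I) * 𝓕 w ξ := by
    have := congrFun (VectorFourier.fourierIntegral_comp_add_right Real.fourierChar volume (innerₗ E)
      w (h • e)) ξ
    simpa [Function.comp_def, Circle.smul_def, Real.fourierChar_apply, inner_smul_left] using! this
  have h2 : 𝓕 (diffQuot h e w) ξ = (h⁻¹ : ℝ) • (𝓕 (fun x => w (x + h • e)) ξ - 𝓕 w ξ) := by
    simp only [Real.fourier_eq]
    rw [← integral_sub, ← integral_smul]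
    · congr 1; ext x; rw [diffQuot, ← smul_sub, smul_comm]
    · exact (Real.fourierIntegral_convergent_iff ξ).2 (hw.comp_add_right (h • e))
    · exact (Real.fourierIntegral_convergent_iff ξ).2 hw
  rw [h2, h1, Complex.real_smul]; ring

theorem fourier_iterate_diffQuot {w : E → ℂ} (hw : Integrable w) (h : ℝ) (e ξ : E) (m : ℕ) :
    Integrable ((diffQuot h e)^[m] w) ∧ 𝓕 ((diffQuot h e)^[m] w) ξ =
      ((h⁻¹ : ℝ) * (Complex.exp (2 * Real.pi * (h * inner ℝ e ξ : ℝ) * Complex.I) - 1)) ^ m *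
        𝓕 w ξ := by
  induction m with
  | zero => simpa using hw
  | succ m ih =>
    rw [Function.iterate_succ_apply']
    refine ⟨integrable_diffQuot ih.1 h e, ?_⟩
    rw [fourier_diffQuot ih.1, ih.2]; ring

theorem tendsto_symbol (a : ℝ) :
    Tendsto (fun h : ℝ => ((h⁻¹ : ℝ) * (Complex.exp (2 * Real.pi * (h * a : ℝ) * Complex.I) - 1) : ℂ))
      (𝓝[>] 0) (𝓝 (2 * Real.pi * a * Complex.I)) := by
  have h1 : HasDerivAt (fun h : ℝ => Complex.exp (2 * Real.pi * (h * a : ℝ) * Complex.I))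
      (2 * Real.pi * a * Complex.I) 0 := by
    have h2 : HasDerivAt (fun h : ℝ => (2 * Real.pi * (h * a : ℝ) * Complex.I : ℂ))
        (2 * Real.pi * a * Complex.I) 0 := by
      have := (((hasDerivAt_id (0 : ℝ)).mul_const a).ofReal_comp.const_mul
        (2 * Real.pi : ℂ)).mul_const Complex.I
      simpa using this
    simpa using h2.cexp
  have := h1.tendsto_slope_zero_right
  simpa [Complex.real_smul] using this

/-- The transform of the iterated quotient is bounded by its L¹ norm, and its symbol tends to the
m-th power of 2πi⟨e, ξ⟩ as `h` tends to zero. The factor 2π is at least one and is dropped. -/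
theorem norm_fourier_le_of_bound {w : E → ℂ} (hw : Integrable w) {e : E} {m : ℕ} {C : ℝ}
    (hC : ∀ h ∈ Ioc (0 : ℝ) 1, ∫ x, ‖(diffQuot h e)^[m] w x‖ ≤ C) (ξ : E) :
    |inner ℝ e ξ| ^ m * ‖𝓕 w ξ‖ ≤ C := by
  have lim := (((tendsto_symbol (inner ℝ e ξ)).pow m).mul_const (𝓕 w ξ)).norm
  have bd : ∀ᶠ h in 𝓝[>] (0 : ℝ), ‖((h⁻¹ : ℝ) *
      (Complex.exp (2 * Real.pi * (h * inner ℝ e ξ : ℝ) * Complex.I) - 1) : ℂ) ^ m * 𝓕 w ξ‖ ≤ C := by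
    filter_upwards [Ioc_mem_nhdsGT (zero_lt_one (α := ℝ))] with h hh
    rw [← (fourier_iterate_diffQuot hw h e ξ m).2]
    exact (VectorFourier.norm_fourierIntegral_le_integral_norm _ _ _ _ _).trans (hC h hh)
  have := le_of_tendsto lim bd
  refine le_trans ?_ this
  rw [norm_mul, norm_pow]
  gcongr
  simp only [norm_mul, Complex.norm_real, Complex.norm_I, mul_one, Real.norm_eq_abs,
    Complex.norm_ofNat]
  rw [abs_of_pos Real.pi_pos]
  nlinarith [Real.pi_gt_three, abs_nonneg (inner ℝ e ξ)]

/-- Power mean inequality for the summands 1 and |⟨bᵢ, ξ⟩|². Indexing by `Option` accounts for the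
summand 1, so `N` is the dimension plus one. -/
theorem exists_bound_norm_pow_mul {u : E → ℂ}
    (hu : ∀ i, ∀ m : ℕ, ∃ C : ℝ, ∀ ξ, |inner ℝ (stdOrthonormalBasis ℝ E i) ξ| ^ m * ‖u ξ‖ ≤ C)
    (hu0 : ∃ C : ℝ, ∀ ξ, ‖u ξ‖ ≤ C) (M : ℕ) : ∃ C : ℝ, ∀ ξ, (1 + ‖ξ‖ ^ 2) ^ (M + 1) * ‖u ξ‖ ≤ C := by
  set b := stdOrthonormalBasis ℝ E
  choose C hC using fun i => hu i (2 * (M + 1))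
  obtain ⟨C0, hC0⟩ := hu0
  set N : ℕ := Fintype.card (Option (Fin (Module.finrank ℝ E))) with hN
  refine ⟨(N : ℝ) ^ M * (C0 + ∑ i, C i), fun ξ => ?_⟩
  have h1 : (1 + ‖ξ‖ ^ 2) ^ (M + 1) ≤
      (N : ℝ) ^ M * (1 + ∑ i, |inner ℝ (b i) ξ| ^ (2 * (M + 1))) := by
    have h2 := pow_sum_div_card_le_sum_pow (s := (Finset.univ : Finset (Option (Fin _))))
      (f := fun o : Option (Fin (Module.finrank ℝ E)) =>
        o.elim (1 : ℝ) fun i => |inner ℝ (b i) ξ| ^ 2)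
      (fun o _ => by cases o <;> simp [sq_nonneg]) M
    rw [div_le_iff₀ (by rw [Finset.card_univ]; positivity)] at h2
    simp only [Fintype.sum_option, Option.elim, one_pow, ← pow_mul] at h2
    rw [← b.sum_sq_norm_inner_right ξ]
    simpa [mul_comm, hN] using h2
  calc (1 + ‖ξ‖ ^ 2) ^ (M + 1) * ‖u ξ‖
      ≤ (N : ℝ) ^ M * (1 + ∑ i, |inner ℝ (b i) ξ| ^ (2 * (M + 1))) * ‖u ξ‖ := by gcongr
    _ = (N : ℝ) ^ M * (‖u ξ‖ + ∑ i, |inner ℝ (b i) ξ| ^ (2 * (M + 1)) * ‖u ξ‖) := by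
        rw [mul_assoc, add_mul, one_mul, Finset.sum_mul]
    _ ≤ (N : ℝ) ^ M * (C0 + ∑ i, C i) := by
        gcongr
        · exact hC0 ξ
        · exact hC _ ξ

theorem integrable_norm_pow_mul {u : E → ℂ} (hc : Continuous u)
    (hu : ∀ M : ℕ, ∃ C : ℝ, ∀ ξ, (1 + ‖ξ‖ ^ 2) ^ (M + 1) * ‖u ξ‖ ≤ C) (n : ℕ) :
    Integrable fun ξ => ‖ξ‖ ^ n * ‖u ξ‖ := by
  set d := Module.finrank ℝ E
  -- Of the `n + d + 1` powers available, `n` absorb `‖ξ‖ ^ n` and the other `d + 1` give an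
  -- integrable weight.
  obtain ⟨C, hC⟩ := hu (n + d)
  have hi := (integrable_rpow_neg_one_add_norm_sq (E := E) (μ := volume)
    (r := 2 * ((d : ℝ) + 1)) (by
      have : (0 : ℝ) ≤ d := by positivity
      change (d : ℝ) < _; linarith)).const_mul C
  refine hi.mono' (by fun_prop) (Eventually.of_forall fun ξ => ?_)
  have e1 : ((1 : ℝ) + ‖ξ‖ ^ 2) ^ (-(2 * ((d : ℝ) + 1)) / 2) = ((1 + ‖ξ‖ ^ 2) ^ (d + 1))⁻¹ := by
    rw [show -(2 * ((d : ℝ) + 1)) / 2 = -((d + 1 : ℕ) : ℝ) by push_cast; ring,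
      Real.rpow_neg (by positivity), Real.rpow_natCast]
  rw [e1, Real.norm_of_nonneg (by positivity), ← div_eq_mul_inv, le_div_iff₀ (by positivity)]
  refine le_trans ?_ (hC ξ)
  have : ‖ξ‖ ^ n ≤ (1 + ‖ξ‖ ^ 2) ^ n :=
    pow_le_pow_left₀ (norm_nonneg _) (by nlinarith [sq_nonneg (‖ξ‖ - 1)]) n
  calc ‖ξ‖ ^ n * ‖u ξ‖ * (1 + ‖ξ‖ ^ 2) ^ (d + 1)
      ≤ (1 + ‖ξ‖ ^ 2) ^ n * ‖u ξ‖ * (1 + ‖ξ‖ ^ 2) ^ (d + 1) := by gcongr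
    _ = _ := by ring

/-- An integrable function whose iterated difference quotients are bounded in `L¹` is smooth. -/
theorem exists_contDiff_ae_eq_of_diffQuot {w : E → ℂ} (hw : Integrable w)
    (H : ∀ e : E, ‖e‖ ≤ 1 → ∀ m : ℕ, ∃ C : ℝ, ∀ h ∈ Ioc (0 : ℝ) 1,
      ∫ x, ‖(diffQuot h e)^[m] w x‖ ≤ C) : ∃ g : E → ℂ, ContDiff ℝ ∞ g ∧ w =ᵐ[volume] g := by
  have hc : Continuous (𝓕 w) := VectorFourier.fourierIntegral_continuous Real.continuous_fourierChar
      (L := innerₗ E) continuous_inner hw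
  have hu := exists_bound_norm_pow_mul (u := 𝓕 w)
    (fun i m => by
      obtain ⟨C, hC⟩ := H (stdOrthonormalBasis ℝ E i) (by simp) m
      exact ⟨C, norm_fourier_le_of_bound hw hC⟩)
    ⟨∫ x, ‖w x‖, VectorFourier.norm_fourierIntegral_le_integral_norm _ _ _ _⟩
  have hi := integrable_norm_pow_mul hc hu
  have hF : Integrable (𝓕 w) := by
    have := hi 0
    simp only [pow_zero, one_mul] at this
    exact (integrable_norm_iff hc.aestronglyMeasurable).1 this
  refine ⟨𝓕⁻ (𝓕 w), ?_, ae_eq_fourierInv_fourier hw hF⟩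
  have : 𝓕⁻ (𝓕 w) = fun x => 𝓕 (𝓕 w) (-x) := by
    ext x; exact Real.fourierInv_eq_fourier_neg _ _
  rw [this]
  exact (Real.contDiff_fourier (N := ⊤) fun n _ => hi n).comp contDiff_neg

end FourierDecay

end NewtonDecomp

namespace NewtonDecomp

open Metric Set Filter Topology

set_option linter.unusedSectionVars false

/-! ### Gluing smooth representatives and recovering the potential. -/

section SmoothRepresentative

variable {E : Type*} [NormedAddCommGroup E] [InnerProductSpace ℝ E] [FiniteDimensional ℝ E]
  [MeasurableSpace E] [BorelSpace E]

theorem UnifSob.unifL2_iterate {G : Type*} [NormedAddCommGroup G] [NormedSpace ℝ G] {e : E}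
    {k : ℕ} : ∀ {w : ℝ → E → G}, UnifSob e k w → UnifL2 (fun h => (diffQuot h e)^[k] (w h)) := by
  induction k with
  | zero => intro w hw; exact hw
  | succ k ih => intro w hw; exact ih hw.2

/-- Each quotient enlarges the support by at most `‖h • e‖`, hence by at most one. -/
theorem iterate_diffQuot_eq_zero {G : Type*} [NormedAddCommGroup G] [NormedSpace ℝ G] {w : E → G}
    {R : ℝ} (hw : ∀ x, R ≤ ‖x‖ → w x = 0) {h : ℝ} (hh : h ∈ Ioc (0 : ℝ) 1) {e : E}
    (he : ‖e‖ ≤ 1) (m : ℕ) : ∀ x, R + m ≤ ‖x‖ → (diffQuot h e)^[m] w x = 0 := by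
  induction m with
  | zero => simpa using hw
  | succ m ih =>
    intro x hx
    push_cast at hx
    have hn : ‖h • e‖ ≤ 1 := by
      rw [norm_smul, Real.norm_of_nonneg hh.1.le]; nlinarith [hh.1, hh.2, norm_nonneg e]
    have h1 : ‖x‖ ≤ ‖x + h • e‖ + ‖h • e‖ := by
      simpa using norm_sub_le (x + h • e) (h • e)
    rw [Function.iterate_succ_apply', diffQuot, ih x (by linarith), ih (x + h • e) (by linarith)]
    simp

/-- The Fourier criterion is applied to the components of `p` times a cutoff. Cutoff and component
are packaged as one operator field `T`, so that the Leibniz rule for `UnifSob` covers the product.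
-/
theorem exists_contDiff_ae_eq_on_ball.{u} {E : Type u} [NormedAddCommGroup E]
    [InnerProductSpace ℝ E] [FiniteDimensional ℝ E] [MeasurableSpace E] [BorelSpace E]
    {p : E → E} (hp : LocL2 p) (H : ∀ e : E, ‖e‖ ≤ 1 → ∀ k, UnifSob e k (fun _ => p))
    {R : ℝ} (hR : 0 < R) :
    ∃ g : E → E, ContDiff ℝ ∞ g ∧ ∀ᵐ x ∂volume, x ∈ ball (0 : E) R → p x = g x := by
  let η : ContDiffBump (0 : E) := ⟨R, R + 1, hR, by linarith⟩
  have hη : ContDiff ℝ ∞ η := η.contDiff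
  set b := stdOrthonormalBasis ℝ E
  have comp : ∀ i, ∃ g : E → ℂ, ContDiff ℝ ∞ g ∧
      (fun x => ((η x * inner ℝ (b i) (p x) : ℝ) : ℂ)) =ᵐ[volume] g := by
    intro i
    set T : E → E →L[ℝ] ℂ := fun x => η x • (Complex.ofRealCLM ∘L innerSL ℝ (b i)) with hT
    have hTs : ContDiff ℝ ∞ T := hη.smul contDiff_const
    have hw : ∀ x, T x (p x) = ((η x * inner ℝ (b i) (p x) : ℝ) : ℂ) := by
      intro x; simp [hT]
    simp only [← hw]
    have h0 : ∀ x, R + 1 ≤ ‖x‖ → T x (p x) = 0 := by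
      intro x hx
      have : η x = 0 := by
        by_contra hne
        have : x ∈ Function.support η := hne
        rw [η.support_eq, mem_ball_zero_iff] at this
        exact absurd this (not_lt.2 hx)
      simp [hT, this]
    -- For functions supported in a ball, |v| ≤ 1 + |v|² turns L² bounds into the L¹ bounds that the
    -- criterion requires.
    have bd : ∀ {v : E → ℂ} {S : ℝ}, LocL2 v → (∀ x, S ≤ ‖x‖ → v x = 0) →
        Integrable v ∧ ∫ x, ‖v x‖ ≤ (∫ x in ball (0 : E) S, (1 : ℝ)) +
          ∫ x in ball 0 S, ‖v x‖ ^ 2 := by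
      intro v S hv hv0
      have i1 : IntegrableOn (fun _ : E => (1 : ℝ)) (ball 0 S) :=
        integrableOn_const measure_ball_lt_top.ne
      have i2 := hv.integrableOn S
      have le : ∀ x, ‖v x‖ ≤ 1 + ‖v x‖ ^ 2 := fun x => by nlinarith [sq_nonneg (‖v x‖ - 1)]
      have hon : IntegrableOn v (ball 0 S) :=
        Integrable.mono' (i1.fun_add i2) hv.aesm.restrict (Eventually.of_forall le)
      have hz : ∀ x, x ∉ ball (0 : E) S → v x = 0 := fun x hx => hv0 x (by simpa using hx)
      have hint : Integrable v := (integrableOn_iff_integrable_of_support_subset (fun x hx => by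
        by_contra hxb; exact hx (hz x hxb))).1 hon
      refine ⟨hint, ?_⟩
      rw [← integral_add i1 i2, ← setIntegral_eq_integral_of_forall_compl_eq_zero (s := ball 0 S)
        (fun x hx => by simp [hz x hx])]
      exact integral_mono hon.norm (i1.fun_add i2) le
    refine exists_contDiff_ae_eq_of_diffQuot
      (bd (hp.clm_apply hTs.continuous) h0).1 fun e he m => ?_
    have hS : UnifSob e m (fun _ x => T x (p x)) :=
      UnifSob.clm_apply he (unifSmooth_of_contDiff he hTs) (H e he m)
    have hS' := hS.unifL2_iterate
    obtain ⟨C, hC⟩ := hS'.bound (R + 1 + m)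
    refine ⟨(∫ x in ball (0 : E) (R + 1 + m), (1 : ℝ)) + C, fun h hh => ?_⟩
    refine (bd (hS'.locL2 h hh) (iterate_diffQuot_eq_zero h0 hh he m)).2.trans ?_
    gcongr
    exact hC h hh
  choose g hg hae using comp
  refine ⟨fun x => ∑ i, (g i x).re • b i, ?_, ?_⟩
  · exact ContDiff.sum fun i _ => (Complex.reCLM.contDiff.comp (hg i)).smul contDiff_const
  · filter_upwards [ae_all_iff.2 hae] with x hx hxR
    have : η x = 1 := η.one_of_mem_closedBall (ball_subset_closedBall hxR)
    conv_lhs => rw [← b.sum_repr' (p x)]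
    refine Finset.sum_congr rfl fun i _ => ?_
    rw [← hx i, this]; simp

theorem exists_contDiff_ae_eq_of_locally {p : E → E}
    (H : ∀ R : ℝ, 0 < R → ∃ g : E → E, ContDiff ℝ ∞ g ∧
      ∀ᵐ x ∂volume, x ∈ ball (0 : E) R → p x = g x) :
    ∃ g : E → E, ContDiff ℝ ∞ g ∧ p =ᵐ[volume] g := by
  -- The radius `n + 1` is positive for every `n` and strictly exceeds `‖x‖` when `n = ⌈‖x‖⌉₊`, the
  -- index used for gluing.
  choose g hg hae using fun n : ℕ => H (n + 1) (by positivity)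
  have agree : ∀ k n : ℕ, k ≤ n → ∀ x ∈ ball (0 : E) (k + 1), g k x = g n x := by
    intro k n hkn
    have hk : (k : ℝ) ≤ n := by exact_mod_cast hkn
    refine Measure.eqOn_open_of_ae_eq (μ := volume) ?_ isOpen_ball
      (hg k).continuous.continuousOn (hg n).continuous.continuousOn
    refine (ae_restrict_iff' measurableSet_ball).2 ?_
    filter_upwards [hae k, hae n] with x h1 h2 hx
    rw [← h1 hx, ← h2 (ball_subset_ball (by linarith) hx)]
  have key : ∀ n : ℕ, ∀ x ∈ ball (0 : E) n, g ⌈‖x‖⌉₊ x = g n x := by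
    intro n x hx
    rw [mem_ball_zero_iff] at hx
    refine agree _ _ (Nat.ceil_le.2 hx.le) x ?_
    rw [mem_ball_zero_iff]
    linarith [Nat.le_ceil ‖x‖]
  refine ⟨fun x => g ⌈‖x‖⌉₊ x, contDiff_iff_contDiffAt.2 fun x => ?_, ?_⟩
  · obtain ⟨n, hn⟩ := exists_nat_gt ‖x‖
    refine (hg n).contDiffAt.congr_of_eventuallyEq ?_
    filter_upwards [isOpen_ball.mem_nhds (mem_ball_zero_iff.2 hn)] with y hy
    exact key n y hy
  · filter_upwards [ae_all_iff.2 hae] with x hx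
    exact hx _ (by rw [mem_ball_zero_iff]; linarith [Nat.le_ceil ‖x‖])

theorem integral_mul_fderiv_eq_neg {a b : E → ℝ} (ha : ContDiff ℝ 1 a) (hb : ContDiff ℝ 1 b)
    (hc : HasCompactSupport b) (v : E) :
    ∫ x, a x * fderiv ℝ b x v = -∫ x, fderiv ℝ a x v * b x := by
  have ha' : Continuous fun x => fderiv ℝ a x v :=
    (ha.continuous_fderiv one_ne_zero).clm_apply continuous_const
  have hb' : Continuous fun x => fderiv ℝ b x v :=
    (hb.continuous_fderiv one_ne_zero).clm_apply continuous_const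
  have hc' : HasCompactSupport fun x => fderiv ℝ b x v := hc.fderiv_apply (𝕜 := ℝ) v
  exact integral_mul_fderiv_eq_neg_fderiv_mul_of_integrable
    ((ha'.mul hb.continuous).integrable_of_hasCompactSupport hc.mul_left)
    ((ha.continuous.mul hb').integrable_of_hasCompactSupport hc'.mul_left)
    ((ha.continuous.mul hb.continuous).integrable_of_hasCompactSupport hc.mul_left)
    (fun x _ => ha.differentiable one_ne_zero x) (fun x _ => hb.differentiable one_ne_zero x)

/-- Young's inequality with weight `lam`: letting `n` grow kills the approximation error, and then
letting `lam` grow kills the term in `k`. -/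
theorem integral_inner_eq_zero_of_tendsto {g k : E → E} (hg : LocL2 g) (hk : Continuous k)
    (hc : HasCompactSupport k) (hgl : IsGradLimit g)
    (h0 : ∀ Φ : E → ℝ, ContDiff ℝ ∞ Φ → ∫ x, inner ℝ (gradient Φ x) (k x) = 0) :
    ∫ x, inner ℝ (g x) (k x) = 0 := by
  obtain ⟨Φ, hΦ, hlim⟩ := hgl
  obtain ⟨R, hR⟩ := hc.isCompact.isBounded.subset_ball 0
  have hz : ∀ x, x ∉ ball (0 : E) R → k x = 0 := fun x hx =>
    image_eq_zero_of_notMem_tsupport fun h => hx (hR h)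
  have hk2 := (LocL2.of_continuous hk).integrableOn R
  set K := ∫ x in ball 0 R, ‖k x‖ ^ 2
  have bd : ∀ (lam : ℝ), 0 < lam → ∀ n, 2 * |∫ x, inner ℝ (g x) (k x)| ≤
      lam * (∫ x in ball 0 R, ‖gradient (Φ n) x - g x‖ ^ 2) + lam⁻¹ * K := by
    intro lam hlam n
    have hgr : LocL2 (gradient (Φ n)) := .of_continuous (contDiff_gradient (hΦ n)).continuous
    have hd := (hgr.sub hg).integrableOn R
    have e1 : ∫ x, inner ℝ (g x) (k x) =
        -∫ x in ball 0 R, inner ℝ (gradient (Φ n) x - g x) (k x) := by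
      rw [setIntegral_eq_integral_of_forall_compl_eq_zero (fun x hx => by simp [hz x hx])]
      simp only [inner_sub_left]
      rw [integral_sub (integrable_inner_of_hasCompactSupport hgr hk hc)
        (integrable_inner_of_hasCompactSupport hg hk hc), h0 _ (hΦ n)]
      simp
    rw [e1, abs_neg, ← integral_const_mul, ← integral_const_mul,
      ← integral_add (hd.const_mul _) (hk2.const_mul _)]
    have := abs_integral_le_integral_abs (μ := volume.restrict (ball 0 R))
      (f := fun x => inner ℝ (gradient (Φ n) x - g x) (k x))
    refine (mul_le_mul_of_nonneg_left this zero_le_two).trans ?_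
    rw [← integral_const_mul]
    have hI := (integrable_inner_of_hasCompactSupport (hgr.sub hg) hk hc).integrableOn
      (s := ball (0 : E) R)
    refine integral_mono (hI.abs.const_mul 2) ((hd.const_mul _).fun_add (hk2.const_mul _))
      fun x => ?_
    have h1 := abs_real_inner_le_norm (gradient (Φ n) x - g x) (k x)
    have h2 : 0 ≤ lam⁻¹ * (lam * ‖gradient (Φ n) x - g x‖ - ‖k x‖) ^ 2 := by positivity
    have h3 : lam⁻¹ * (lam * ‖gradient (Φ n) x - g x‖ - ‖k x‖) ^ 2 =
        lam * ‖gradient (Φ n) x - g x‖ ^ 2 + lam⁻¹ * ‖k x‖ ^ 2 -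
          2 * (‖gradient (Φ n) x - g x‖ * ‖k x‖) := by field_simp; ring
    dsimp only
    linarith
  have bd' : ∀ lam : ℝ, 0 < lam → 2 * |∫ x, inner ℝ (g x) (k x)| ≤ lam⁻¹ * K := fun lam hlam => by
    simpa using ge_of_tendsto' (((hlim R).const_mul lam).add_const (lam⁻¹ * K)) (bd lam hlam)
  have lim : Tendsto (fun lam : ℝ => lam⁻¹ * K) atTop (𝓝 (0 * K)) :=
    tendsto_inv_atTop_zero.mul_const K
  have := ge_of_tendsto lim ((eventually_gt_atTop 0).mono bd')
  rw [zero_mul] at this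
  exact abs_eq_zero.1 (le_antisymm (by linarith) (abs_nonneg _))

/-- A smooth field that is a limit of gradients is a gradient. -/
theorem exists_gradient_eq_of_isGradLimit {g : E → E} (hg : ContDiff ℝ ∞ g)
    (hgl : IsGradLimit g) : ∃ Φ : E → ℝ, ContDiff ℝ ∞ Φ ∧ gradient Φ = g := by
  have hgd : Differentiable ℝ g := hg.differentiable (by simp)
  have hg' : Continuous (fderiv ℝ g) := hg.continuous_fderiv (by simp)
  -- The curl is tested against `ψ` and integrated by parts; the identity then passes from gradients
  -- to their limit `g`.
  have curl : ∀ v w : E, ∀ x, inner ℝ (fderiv ℝ g x v) w = inner ℝ (fderiv ℝ g x w) v := by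
    intro v w
    have hs : Continuous fun x => inner ℝ (fderiv ℝ g x v) w - inner ℝ (fderiv ℝ g x w) v := by
      fun_prop
    have hae := ae_eq_zero_of_integral_contDiff_smul_eq_zero (μ := (volume : Measure E))
      hs.locallyIntegrable fun ψ hψ hc => ?_
    · have := (Continuous.ae_eq_iff_eq volume hs continuous_const).1 hae
      exact fun x => sub_eq_zero.1 (congrFun this x)
    have hψ1 : ∀ u : E, ContDiff ℝ 1 fun x => fderiv ℝ ψ x u := fun u =>
      ((hψ.fderiv_right (m := ∞) (by simp)).clm_apply contDiff_const).of_le (by simp)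
    have hψc : ∀ u : E, HasCompactSupport fun x => fderiv ℝ ψ x u := fun u =>
      hc.fderiv_apply (𝕜 := ℝ) u
    have parts : ∀ v w : E, ∫ x, ψ x * inner ℝ (fderiv ℝ g x v) w =
        -∫ x, inner ℝ (g x) (fderiv ℝ ψ x v • w) := by
      intro v w
      have h1 := integral_mul_fderiv_eq_neg (a := fun x => inner ℝ (g x) w)
        ((hg.of_le (by simp)).inner ℝ contDiff_const) (hψ.of_le (by simp)) hc v
      have h2 : ∀ x, fderiv ℝ (fun x => inner ℝ (g x) w) x v = inner ℝ (fderiv ℝ g x v) w := by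
        intro x
        rw [fderiv_inner_apply ℝ (hgd x) (differentiableAt_const w)]; simp
      simp only [h2] at h1
      simp only [inner_smul_right, mul_comm (ψ _)]
      rw [← neg_eq_iff_eq_neg, ← h1]
      simp only [mul_comm]
    have hci : ∀ v w : E, Integrable fun x => ψ x * inner ℝ (fderiv ℝ g x v) w := fun v w =>
      Continuous.integrable_of_hasCompactSupport
        (hψ.continuous.mul (by fun_prop)) hc.mul_right
    simp only [smul_eq_mul, mul_sub]
    rw [integral_sub (hci v w) (hci w v), parts, parts]
    have kc : ∀ v w : E, Continuous fun x => fderiv ℝ ψ x v • w := fun v w =>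
      (hψ1 v).continuous.smul continuous_const
    have kcs : ∀ v w : E, HasCompactSupport fun x => fderiv ℝ ψ x v • w := fun v w =>
      (hψc v).smul_right
    have hl : LocL2 g := .of_continuous hg.continuous
    -- This compactly supported field is orthogonal to every smooth gradient, by symmetry of the
    -- second derivative of `ψ`.
    have key : ∫ x, inner ℝ (g x) (fderiv ℝ ψ x w • v - fderiv ℝ ψ x v • w) = 0 := by
      refine integral_inner_eq_zero_of_tendsto hl ((kc w v).sub (kc v w))
        ((kcs w v).sub (kcs v w)) hgl fun Φ hΦ => ?_
      have hgr : LocL2 (gradient Φ) := .of_continuous (contDiff_gradient hΦ).continuous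
      simp only [inner_sub_right]
      rw [integral_sub (integrable_inner_of_hasCompactSupport hgr (kc w v) (kcs w v))
        (integrable_inner_of_hasCompactSupport hgr (kc v w) (kcs v w))]
      have p1 : ∀ v w : E, ∫ x, inner ℝ (gradient Φ x) (fderiv ℝ ψ x w • v) =
          -∫ x, Φ x * fderiv ℝ (fderiv ℝ ψ) x v w := by
        intro v w
        have h1 := integral_mul_fderiv_eq_neg (hΦ.of_le (by simp)) (hψ1 w) (hψc w) v
        have h2 : ∀ x, fderiv ℝ (fun x => fderiv ℝ ψ x w) x v = fderiv ℝ (fderiv ℝ ψ) x v w := by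
          intro x
          have hd : DifferentiableAt ℝ (fderiv ℝ ψ) x :=
            (hψ.fderiv_right (m := ∞) (by simp)).differentiable (by simp) x
          rw [fderiv_clm_apply hd (differentiableAt_const w)]; simp
        simp only [h2] at h1
        rw [h1, neg_neg]
        congr 1; ext x; rw [inner_smul_right, inner_gradient, mul_comm]
      rw [p1, p1]
      have sym : ∀ x, fderiv ℝ (fderiv ℝ ψ) x v w = fderiv ℝ (fderiv ℝ ψ) x w v := fun x =>
        (hψ.contDiffAt (x := x)).isSymmSndFDerivAt
          (by simpa using WithTop.coe_le_coe.2 (le_top (a := (2 : ℕ∞)))) v w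
      simp only [sym]; simp
    simp only [inner_sub_right] at key
    rw [integral_sub (integrable_inner_of_hasCompactSupport hl (kc w v) (kcs w v))
        (integrable_inner_of_hasCompactSupport hl (kc v w) (kcs v w))] at key
    linarith
  set θ : E → E →L[ℝ] ℝ := fun x => InnerProductSpace.toDual ℝ E (g x) with hθ
  have hθs : ContDiff ℝ ∞ θ :=
    (InnerProductSpace.toDual ℝ E).toContinuousLinearEquiv.contDiff.comp hg
  have hθd : ∀ x v w, fderiv ℝ θ x v w = inner ℝ (fderiv ℝ g x v) w := by
    intro x v w
    have h1 : fderiv ℝ (fun y => θ y w) x v = fderiv ℝ θ x v w := by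
      rw [fderiv_clm_apply (hθs.differentiable (by simp) x) (differentiableAt_const w)]; simp
    rw [← h1]
    simp only [hθ, InnerProductSpace.toDual_apply_apply]
    rw [fderiv_inner_apply ℝ (hgd x) (differentiableAt_const w)]; simp
  -- Poincaré lemma for the closed one-form dual to `g`.
  obtain ⟨Φ, hΦ⟩ := (convex_univ (𝕜 := ℝ) (E := E)).exists_forall_hasFDerivAt_of_fderiv_symmetric
    isOpen_univ (hθs.differentiable (by simp)).differentiableOn
    (fun x _ v w => by rw [hθd, hθd, curl])
  have hfd : fderiv ℝ Φ = θ := funext fun x => (hΦ x (mem_univ x)).fderiv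
  refine ⟨Φ, ?_, ?_⟩
  · have : ContDiff ℝ (∞ + 1) Φ := contDiff_succ_iff_fderiv.2
      ⟨fun x => (hΦ x (mem_univ x)).differentiableAt, by simp, hfd ▸ hθs⟩
    simpa using this
  · ext1 x; rw [gradient, hfd, hθ]; simp

/-- Minimise over the compact product of the closed ball and the unit sphere, then scale by
homogeneity. The product can be empty, for a negative radius or in dimension zero. -/
theorem exists_coercive_on_ball {B : E → E →L[ℝ] E} (hB : Continuous B)
    (hpos : ∀ x v, v ≠ 0 → 0 < inner ℝ (B x v) v) (R : ℝ) :
    ∃ c > 0, ∀ x ∈ ball (0 : E) R, ∀ v, c * ‖v‖ ^ 2 ≤ inner ℝ (B x v) v := by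
  set S : Set (E × E) := closedBall 0 R ×ˢ sphere 0 1 with hS
  have hSc : IsCompact S := (isCompact_closedBall 0 R).prod (isCompact_sphere 0 1)
  have hf : Continuous fun z : E × E => inner ℝ (B z.1 z.2) z.2 := by fun_prop
  obtain ⟨c, hc, hmin⟩ : ∃ c > 0, ∀ z ∈ S, c ≤ inner ℝ (B z.1 z.2) z.2 := by
    rcases S.eq_empty_or_nonempty with he | hne
    · exact ⟨1, one_pos, fun z hz => by simp [he] at hz⟩
    · obtain ⟨z, hz, hzm⟩ := hSc.exists_isMinOn hne hf.continuousOn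
      refine ⟨_, hpos z.1 z.2 ?_, fun y hy => hzm hy⟩
      intro h0
      have := hz.2
      simp [h0] at this
  refine ⟨c, hc, fun x hx v => ?_⟩
  rcases eq_or_ne v 0 with rfl | hv
  · simp
  have hn : 0 < ‖v‖ := norm_pos_iff.2 hv
  have h1 := hmin (x, ‖v‖⁻¹ • v) ⟨ball_subset_closedBall hx, by simp [norm_smul, hn.ne']⟩
  simp only [map_smul, inner_smul_left, inner_smul_right] at h1
  have h2 : ‖v‖⁻¹ * (‖v‖⁻¹ * inner ℝ (B x v) v) = inner ℝ (B x v) v / ‖v‖ ^ 2 := by field_simp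
  simp only [conj_trivial] at h1
  rw [h2, le_div_iff₀ (by positivity)] at h1
  exact h1

/-- Interior regularity: a weak solution of `∇·(B p - F) = 0` which is a limit of gradients is
the gradient of a smooth function. -/
theorem exists_smooth_potential.{u} {E : Type u} [NormedAddCommGroup E]
    [InnerProductSpace ℝ E] [FiniteDimensional ℝ E] [MeasurableSpace E] [BorelSpace E]
    {p F : E → E} {B : E → E →L[ℝ] E} (hp : LocL2 p)
    (hgl : IsGradLimit p) (hB : ContDiff ℝ ∞ B)
    (hpos : ∀ x v, v ≠ 0 → 0 < inner ℝ (B x v) v) (hF : ContDiff ℝ ∞ F)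
    (heq : IsWeakDivFree fun x => B x (p x) - F x) :
    ∃ Φ : E → ℝ, ContDiff ℝ ∞ Φ ∧ p =ᵐ[volume] gradient Φ := by
  have hell : UnifElliptic fun _ => B := fun R => by
    obtain ⟨c, hc, H⟩ := exists_coercive_on_ball hB.continuous hpos R
    exact ⟨c, hc, fun _ _ => H⟩
  have hpu : UnifL2 fun _ => p := ⟨fun _ _ => hp, fun R => ⟨_, fun _ _ => le_rfl⟩⟩
  have H : ∀ e : E, ‖e‖ ≤ 1 → ∀ k, UnifSob e k (fun _ => p) := fun e he k =>
    unifSob_of_solution he k hpu (fun _ _ => hgl) (unifSmooth_of_contDiff he hB) hell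
      (unifSmooth_of_contDiff he hF).unifSob fun _ _ => heq
  obtain ⟨g, hg, hpg⟩ := exists_contDiff_ae_eq_of_locally fun R hR =>
    exists_contDiff_ae_eq_on_ball hp H hR
  have hgl' : IsGradLimit g := by
    obtain ⟨Φ, hΦ, hlim⟩ := hgl
    refine ⟨Φ, hΦ, fun R => (hlim R).congr fun n => ?_⟩
    refine integral_congr_ae (ae_restrict_of_ae ?_)
    filter_upwards [hpg] with x hx
    rw [hx]
  obtain ⟨Φ, hΦ, hΦg⟩ := exists_gradient_eq_of_isGradLimit hg hgl'
  exact ⟨Φ, hΦ, hΦg ▸ hpg⟩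

end SmoothRepresentative

end NewtonDecomp

namespace NewtonDecomp

open Metric Set Filter Topology

set_option linter.unusedSectionVars false

/-! ### The Hilbert space of finite-energy fields, handled through sequences. -/

section EnergyProjection

/-- Fatou's lemma, with integrability of the limit included. -/
theorem integrable_and_integral_le_of_tendsto {α : Type*} [MeasurableSpace α] {μ : Measure α}
    {g : ℕ → α → ℝ} {g' : α → ℝ} {C : ℝ} (hg : ∀ m, Integrable (g m) μ) (h0 : ∀ m x, 0 ≤ g m x)
    (hC : ∀ᶠ m in atTop, ∫ x, g m x ∂μ ≤ C)
    (hlim : ∀ᵐ x ∂μ, Tendsto (fun m => g m x) atTop (𝓝 (g' x))) :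
    Integrable g' μ ∧ ∫ x, g' x ∂μ ≤ C := by
  have hm : AEStronglyMeasurable g' μ :=
    aestronglyMeasurable_of_tendsto_ae atTop (fun m => (hg m).aestronglyMeasurable) hlim
  have h0' : 0 ≤ᵐ[μ] g' := by
    filter_upwards [hlim] with x hx
    exact ge_of_tendsto' hx fun m => h0 m x
  have hC0 : 0 ≤ C := by
    obtain ⟨m, hm⟩ := hC.exists
    exact (integral_nonneg (h0 m)).trans hm
  have key : ∫⁻ x, ENNReal.ofReal (g' x) ∂μ ≤ ENNReal.ofReal C := by
    calc ∫⁻ x, ENNReal.ofReal (g' x) ∂μ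
        = ∫⁻ x, liminf (fun m => ENNReal.ofReal (g m x)) atTop ∂μ := by
          refine lintegral_congr_ae ?_
          filter_upwards [hlim] with x hx
          exact ((ENNReal.continuous_ofReal.tendsto _).comp hx).liminf_eq.symm
      _ ≤ liminf (fun m => ∫⁻ x, ENNReal.ofReal (g m x) ∂μ) atTop :=
          lintegral_liminf_le' fun m => (hg m).aestronglyMeasurable.aemeasurable.ennreal_ofReal
      _ ≤ ENNReal.ofReal C := by
          refine liminf_le_of_frequently_le' (Eventually.frequently ?_)
          filter_upwards [hC] with m hm
          rw [← ofReal_integral_eq_lintegral_ofReal (hg m) (Eventually.of_forall (h0 m))]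
          exact ENNReal.ofReal_le_ofReal hm
  have hint : Integrable g' μ := by
    refine ⟨hm, ?_⟩
    rw [hasFiniteIntegral_iff_ofReal h0']
    exact key.trans_lt ENNReal.ofReal_lt_top
  refine ⟨hint, ?_⟩
  rwa [← ofReal_integral_eq_lintegral_ofReal hint h0', ENNReal.ofReal_le_ofReal_iff hC0] at key

variable {E : Type*} [NormedAddCommGroup E] [InnerProductSpace ℝ E] [FiniteDimensional ℝ E]
  [MeasurableSpace E] [BorelSpace E]

/-- A continuous field of symmetric positive definite operators. -/
structure IsEnergyForm (B : E → E →L[ℝ] E) : Prop where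
  continuous : Continuous B
  symm : ∀ x v w, inner ℝ (B x v) w = inner ℝ (B x w) v
  pos : ∀ x v, v ≠ 0 → 0 < inner ℝ (B x v) v

/-- The field `v` is measurable and has finite `B`-energy. -/
structure FinEnergy (B : E → E →L[ℝ] E) (v : E → E) : Prop where
  aesm : AEStronglyMeasurable v volume
  integrable : Integrable fun x => inner ℝ (B x (v x)) (v x)

/-- The `B`-energy of a field. -/
noncomputable def energy (B : E → E →L[ℝ] E) (v : E → E) : ℝ := ∫ x, inner ℝ (B x (v x)) (v x)

variable {B : E → E →L[ℝ] E}

theorem IsEnergyForm.nonneg (hB : IsEnergyForm B) (x v : E) : 0 ≤ inner ℝ (B x v) v := by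
  rcases eq_or_ne v 0 with rfl | hv
  · simp
  · exact (hB.pos x v hv).le

theorem IsEnergyForm.add_sq (hB : IsEnergyForm B) (x v w : E) :
    inner ℝ (B x (v + w)) (v + w) =
      inner ℝ (B x v) v + 2 * inner ℝ (B x v) w + inner ℝ (B x w) w := by
  simp only [map_add, inner_add_left, inner_add_right, hB.symm x w v]; ring

theorem IsEnergyForm.abs_two_inner_le (hB : IsEnergyForm B) (x v w : E) :
    |2 * inner ℝ (B x v) w| ≤ inner ℝ (B x v) v + inner ℝ (B x w) w := by
  have h1 := hB.add_sq x v w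
  have h2 := hB.add_sq x v (-w)
  have h3 := hB.nonneg x (v + w)
  have h4 := hB.nonneg x (v + -w)
  simp only [map_neg, inner_neg_left, inner_neg_right, neg_neg] at h2
  rw [abs_le]; constructor <;> linarith

theorem IsEnergyForm.aesm_inner (hB : IsEnergyForm B) {v w : E → E}
    (hv : AEStronglyMeasurable v volume) (hw : AEStronglyMeasurable w volume) :
    AEStronglyMeasurable (fun x => inner ℝ (B x (v x)) (w x)) volume :=
  (ContinuousLinearMap.aestronglyMeasurable_comp₂ (ContinuousLinearMap.id ℝ (E →L[ℝ] E))
      hB.continuous.aestronglyMeasurable hv).inner hw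

theorem FinEnergy.integrable_inner (hB : IsEnergyForm B) {v w : E → E} (hv : FinEnergy B v)
    (hw : FinEnergy B w) : Integrable fun x => inner ℝ (B x (v x)) (w x) := by
  have : Integrable fun x => 2 * inner ℝ (B x (v x)) (w x) :=
    (hv.integrable.fun_add hw.integrable).mono' ((hB.aesm_inner hv.aesm hw.aesm).const_mul 2)
      (Eventually.of_forall fun x => hB.abs_two_inner_le x (v x) (w x))
  simpa using this.const_mul 2⁻¹

theorem FinEnergy.add (hB : IsEnergyForm B) {v w : E → E} (hv : FinEnergy B v)
    (hw : FinEnergy B w) : FinEnergy B fun x => v x + w x := by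
  refine ⟨hv.aesm.add hw.aesm, ?_⟩
  simp only [hB.add_sq]
  exact (hv.integrable.fun_add ((hv.integrable_inner hB hw).const_mul 2)).fun_add hw.integrable

theorem FinEnergy.const_smul {v : E → E} (hv : FinEnergy B v) (c : ℝ) :
    FinEnergy B fun x => c • v x := by
  refine ⟨hv.aesm.const_smul c, ?_⟩
  simp only [map_smul, inner_smul_left, inner_smul_right, conj_trivial]
  exact (hv.integrable.const_mul c).const_mul c

theorem FinEnergy.sub (hB : IsEnergyForm B) {v w : E → E} (hv : FinEnergy B v)
    (hw : FinEnergy B w) : FinEnergy B fun x => v x - w x := by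
  simpa [sub_eq_add_neg] using hv.add hB (hw.const_smul (-1))

theorem energy_nonneg (hB : IsEnergyForm B) (v : E → E) : 0 ≤ energy B v :=
  integral_nonneg fun x => hB.nonneg x (v x)

theorem energy_smul (v : E → E) (c : ℝ) : energy B (fun x => c • v x) = c ^ 2 * energy B v := by
  simp only [energy, map_smul, inner_smul_left, inner_smul_right, conj_trivial]
  rw [← integral_const_mul]; congr 1; ext x; ring

theorem energy_add (hB : IsEnergyForm B) {v w : E → E} (hv : FinEnergy B v)
    (hw : FinEnergy B w) : energy B (fun x => v x + w x) =
      energy B v + 2 * (∫ x, inner ℝ (B x (v x)) (w x)) + energy B w := by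
  have hvw := (hv.integrable_inner hB hw).const_mul 2
  simp only [energy, hB.add_sq]
  rw [integral_add (hv.integrable.fun_add hvw) hw.integrable, integral_add hv.integrable hvw,
    integral_const_mul]

theorem energy_sub (hB : IsEnergyForm B) {v w : E → E} (hv : FinEnergy B v)
    (hw : FinEnergy B w) : energy B (fun x => v x - w x) =
      energy B v - 2 * (∫ x, inner ℝ (B x (v x)) (w x)) + energy B w := by
  have h := energy_add hB hv (hw.const_smul (-1))
  rw [energy_smul] at h
  simp only [inner_smul_right, integral_const_mul] at h
  simp only [neg_smul, one_smul, ← sub_eq_add_neg] at h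
  rw [h]; ring

theorem setIntegral_sq_le_energy (hB : IsEnergyForm B) {v : E → E} (hv : FinEnergy B v) {R c : ℝ}
    (hc : 0 < c) (hcoer : ∀ x ∈ ball (0 : E) R, ∀ v, c * ‖v‖ ^ 2 ≤ inner ℝ (B x v) v) :
    IntegrableOn (fun x => ‖v x‖ ^ 2) (ball 0 R) ∧
      ∫ x in ball 0 R, ‖v x‖ ^ 2 ≤ c⁻¹ * energy B v := by
  have hle : ∀ x ∈ ball (0 : E) R, ‖v x‖ ^ 2 ≤ c⁻¹ * inner ℝ (B x (v x)) (v x) := fun x hx => by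
    rw [inv_mul_eq_div, le_div_iff₀' hc]; exact hcoer x hx _
  have hi := hv.integrable.const_mul c⁻¹
  have hon : IntegrableOn (fun x => ‖v x‖ ^ 2) (ball 0 R) :=
    hi.integrableOn.mono' (hv.aesm.norm.pow 2).restrict
      ((ae_restrict_iff' measurableSet_ball).2 (Eventually.of_forall fun x hx => by
        simpa using hle x hx))
  refine ⟨hon, (setIntegral_mono_on hon hi.integrableOn measurableSet_ball hle).trans ?_⟩
  rw [energy, ← integral_const_mul]
  exact setIntegral_le_integral hi (Eventually.of_forall fun x =>
    mul_nonneg (inv_nonneg.2 hc.le) (hB.nonneg x _))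

theorem FinEnergy.locL2 (hB : IsEnergyForm B) {v : E → E} (hv : FinEnergy B v) : LocL2 v :=
  ⟨hv.aesm, fun R => by
    obtain ⟨c, hc, hcoer⟩ := exists_coercive_on_ball hB.continuous hB.pos R
    exact (setIntegral_sq_le_energy hB hv hc hcoer).1⟩

/-- Completeness: a rapidly Cauchy sequence for the energy converges almost everywhere. -/
theorem exists_limit_of_energy_cauchy (hB : IsEnergyForm B) {v : ℕ → E → E}
    (hv : ∀ n, FinEnergy B (v n))
    (hcau : ∀ N n m : ℕ, N ≤ n → N ≤ m → energy B (fun x => v n x - v m x) ≤ (1 / 4) ^ N) :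
    ∃ P : E → E, AEStronglyMeasurable P volume ∧
      (∀ᵐ x ∂volume, Tendsto (fun n => v n x) atTop (𝓝 (P x))) ∧
      ∀ n, FinEnergy B (fun x => P x - v n x) ∧
        energy B (fun x => P x - v n x) ≤ (1 / 4) ^ n := by
  have hball : ∀ k : ℕ, ∀ᵐ x ∂volume.restrict (ball (0 : E) k),
      ∃ l, Tendsto (fun n => v n x) atTop (𝓝 l) := by
    intro k
    obtain ⟨c, hc, hcoer⟩ := exists_coercive_on_ball hB.continuous hB.pos (k : ℝ)
    -- Coercivity gives the constant `√(c⁻¹)`; the added 1 makes the inequality strict, as the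
    -- almost everywhere convergence criterion demands.
    set K := √(c⁻¹) + 1 with hK
    have hK0 : 0 < K := by positivity
    refine Lp.ae_tendsto_of_cauchy_eLpNorm (p := 2)
      (B := fun N => ENNReal.ofReal (K * (1 / 2) ^ N)) (fun n => (hv n).aesm.restrict)
      (by norm_num) ?_ ?_
    · rw [← ENNReal.ofReal_tsum_of_nonneg (fun n => by positivity)
        ((summable_geometric_of_lt_one (by norm_num) (by norm_num)).mul_left K)]
      exact ENNReal.ofReal_ne_top
    · intro N n m hn hm
      have hfe := (hv n).sub hB (hv m)
      obtain ⟨hi, hle⟩ := setIntegral_sq_le_energy hB hfe hc hcoer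
      have hmem : MemLp (v n - v m) 2 (volume.restrict (ball (0 : E) k)) :=
        (memLp_two_iff_integrable_sq_norm (hfe.aesm.restrict)).2 hi
      rw [hmem.eLpNorm_eq_integral_rpow_norm (by norm_num) (by norm_num)]
      refine (ENNReal.ofReal_lt_ofReal_iff (by positivity)).2 ?_
      have h1 : ∫ x in ball (0 : E) k, ‖(v n - v m) x‖ ^ (2 : ENNReal).toReal ≤
          c⁻¹ * (1 / 4) ^ N := by
        simp only [ENNReal.toReal_ofNat, Real.rpow_ofNat]
        exact hle.trans (by gcongr; exact hcau N n m hn hm)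
      have h2 : (2 : ENNReal).toReal⁻¹ = 1 / 2 := by norm_num
      rw [h2, ← Real.sqrt_eq_rpow]
      refine (Real.sqrt_le_sqrt h1).trans_lt ?_
      have h3 : ((1 : ℝ) / 4) ^ N = ((1 / 2) ^ N) ^ 2 := by rw [← pow_mul, mul_comm, pow_mul]; norm_num
      rw [h3, Real.sqrt_mul (by positivity), Real.sqrt_sq (by positivity)]
      gcongr
      linarith
  have hae : ∀ᵐ x ∂(volume : Measure E), ∃ l, Tendsto (fun n => v n x) atTop (𝓝 l) := by
    have := ae_all_iff.2 fun k => (ae_restrict_iff' measurableSet_ball).1 (hball k)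
    filter_upwards [this] with x hx
    obtain ⟨k, hk⟩ := exists_nat_gt ‖x‖
    exact hx k (mem_ball_zero_iff.2 hk)
  obtain ⟨P, hPm, hP⟩ := exists_stronglyMeasurable_limit_of_tendsto_ae (fun n => (hv n).aesm) hae
  refine ⟨P, hPm.aestronglyMeasurable, hP, fun n => ?_⟩
  -- Fatou in `m` at fixed `n`.
  have := integrable_and_integral_le_of_tendsto (C := (1 / 4) ^ n)
    (g := fun m x => inner ℝ (B x (v m x - v n x)) (v m x - v n x))
    (g' := fun x => inner ℝ (B x (P x - v n x)) (P x - v n x))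
    (fun m => ((hv m).sub hB (hv n)).integrable) (fun m x => hB.nonneg _ _)
    (by filter_upwards [eventually_ge_atTop n] with m hm using hcau n m n hm le_rfl) (by
      filter_upwards [hP] with x hx
      have h1 : Tendsto (fun m => v m x - v n x) atTop (𝓝 (P x - v n x)) := hx.sub_const _
      exact (((B x).continuous.tendsto _).comp h1).inner h1)
  exact ⟨⟨hPm.aestronglyMeasurable.sub (hv n).aesm, this.1⟩, this.2⟩

/-- The energy-orthogonal projection of a field onto the closure of the gradients. -/
theorem exists_energy_projection (hB : IsEnergyForm B) {N : E → E} (hN : FinEnergy B N) :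
    ∃ P : E → E, FinEnergy B P ∧ IsGradLimit P ∧
      ∀ ψ : E → ℝ, ContDiff ℝ ∞ ψ → FinEnergy B (gradient ψ) →
        ∫ x, inner ℝ (B x (N x - P x)) (gradient ψ x) = 0 := by
  let 𝒟 : Set (E → ℝ) := {ψ | ContDiff ℝ ∞ ψ ∧ FinEnergy B (gradient ψ)}
  let J : (E → ℝ) → ℝ := fun ψ => energy B (fun x => N x - gradient ψ x)
  have grad_lin : ∀ (φ ψ : E → ℝ) (a b : ℝ), ContDiff ℝ ∞ φ → ContDiff ℝ ∞ ψ →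
      gradient (fun x => a * φ x + b * ψ x) = fun x => a • gradient φ x + b • gradient ψ x := by
    intro φ ψ a b hφ hψ
    have h1 : Differentiable ℝ φ := hφ.differentiable (by simp)
    have h2 : Differentiable ℝ ψ := hψ.differentiable (by simp)
    ext1 x
    refine ext_inner_right ℝ fun v => ?_
    rw [inner_add_left, inner_smul_left, inner_smul_left, inner_gradient, inner_gradient,
      inner_gradient, fderiv_fun_add (by fun_prop) (by fun_prop), fderiv_const_mul (h1 x),
      fderiv_const_mul (h2 x)]
    simp
  have lin : ∀ φ ∈ 𝒟, ∀ ψ ∈ 𝒟, ∀ a b : ℝ, (fun x => a * φ x + b * ψ x) ∈ 𝒟 := by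
    intro φ hφ ψ hψ a b
    refine ⟨(contDiff_const.mul hφ.1).add (contDiff_const.mul hψ.1), ?_⟩
    rw [grad_lin φ ψ a b hφ.1 hψ.1]
    exact (hφ.2.const_smul a).add hB (hψ.2.const_smul b)
  have h0 : (fun _ => 0 : E → ℝ) ∈ 𝒟 := by
    refine ⟨contDiff_const, ?_⟩
    have : gradient (fun _ => 0 : E → ℝ) = fun _ => 0 := by ext1 x; exact gradient_fun_const x 0
    rw [this]
    exact ⟨aestronglyMeasurable_const, by simp⟩
  have hbdd : BddBelow (J '' 𝒟) := ⟨0, by rintro _ ⟨ψ, _, rfl⟩; exact energy_nonneg hB _⟩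
  set m := sInf (J '' 𝒟)
  have hm : ∀ ψ ∈ 𝒟, m ≤ J ψ := fun ψ hψ => csInf_le hbdd (mem_image_of_mem J hψ)
  have hex : ∀ n : ℕ, ∃ φ ∈ 𝒟, J φ < m + (1 / 4) * (1 / 4) ^ n := by
    intro n
    obtain ⟨_, ⟨φ, hφ, rfl⟩, hlt⟩ := exists_lt_of_csInf_lt (Set.Nonempty.image J ⟨_, h0⟩)
      (lt_add_of_pos_right m (by positivity : (0 : ℝ) < (1 / 4) * (1 / 4) ^ n))
    exact ⟨φ, hφ, hlt⟩
  choose φ hφ hJ using hex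
  have hfe : ∀ n, FinEnergy B (fun x => N x - gradient (φ n) x) := fun n => hN.sub hB (hφ n).2
  -- Parallelogram law: the midpoint of two near-minimisers costs at least `m`, so their distance is
  -- at most twice the sum of their two excesses over `m`. The prefactor `1 / 4` in the choice of
  -- `φ` makes this at most `(1 / 4) ^ k`.
  have hcau : ∀ k n l : ℕ, k ≤ n → k ≤ l →
      energy B (fun x => gradient (φ n) x - gradient (φ l) x) ≤ (1 / 4) ^ k := by
    intro k n l hn hl
    have e1 := energy_sub hB (hfe l) (hfe n)
    have e2 := energy_add hB (hfe l) (hfe n)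
    have e3 : energy B (fun x => N x - gradient (φ l) x + (N x - gradient (φ n) x)) =
        2 ^ 2 * J (fun x => (1 / 2) * φ l x + (1 / 2) * φ n x) := by
      simp only [J]
      rw [← energy_smul, grad_lin _ _ _ _ (hφ l).1 (hφ n).1]
      congr 1; ext1 x; module
    have e4 : (fun x => N x - gradient (φ l) x - (N x - gradient (φ n) x)) =
        fun x => gradient (φ n) x - gradient (φ l) x := by ext1 x; abel
    have h1 := hm _ (lin _ (hφ l) _ (hφ n) (1 / 2) (1 / 2))
    have h2 := hJ l
    have h3 := hJ n
    have p1 : ((1 : ℝ) / 4) ^ l ≤ (1 / 4) ^ k :=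
      pow_le_pow_of_le_one (by norm_num) (by norm_num) hl
    have p2 : ((1 : ℝ) / 4) ^ n ≤ (1 / 4) ^ k :=
      pow_le_pow_of_le_one (by norm_num) (by norm_num) hn
    rw [e4] at e1
    rw [e3] at e2
    simp only [J] at h1 h2 h3 e2
    linarith
  obtain ⟨P, hPm, hP, hPe⟩ := exists_limit_of_energy_cauchy hB (fun n => (hφ n).2) hcau
  have hPf : FinEnergy B P := by
    simpa using (hPe 0).1.add hB (hφ 0).2
  have lim0 : Tendsto (fun n : ℕ => ((1 : ℝ) / 4) ^ n) atTop (𝓝 0) :=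
    tendsto_pow_atTop_nhds_zero_of_lt_one (by norm_num) (by norm_num)
  refine ⟨P, hPf, ⟨φ, fun n => (hφ n).1, fun R => ?_⟩, fun ψ hψ hψe => ?_⟩
  · obtain ⟨c, hc, hcoer⟩ := exists_coercive_on_ball hB.continuous hB.pos R
    refine squeeze_zero (fun n => integral_nonneg fun x => by positivity) (fun n => ?_)
      (by rw [← mul_zero c⁻¹]; exact lim0.const_mul c⁻¹)
    have := (setIntegral_sq_le_energy hB (hPe n).1 hc hcoer).2
    simp only [norm_sub_rev (gradient (φ n) _)]
    refine this.trans ?_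
    gcongr
    exact (hPe n).2
  -- First variation at the near-minimiser `φ n` in the direction `t • ∇ψ`. Replacing `gradient (φ
  -- n)` by `P` costs a second t² term, through the nonnegative energy `n3`; this accounts for the
  -- factor 2.
  · have bd : ∀ t : ℝ, ∀ n, 2 * t * (∫ x, inner ℝ (B x (N x - P x)) (gradient ψ x)) ≤
        2 * t ^ 2 * energy B (gradient ψ) + 2 * (1 / 4) ^ n := by
      intro t n
      have h1 := hm _ (lin _ (hφ n) _ ⟨hψ, hψe⟩ 1 t)
      have e1 : J (fun x => 1 * φ n x + t * ψ x) =
          energy B (fun x => (N x - gradient (φ n) x) - t • gradient ψ x) := by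
        simp only [J]
        rw [grad_lin _ _ _ _ (hφ n).1 hψ]
        congr 1; ext1 x; module
      have e2 := energy_sub hB (hfe n) (hψe.const_smul t)
      have e3 := energy_add hB (hPe n).1 (hψe.const_smul t)
      have n3 := energy_nonneg hB (fun x => (P x - gradient (φ n) x) + t • gradient ψ x)
      have n4 := hJ n
      have n5 := (hPe n).2
      simp only [inner_smul_right, integral_const_mul, energy_smul] at e2 e3
      have e5 : ∫ x, inner ℝ (B x (N x - P x)) (gradient ψ x) =
          (∫ x, inner ℝ (B x (N x - gradient (φ n) x)) (gradient ψ x)) -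
            ∫ x, inner ℝ (B x (P x - gradient (φ n) x)) (gradient ψ x) := by
        rw [← integral_sub ((hfe n).integrable_inner hB hψe) ((hPe n).1.integrable_inner hB hψe)]
        congr 1; ext1 x
        rw [← inner_sub_left, ← map_sub]
        congr 2; abel
      have e6 : J (φ n) = energy B (fun x => N x - gradient (φ n) x) := rfl
      have p0 : (0 : ℝ) < (1 / 4) ^ n := by positivity
      rw [e5]
      rw [e1, e2] at h1
      rw [e3] at n3
      rw [e6] at n4
      linarith
    have bd' : ∀ t : ℝ, 2 * t * (∫ x, inner ℝ (B x (N x - P x)) (gradient ψ x)) ≤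
        2 * t ^ 2 * energy B (gradient ψ) := fun t => by
      simpa using ge_of_tendsto' ((lim0.const_mul 2).const_add _) (bd t)
    set S := ∫ x, inner ℝ (B x (N x - P x)) (gradient ψ x)
    set Q := energy B (gradient ψ) with hQ
    have hQ0 : 0 ≤ Q := energy_nonneg hB _
    -- Nearly optimal `t`; the `+ 1` keeps the denominator positive when `Q = 0`. The bound then
    -- reads X ≤ X/2 for X = S²/(Q + 1) ≥ 0.
    have := bd' (S / (2 * (Q + 1)))
    have h2 : 2 * (S / (2 * (Q + 1))) * S = S ^ 2 / (Q + 1) := by field_simp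
    have h3 : 2 * (S / (2 * (Q + 1))) ^ 2 * Q = S ^ 2 / (Q + 1) * (Q / (2 * (Q + 1))) := by
      field_simp
    rw [h2, h3] at this
    have h4 : Q / (2 * (Q + 1)) ≤ 1 / 2 := by
      rw [div_le_div_iff₀ (by positivity) (by norm_num)]; linarith
    have h5 : 0 ≤ S ^ 2 / (Q + 1) := by positivity
    have h6 : S ^ 2 / (Q + 1) = 0 := by nlinarith
    have h7 : S ^ 2 = 0 := by
      rcases div_eq_zero_iff.1 h6 with h | h
      · exact h
      · linarith
    exact pow_eq_zero_iff two_ne_zero |>.1 h7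

end EnergyProjection

end NewtonDecomp

namespace NewtonDecomp

open Metric Set Filter Topology

set_option linter.unusedSectionVars false

/-! ### Existence and uniqueness of the Newton decomposition. -/

section Decomposition

variable {d : ℕ} {f ρ : Space d → ℝ}

/-- The operator field `ρ ∇²f`. -/
noncomputable def weightedHessian (f ρ : Space d → ℝ) (x : Space d) : Space d →L[ℝ] Space d :=
  ρ x • hessian f x

theorem contDiff_hessian (hf : ContDiff ℝ ∞ f) : ContDiff ℝ ∞ (hessian f) :=
  (contDiff_gradient hf).fderiv_right (by simp)

theorem inner_hessian (hf : ContDiff ℝ ∞ f) (x v w : Space d) :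
    inner ℝ (hessian f x v) w = fderiv ℝ (fderiv ℝ f) x v w := by
  have hgd : DifferentiableAt ℝ (gradient f) x := (contDiff_gradient hf).differentiable (by simp) x
  have hfd : DifferentiableAt ℝ (fderiv ℝ f) x :=
    (hf.fderiv_right (m := ∞) (by simp)).differentiable (by simp) x
  have h1 : fderiv ℝ (fun y => inner ℝ (gradient f y) w) x v = inner ℝ (hessian f x v) w := by
    rw [fderiv_inner_apply ℝ hgd (differentiableAt_const w)]; simp [hessian]
  rw [← h1]
  simp only [inner_gradient]
  rw [fderiv_clm_apply hfd (differentiableAt_const w)]; simp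

theorem hessian_symm (hf : ContDiff ℝ ∞ f) (x v w : Space d) :
    inner ℝ (hessian f x v) w = inner ℝ (hessian f x w) v := by
  rw [inner_hessian hf, inner_hessian hf]
  exact (hf.contDiffAt (x := x)).isSymmSndFDerivAt
    (by simpa using WithTop.coe_le_coe.2 (le_top (a := (2 : ℕ∞)))) v w

theorem contDiff_weightedHessian (hf : ContDiff ℝ ∞ f) (hρ : ContDiff ℝ ∞ ρ) :
    ContDiff ℝ ∞ (weightedHessian f ρ) := hρ.smul (contDiff_hessian hf)

theorem isEnergyForm_weightedHessian (hf : IsSmoothStrictlyConvex f) (hρ : IsSmoothDensity ρ) :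
    IsEnergyForm (weightedHessian f ρ) where
  continuous := (contDiff_weightedHessian hf.smooth hρ.smooth).continuous
  symm x v w := by
    simp only [weightedHessian, smul_apply, real_inner_smul_left, hessian_symm hf.smooth x v w]
  pos x v hv := by
    simp only [weightedHessian, smul_apply, real_inner_smul_left]
    exact mul_pos (hρ.pos x) (hf.hessian_pos x v hv)

theorem finEnergy_weightedHessian_iff {v : Space d → Space d} (hv : Continuous v) :
    FinEnergy (weightedHessian f ρ) v ↔ HasFiniteEnergy f ρ v := by
  unfold HasFiniteEnergy
  constructor
  · intro h; simpa [weightedHessian, real_inner_smul_left] using h.integrable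
  · intro h
    exact ⟨hv.aestronglyMeasurable, by simpa [weightedHessian, real_inner_smul_left] using h⟩

theorem isInvertible_hessian (hf : IsSmoothStrictlyConvex f) (x : Space d) :
    (hessian f x).IsInvertible := by
  have hinj : Function.Injective (hessian f x : Space d →ₗ[ℝ] Space d) := by
    rw [← LinearMap.ker_eq_bot, LinearMap.ker_eq_bot']
    intro v hv
    by_contra hne
    have := hf.hessian_pos x v hne
    rw [show hessian f x v = 0 from hv] at this
    simp at this
  refine ⟨(LinearEquiv.ofInjectiveEndo _ hinj).toContinuousLinearEquiv, ?_⟩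
  ext1 v; rfl

theorem hessian_newtonDirection (hf : IsSmoothStrictlyConvex f) (x : Space d) :
    hessian f x (newtonDirection f x) = -gradient f x := by
  rw [newtonDirection, map_neg, (isInvertible_hessian hf x).self_apply_inverse]

theorem contDiff_newtonDirection (hf : IsSmoothStrictlyConvex f) :
    ContDiff ℝ ∞ (newtonDirection f) := by
  refine ContDiff.neg (ContDiff.clm_apply ?_ (contDiff_gradient hf.smooth))
  rw [contDiff_iff_contDiffAt]
  intro x
  exact (isInvertible_hessian hf x).contDiffAt_map_inverse.comp x
    (contDiff_hessian hf.smooth).contDiffAt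

theorem fderiv_coord {W : Space d → Space d} {x : Space d} (hW : DifferentiableAt ℝ W x) (i : Fin d)
    (v : Space d) : (fderiv ℝ W x v) i = fderiv ℝ (fun y => W y i) x v := by
  have : HasFDerivAt (fun y => W y i) ((EuclideanSpace.proj i : Space d →L[ℝ] ℝ) ∘L fderiv ℝ W x) x :=
    (EuclideanSpace.proj i : Space d →L[ℝ] ℝ).hasFDerivAt.comp x hW.hasFDerivAt
  rw [this.fderiv]; rfl

theorem integral_mul_divergence {W : Space d → Space d} (hW : ContDiff ℝ 1 W) {ψ : Space d → ℝ}
    (hψ : ContDiff ℝ ∞ ψ) (hc : HasCompactSupport ψ) :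
    ∫ x, ψ x * divergence W x = -∫ x, inner ℝ (W x) (gradient ψ x) := by
  have hWd : Differentiable ℝ W := hW.differentiable one_ne_zero
  have hWf : Continuous (fderiv ℝ W) := hW.continuous_fderiv one_ne_zero
  have hψd : Continuous (fderiv ℝ ψ) := hψ.continuous_fderiv (by simp)
  have e1 : ∀ x, inner ℝ (W x) (gradient ψ x) =
      ∑ i, W x i * fderiv ℝ ψ x (EuclideanSpace.single i 1) := by
    intro x
    rw [PiLp.inner_apply]
    refine Finset.sum_congr rfl fun i _ => ?_
    rw [← inner_gradient, EuclideanSpace.inner_single_right]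
    simp [mul_comm]
  have e2 : ∀ i x, fderiv ℝ (fun y => W y i) x (EuclideanSpace.single i 1) =
      (fderiv ℝ W x (EuclideanSpace.single i 1)) i := fun i x => (fderiv_coord (hWd x) i _).symm
  have hWi : ∀ i, ContDiff ℝ 1 fun y => W y i := fun i =>
    (EuclideanSpace.proj i : Space d →L[ℝ] ℝ).contDiff.comp hW
  have parts := fun i => integral_mul_fderiv_eq_neg (hWi i) (hψ.of_le (by simp)) hc
    (EuclideanSpace.single i 1)
  simp only [e2] at parts
  have hcf : ∀ i, HasCompactSupport fun x => fderiv ℝ ψ x (EuclideanSpace.single i 1) := fun i =>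
    hc.fderiv_apply (𝕜 := ℝ) _
  have hpc : ∀ i, Continuous fun x => (fderiv ℝ W x (EuclideanSpace.single i 1)) i := fun i =>
    (EuclideanSpace.proj i : Space d →L[ℝ] ℝ).continuous.comp (hWf.clm_apply continuous_const)
  simp only [e1, divergence, Finset.mul_sum]
  rw [integral_finsetSum, integral_finsetSum, ← Finset.sum_neg_distrib]
  · refine Finset.sum_congr rfl fun i _ => ?_
    rw [parts i, neg_neg]; simp only [mul_comm]
  · intro i _
    exact ((hWi i).continuous.mul (hψd.clm_apply continuous_const)).integrable_of_hasCompactSupport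
      (hcf i).mul_left
  · intro i _
    exact (hψ.continuous.mul (hpc i)).integrable_of_hasCompactSupport hc.mul_right

theorem continuous_divergence {W : Space d → Space d} (hW : ContDiff ℝ 1 W) :
    Continuous (divergence W) := by
  have hWf : Continuous (fderiv ℝ W) := hW.continuous_fderiv one_ne_zero
  refine continuous_finsetSum _ fun i _ => ?_
  exact (EuclideanSpace.proj i : Space d →L[ℝ] ℝ).continuous.comp (hWf.clm_apply continuous_const)

theorem IsWeakDivFree.divergence_eq_zero {W : Space d → Space d} (hW : ContDiff ℝ 1 W)
    (h : IsWeakDivFree W) (x : Space d) : divergence W x = 0 := by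
  have hc := continuous_divergence hW
  have hae := ae_eq_zero_of_integral_contDiff_smul_eq_zero (μ := (volume : Measure (Space d)))
    hc.locallyIntegrable fun ψ hψ hψc => by
      simp only [smul_eq_mul]
      rw [integral_mul_divergence hW hψ hψc, h ψ hψ hψc, neg_zero]
  exact congrFun ((Continuous.ae_eq_iff_eq volume hc continuous_const).1 hae) x

theorem isWeakDivFree_of_divergence_eq_zero {W : Space d → Space d} (hW : ContDiff ℝ 1 W)
    (h : ∀ x, divergence W x = 0) : IsWeakDivFree W := fun ψ hψ hc => by
  have := integral_mul_divergence hW hψ hc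
  simp only [h, mul_zero, integral_zero] at this
  linarith

theorem IsDivergenceFree.neg {W : Space d → Space d} (h : IsDivergenceFree f ρ W) :
    IsDivergenceFree f ρ (fun x => -W x) where
  smooth := h.smooth.neg
  divergence_eq_zero x := by
    have := h.divergence_eq_zero x
    simp only [divergence] at this ⊢
    have hn : fderiv ℝ (fun x => -W x) x = -fderiv ℝ W x := fderiv_fun_neg
    simp [hn, this]
  integrable ψ hψ := by simpa only [inner_neg_left] using (h.integrable ψ hψ).fun_neg
  no_flux ψ hψ := by simp only [inner_neg_left]; rw [integral_neg, h.no_flux ψ hψ, neg_zero]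

/-- As the Hessian sends the Newton direction to `-gradient f x`, the flux of the remainder is the
Wasserstein Newton flux up to sign. This identifies the two formulations of the problem. -/
theorem newton_residual (hf : IsSmoothStrictlyConvex f) (ρ Φ : Space d → ℝ) (x : Space d) :
    ρ x • hessian f x (newtonDirection f x - gradient Φ x) =
      -(ρ x • hessian f x (gradient Φ x) + ρ x • gradient f x) := by
  rw [map_sub, hessian_newtonDirection hf]; module

theorem isWassersteinNewtonPotential_iff (hf : IsSmoothStrictlyConvex f) {Φ : Space d → ℝ} :
    IsWassersteinNewtonPotential f ρ Φ ↔
      IsNewtonDecomposition f ρ Φ (fun x => newtonDirection f x - gradient Φ x) := by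
  constructor
  · intro h
    refine ⟨h.potential, ?_, fun x => by abel⟩
    simp only [newton_residual hf]
    exact h.equation.neg
  · intro h
    refine ⟨h.potential, ?_⟩
    have := h.divergence_free.neg
    simpa only [newton_residual hf, neg_neg] using this

/-- The projection `P` is orthogonal to the gradients of all potentials. Compactly supported ones
give the elliptic equation, hence a smooth `Φ` and a pointwise zero divergence; the others give the
absence of flux at infinity. -/
theorem exists_wassersteinNewtonPotential (hf : IsSmoothStrictlyConvex f) (hρ : IsSmoothDensity ρ)
    (hE : HasFiniteEnergy f ρ (newtonDirection f)) :
    ∃ Φ, IsWassersteinNewtonPotential f ρ Φ := by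
  have hB := isEnergyForm_weightedHessian hf hρ
  have hBs := contDiff_weightedHessian hf.smooth hρ.smooth
  set B := weightedHessian f ρ with hBdef
  have hNs := contDiff_newtonDirection hf
  have hN : FinEnergy B (newtonDirection f) := (finEnergy_weightedHessian_iff hNs.continuous).2 hE
  obtain ⟨P, hP, hgl, horth⟩ := exists_energy_projection hB hN
  have hcs : ∀ ψ : Space d → ℝ, ContDiff ℝ ∞ ψ → HasCompactSupport ψ →
      FinEnergy B (gradient ψ) := by
    intro ψ hψ hc
    have hg := (contDiff_gradient hψ).continuous
    refine ⟨hg.aestronglyMeasurable, Continuous.integrable_of_hasCompactSupport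
      ((hB.continuous.clm_apply hg).inner hg) ?_⟩
    refine (hasCompactSupport_gradient hc).mono fun x hx => ?_
    rw [Function.mem_support] at hx ⊢
    intro h0; simp [h0] at hx
  have hweak : IsWeakDivFree fun x => B x (P x) - B x (newtonDirection f x) := by
    intro ψ hψ hc
    have := horth ψ hψ (hcs ψ hψ hc)
    have e : ∀ x, inner ℝ (B x (P x) - B x (newtonDirection f x)) (gradient ψ x) =
        -inner ℝ (B x (newtonDirection f x - P x)) (gradient ψ x) := by
      intro x; rw [← inner_neg_left, ← map_neg, neg_sub, map_sub]
    simp only [e]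
    rw [integral_neg, this, neg_zero]
  obtain ⟨Φ, hΦ, hPΦ⟩ := exists_smooth_potential (hP.locL2 hB) hgl hBs hB.pos
    (hBs.clm_apply hNs) hweak
  have hgΦ := contDiff_gradient hΦ
  have hΦe : FinEnergy B (gradient Φ) := by
    refine ⟨hgΦ.continuous.aestronglyMeasurable, hP.integrable.congr ?_⟩
    filter_upwards [hPΦ] with x hx
    rw [hx]
  have horth' : ∀ ψ : Space d → ℝ, ContDiff ℝ ∞ ψ → FinEnergy B (gradient ψ) →
      ∫ x, inner ℝ (B x (newtonDirection f x - gradient Φ x)) (gradient ψ x) = 0 := by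
    intro ψ hψ hψe
    rw [← horth ψ hψ hψe]
    refine integral_congr_ae ?_
    filter_upwards [hPΦ] with x hx
    rw [hx]
  have hpot : ∀ {ψ}, IsPotential f ρ ψ → FinEnergy B (gradient ψ) := fun {ψ} hψ =>
    (finEnergy_weightedHessian_iff (contDiff_gradient hψ.smooth).continuous).2 hψ.finite_energy
  have hWs : ContDiff ℝ ∞ fun x => B x (newtonDirection f x - gradient Φ x) :=
    hBs.clm_apply (hNs.sub hgΦ)
  refine ⟨Φ, (isWassersteinNewtonPotential_iff hf).2
    ⟨⟨hΦ, (finEnergy_weightedHessian_iff hgΦ.continuous).1 hΦe⟩, ?_, fun x => by abel⟩⟩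
  exact
    { smooth := hWs
      divergence_eq_zero := IsWeakDivFree.divergence_eq_zero (hWs.of_le (by simp))
        fun ψ hψ hc => horth' ψ hψ (hcs ψ hψ hc)
      integrable := fun ψ hψ => (hN.sub hB hΦe).integrable_inner hB (hpot hψ)
      no_flux := fun ψ hψ => horth' ψ hψ.smooth (hpot hψ) }

theorem gradient_add_const (Φ : Space d → ℝ) (c : ℝ) :
    gradient (fun x => Φ x + c) = gradient Φ := by
  ext1 x; simp [gradient, fderiv_add_const]

theorem IsWassersteinNewtonPotential.add_const {Φ : Space d → ℝ}
    (h : IsWassersteinNewtonPotential f ρ Φ) (c : ℝ) :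
    IsWassersteinNewtonPotential f ρ (fun x => Φ x + c) where
  potential := ⟨h.potential.smooth.add contDiff_const, by
    rw [gradient_add_const]; exact h.potential.finite_energy⟩
  equation := by rw [gradient_add_const]; exact h.equation

/-- The difference `ψ` is itself a potential, so both equations may be tested against it, with no
decay needed. Subtracting shows that `ψ` has zero energy, and a continuous nonnegative integrand
with zero integral vanishes everywhere. -/
theorem IsWassersteinNewtonPotential.eq_add_const (hf : IsSmoothStrictlyConvex f)
    (hρ : IsSmoothDensity ρ) {Φ Φ' : Space d → ℝ} (h : IsWassersteinNewtonPotential f ρ Φ)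
    (h' : IsWassersteinNewtonPotential f ρ Φ') : ∃ c, ∀ x, Φ' x = Φ x + c := by
  have hB := isEnergyForm_weightedHessian hf hρ
  have hd : Differentiable ℝ Φ := h.potential.smooth.differentiable (by simp)
  have hd' : Differentiable ℝ Φ' := h'.potential.smooth.differentiable (by simp)
  have hgc := (contDiff_gradient h.potential.smooth).continuous
  have hgc' := (contDiff_gradient h'.potential.smooth).continuous
  have hfe := (finEnergy_weightedHessian_iff hgc).2 h.potential.finite_energy
  have hfe' := (finEnergy_weightedHessian_iff hgc').2 h'.potential.finite_energy
  set ψ : Space d → ℝ := fun x => Φ' x - Φ x with hψ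
  have hψs : ContDiff ℝ ∞ ψ := h'.potential.smooth.sub h.potential.smooth
  have hgψ : gradient ψ = fun x => gradient Φ' x - gradient Φ x := by
    ext1 x
    simp only [hψ, gradient, fderiv_fun_sub (hd' x) (hd x), map_sub]
  have hgψc : Continuous (gradient ψ) := (contDiff_gradient hψs).continuous
  have hfeψ : FinEnergy (weightedHessian f ρ) (gradient ψ) := hgψ ▸ hfe'.sub hB hfe
  have hpot : IsPotential f ρ ψ := ⟨hψs, (finEnergy_weightedHessian_iff hgψc).1 hfeψ⟩
  have e0 : ∫ x, inner ℝ (weightedHessian f ρ x (gradient ψ x)) (gradient ψ x) = 0 := by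
    have h1 := h.equation.no_flux ψ hpot
    have h2 := h'.equation.no_flux ψ hpot
    have h3 := integral_sub (h'.equation.integrable ψ hpot) (h.equation.integrable ψ hpot)
    rw [h1, h2, sub_zero] at h3
    rw [← h3]
    congr 1; ext x
    rw [← inner_sub_left]
    congr 1
    simp only [hgψ, weightedHessian, smul_apply, map_sub]; module
  have hnn : 0 ≤ fun x => inner ℝ (weightedHessian f ρ x (gradient ψ x)) (gradient ψ x) :=
    fun x => hB.nonneg x _
  have hae := (integral_eq_zero_iff_of_nonneg hnn hfeψ.integrable).1 e0
  have hcont : Continuous fun x => inner ℝ (weightedHessian f ρ x (gradient ψ x)) (gradient ψ x) :=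
    (hB.continuous.clm_apply hgψc).inner hgψc
  have hz := (Continuous.ae_eq_iff_eq volume hcont continuous_const).1 hae
  have hg0 : ∀ x, gradient ψ x = 0 := fun x => by
    by_contra hne
    exact (hB.pos x _ hne).ne' (congrFun hz x)
  have hf0 : ∀ x, fderiv ℝ ψ x = 0 := fun x => by
    ext v; rw [← inner_gradient, hg0]; simp
  refine ⟨ψ 0, fun x => ?_⟩
  have := is_const_of_fderiv_eq_zero (𝕜 := ℝ) (hψs.differentiable (by simp)) hf0 x 0
  simp only [hψ] at this ⊢
  linarith

theorem IsNewtonDecomposition.eq_sub {Φ : Space d → ℝ} {ξ : Space d → Space d}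
    (h : IsNewtonDecomposition f ρ Φ ξ) : ξ = fun x => newtonDirection f x - gradient Φ x := by
  ext1 x; rw [h.decomposition x]; abel

theorem newton_decomposition (hf : IsSmoothStrictlyConvex f) (hρ : IsSmoothDensity ρ)
    (hE : HasFiniteEnergy f ρ (newtonDirection f)) :
    ∃ (Φ : Space d → ℝ) (ξ : Space d → Space d), IsNewtonDecomposition f ρ Φ ξ ∧
      (∀ (Φ' : Space d → ℝ) (ξ' : Space d → Space d), IsNewtonDecomposition f ρ Φ' ξ' →
        (∃ c : ℝ, ∀ x, Φ' x = Φ x + c) ∧ ξ' = ξ) ∧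
      (∀ Φ' : Space d → ℝ,
        IsWassersteinNewtonPotential f ρ Φ' ↔ ∃ c : ℝ, ∀ x, Φ' x = Φ x + c) := by
  obtain ⟨Φ, hΦ⟩ := exists_wassersteinNewtonPotential hf hρ hE
  refine ⟨Φ, _, (isWassersteinNewtonPotential_iff hf).1 hΦ, fun Φ' ξ' h' => ?_, fun Φ' =>
    ⟨fun h' => hΦ.eq_add_const hf hρ h', ?_⟩⟩
  · have hξ := h'.eq_sub
    subst hξ
    obtain ⟨c, hc⟩ := hΦ.eq_add_const hf hρ ((isWassersteinNewtonPotential_iff hf).2 h')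
    refine ⟨⟨c, hc⟩, ?_⟩
    rw [show Φ' = fun x => Φ x + c from funext hc, gradient_add_const]
  · rintro ⟨c, hc⟩
    rw [show Φ' = fun x => Φ x + c from funext hc]
    exact hΦ.add_const c

end Decomposition

end NewtonDecomp

namespace NewtonDecomp

open Metric Set Filter Topology

set_option linter.unusedSectionVars false

/-! ### Radial cutoffs and integration by parts without compact support. -/

section Cutoff

variable {E : Type*} [NormedAddCommGroup E] [InnerProductSpace ℝ E] [FiniteDimensional ℝ E]
  [MeasurableSpace E] [BorelSpace E]

/-- A smooth radial cutoff at distance of order `a⁻¹`. -/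
noncomputable def radialCutoff (a : ℝ) (x : E) : ℝ := Real.smoothTransition (2 - ‖a • x‖ ^ 2)

theorem contDiff_radialCutoff (a : ℝ) : ContDiff ℝ ∞ (radialCutoff a : E → ℝ) := by
  refine Real.smoothTransition.contDiff.comp (contDiff_const.sub ?_)
  exact (contDiff_const.smul contDiff_id).norm_sq ℝ

theorem hasCompactSupport_radialCutoff {a : ℝ} (ha : 0 < a) :
    HasCompactSupport (radialCutoff a : E → ℝ) := by
  refine HasCompactSupport.intro (isCompact_closedBall (0 : E) (2 / a)) fun x hx => ?_
  refine Real.smoothTransition.zero_of_nonpos ?_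
  rw [mem_closedBall_zero_iff, not_le, div_lt_iff₀ ha] at hx
  rw [norm_smul, Real.norm_of_nonneg ha.le]
  nlinarith

theorem radialCutoff_mem (a : ℝ) (x : E) : |radialCutoff a x| ≤ 1 := by
  rw [radialCutoff, abs_of_nonneg (Real.smoothTransition.nonneg _)]
  exact Real.smoothTransition.le_one _

theorem exists_norm_gradient_radialCutoff_le :
    ∃ L, 0 ≤ L ∧ ∀ a : ℝ, 0 < a → ∀ x : E, ‖gradient (radialCutoff a) x‖ ≤ a * L := by
  obtain ⟨L, hL⟩ := (contDiff_gradient (contDiff_radialCutoff (E := E) 1)).continuous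
    |>.bounded_above_of_compact_support
      (hasCompactSupport_gradient (hasCompactSupport_radialCutoff one_pos))
  refine ⟨L, (norm_nonneg _).trans (hL 0), fun a ha x => ?_⟩
  have e : (radialCutoff a : E → ℝ) = fun x => radialCutoff 1 (a • x) := by
    ext x; simp [radialCutoff]
  have : gradient (radialCutoff a) x = a • gradient (radialCutoff 1) (a • x) := by
    rw [e]; simp only [gradient, fderiv_comp_smul, map_smul]
  rw [this, norm_smul, Real.norm_of_nonneg ha.le]
  gcongr
  exact hL _

/-- The gradient of a radial function is parallel to the position vector. -/
theorem inner_gradient_radialCutoff_eq_zero (a : ℝ) {x v : E} (h : inner ℝ x v = 0) :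
    inner ℝ v (gradient (radialCutoff a) x) = 0 := by
  have h1 : HasFDerivAt (fun x : E => 2 - ‖a • x‖ ^ 2) (-(a ^ 2) • (2 • innerSL ℝ x)) x := by
    have h2 := ((hasStrictFDerivAt_norm_sq x).hasFDerivAt.const_mul (a ^ 2)).const_sub 2
    have e : (fun x : E => 2 - ‖a • x‖ ^ 2) = fun x => 2 - a ^ 2 * ‖x‖ ^ 2 := by
      ext x; rw [norm_smul, mul_pow, Real.norm_eq_abs, sq_abs]
    rw [e, neg_smul]; exact h2
  have hs : DifferentiableAt ℝ Real.smoothTransition (2 - ‖a • x‖ ^ 2) :=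
    (Real.smoothTransition.contDiff (n := 1)).differentiable one_ne_zero _
  have h3 := hs.hasFDerivAt.comp x h1
  rw [real_inner_comm, inner_gradient]
  change fderiv ℝ (Real.smoothTransition ∘ fun x : E => 2 - ‖a • x‖ ^ 2) x v = 0
  rw [h3.fderiv]
  simp [h]

/-- A weakly divergence free field is orthogonal to gradients, provided that the boundary terms
coming from radial cutoffs are dominated. -/
theorem IsWeakDivFree.integral_inner_gradient_eq_zero {W : E → E} (hW : IsWeakDivFree W)
    (hWc : Continuous W) {ψ : E → ℝ} (hψ : ContDiff ℝ ∞ ψ)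
    (hi : Integrable fun x => inner ℝ (W x) (gradient ψ x)) {G : E → ℝ} (hG : Integrable G)
    (hb : ∀ a : ℝ, 0 < a → a ≤ 1 → ∀ x, |ψ x * inner ℝ (W x) (gradient (radialCutoff a) x)| ≤ G x) :
    ∫ x, inner ℝ (W x) (gradient ψ x) = 0 := by
  obtain ⟨L, hL0, hL⟩ := exists_norm_gradient_radialCutoff_le (E := E)
  have hψg := (contDiff_gradient hψ).continuous
  set a : ℕ → ℝ := fun n => 1 / ((n : ℝ) + 1) with ha
  have ha0 : ∀ n, 0 < a n := fun n => by positivity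
  have ha1 : ∀ n, a n ≤ 1 := fun n => by
    rw [ha, div_le_one (by positivity)]; linarith [(Nat.cast_nonneg n : (0 : ℝ) ≤ n)]
  have hat : Tendsto a atTop (𝓝 0) := tendsto_one_div_add_atTop_nhds_zero_nat
  have hcg : ∀ n, Continuous (gradient (radialCutoff (a n) : E → ℝ)) := fun n =>
    (contDiff_gradient (contDiff_radialCutoff (a n))).continuous
  have zero : ∀ n, ∫ x, (radialCutoff (a n) x * inner ℝ (W x) (gradient ψ x) +
      ψ x * inner ℝ (W x) (gradient (radialCutoff (a n)) x)) = 0 := by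
    intro n
    have hc := contDiff_radialCutoff (E := E) (a n)
    rw [← hW (fun x => radialCutoff (a n) x * ψ x) (hc.mul hψ)
      (hasCompactSupport_radialCutoff (ha0 n)).mul_right]
    congr 1; ext x
    rw [gradient_fun_mul (hc.differentiable (by simp)) (hψ.differentiable (by simp)),
      inner_add_right, inner_smul_right, inner_smul_right]
  -- The field is tested against cutoff times `ψ`. As `a n` tends to zero the cutoff tends to 1, and
  -- its gradient, of size at most `a n * L`, tends to 0.
  have lim := tendsto_integral_of_dominated_convergence (μ := volume)
    (F := fun n x => radialCutoff (a n) x * inner ℝ (W x) (gradient ψ x) +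
      ψ x * inner ℝ (W x) (gradient (radialCutoff (a n)) x))
    (f := fun x => inner ℝ (W x) (gradient ψ x))
    (bound := fun x => |inner ℝ (W x) (gradient ψ x)| + G x)
    (fun n => Continuous.aestronglyMeasurable
      (((contDiff_radialCutoff (a n)).continuous.mul (hWc.inner hψg)).add
        (hψ.continuous.mul (hWc.inner (hcg n)))))
    (hi.abs.fun_add hG) (fun n => Eventually.of_forall fun x => ?_)
    (Eventually.of_forall fun x => ?_)
  · simp only [zero] at lim
    exact (tendsto_nhds_unique lim tendsto_const_nhds)
  · rw [Real.norm_eq_abs]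
    refine (abs_add_le _ _).trans (add_le_add ?_ (hb _ (ha0 n) (ha1 n) x))
    rw [abs_mul]
    exact mul_le_of_le_one_left (abs_nonneg _) (radialCutoff_mem _ _)
  · have t1 : Tendsto (fun n => radialCutoff (a n) x) atTop (𝓝 1) := by
      have h1 : Tendsto (fun n => ‖a n • x‖ ^ 2) atTop (𝓝 (‖(0 : ℝ) • x‖ ^ 2)) :=
        ((hat.smul_const x).norm).pow 2
      rw [zero_smul, norm_zero, zero_pow two_ne_zero] at h1
      refine tendsto_const_nhds.congr' ?_
      filter_upwards [h1.eventually_lt_const one_pos] with n hn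
      exact (Real.smoothTransition.one_of_one_le (by linarith)).symm
    have t2 : Tendsto (fun n => ψ x * inner ℝ (W x) (gradient (radialCutoff (a n)) x)) atTop
        (𝓝 0) := by
      have t3 : Tendsto (fun n => gradient (radialCutoff (a n)) x) atTop (𝓝 0) :=
        squeeze_zero_norm (fun n => hL _ (ha0 n) x) (by simpa using hat.mul_const L)
      simpa using (tendsto_const_nhds.inner t3).const_mul (ψ x)
    simpa using (t1.mul_const (inner ℝ (W x) (gradient ψ x))).add t2

end Cutoff

/-! ### Gaussian density and integrability of polynomially bounded functions. -/

section Gaussian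

variable {d : ℕ}

theorem integrable_exp_neg_mul_norm_sq {b : ℝ} (hb : 0 < b) :
    Integrable fun x : Space d => Real.exp (-b * ‖x‖ ^ 2) := by
  refine Integrable.of_integral_ne_zero ?_
  rw [GaussianFourier.integral_rexp_neg_mul_sq_norm hb]
  positivity

/-- The density of the centered Gaussian measure with weight `exp (-‖x‖²)`. -/
noncomputable def gaussianDensity (d : ℕ) (x : Space d) : ℝ :=
  (∫ y : Space d, Real.exp (-1 * ‖y‖ ^ 2))⁻¹ * Real.exp (-1 * ‖x‖ ^ 2)

theorem isSmoothDensity_gaussianDensity (d : ℕ) : IsSmoothDensity (gaussianDensity d) := by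
  have hpos : 0 < ∫ y : Space d, Real.exp (-1 * ‖y‖ ^ 2) := by
    rw [GaussianFourier.integral_rexp_neg_mul_sq_norm one_pos]; positivity
  refine ⟨?_, fun x => mul_pos (inv_pos.2 hpos) (Real.exp_pos _), ?_⟩
  · exact contDiff_const.mul ((contDiff_const.mul (contDiff_id.norm_sq ℝ)).exp)
  · simp only [gaussianDensity]
    rw [integral_const_mul, inv_mul_cancel₀ hpos.ne']

/-- Half of the Gaussian exponent absorbs the polynomial, through y^k / k! ≤ exp y at y = (1 +
‖x‖²)/2. -/
theorem integrable_gaussianDensity_mul {F : Space d → ℝ} (hF : Continuous F) {C : ℝ} {k : ℕ}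
    (hb : ∀ x, |F x| ≤ C * (1 + ‖x‖ ^ 2) ^ k) :
    Integrable fun x => gaussianDensity d x * F x := by
  have hρ := isSmoothDensity_gaussianDensity d
  set Z := (∫ y : Space d, Real.exp (-1 * ‖y‖ ^ 2))⁻¹ with hZ
  have hC : 0 ≤ C := by simpa using (abs_nonneg _).trans (hb 0)
  refine ((integrable_exp_neg_mul_norm_sq (d := d) (b := 1 / 2) (by norm_num)).const_mul
    (Z * (C * (k.factorial * 2 ^ k * Real.exp (1 / 2))))).mono'
    (hρ.smooth.continuous.mul hF).aestronglyMeasurable (Eventually.of_forall fun x => ?_)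
  have hZ0 : 0 ≤ Z := inv_nonneg.2 (integral_nonneg fun y => (Real.exp_pos _).le)
  rw [norm_mul, Real.norm_of_nonneg (hρ.pos x).le, gaussianDensity, ← hZ, Real.norm_eq_abs]
  have h1 := Real.pow_div_factorial_le_exp ((1 + ‖x‖ ^ 2) / 2) (by positivity) k
  have hk : (0 : ℝ) < k.factorial := by exact_mod_cast k.factorial_pos
  rw [div_le_iff₀ hk, div_pow, div_le_iff₀ (by positivity)] at h1
  have h2 : Real.exp ((1 + ‖x‖ ^ 2) / 2) * Real.exp (-1 * ‖x‖ ^ 2) =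
      Real.exp (1 / 2) * Real.exp (-(1 / 2) * ‖x‖ ^ 2) := by
    rw [← Real.exp_add, ← Real.exp_add]; congr 1; ring
  calc Z * Real.exp (-1 * ‖x‖ ^ 2) * |F x|
      ≤ Z * Real.exp (-1 * ‖x‖ ^ 2) *
        (C * (Real.exp ((1 + ‖x‖ ^ 2) / 2) * k.factorial * 2 ^ k)) := by
        gcongr
        exact (hb x).trans (by gcongr)
    _ = Z * (C * (k.factorial * 2 ^ k)) *
        (Real.exp ((1 + ‖x‖ ^ 2) / 2) * Real.exp (-1 * ‖x‖ ^ 2)) := by ring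
    _ = _ := by rw [h2]; ring

theorem fderiv_gaussianDensity (x v : Space d) :
    fderiv ℝ (gaussianDensity d) x v = -2 * gaussianDensity d x * inner ℝ x v := by
  have h1 : HasFDerivAt (gaussianDensity d) _ x :=
    (((hasStrictFDerivAt_norm_sq x).hasFDerivAt.const_mul (-1)).exp).const_mul
      (∫ y : Space d, Real.exp (-1 * ‖y‖ ^ 2))⁻¹
  rw [h1.fderiv, gaussianDensity]
  simp; ring

end Gaussian

end NewtonDecomp

namespace NewtonDecomp

open Metric Set Filter Topology

set_option linter.unusedSectionVars false

/-! ### A planar example in which the two flows differ. -/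

section PlanarExample

theorem inner_space_two (v w : Space 2) : inner ℝ v w = v 0 * w 0 + v 1 * w 1 := by
  rw [PiLp.inner_apply, Fin.sum_univ_two]; simp [mul_comm]

theorem norm_sq_space_two (v : Space 2) : ‖v‖ ^ 2 = v 0 ^ 2 + v 1 ^ 2 := by
  rw [← real_inner_self_eq_norm_sq, inner_space_two]; ring

theorem hasFDerivAt_coord (i : Fin 2) (x : Space 2) :
    HasFDerivAt (fun y : Space 2 => y i) (EuclideanSpace.proj i : Space 2 →L[ℝ] ℝ) x :=
  (EuclideanSpace.proj i : Space 2 →L[ℝ] ℝ).hasFDerivAt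

theorem contDiff_coord (i : Fin 2) : ContDiff ℝ ∞ fun y : Space 2 => y i :=
  (EuclideanSpace.proj i : Space 2 →L[ℝ] ℝ).contDiff

theorem contDiff_of_coord {W : Space 2 → Space 2} (h : ∀ i, ContDiff ℝ ∞ fun x => W x i) :
    ContDiff ℝ ∞ W := contDiff_euclidean.2 h

theorem gradient_eq_of_fderiv {φ : Space 2 → ℝ} {x g : Space 2}
    (h : ∀ v, fderiv ℝ φ x v = g 0 * v 0 + g 1 * v 1) : gradient φ x = g := by
  refine ext_inner_right ℝ fun v => ?_
  rw [inner_gradient, h, inner_space_two]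

/-- A quartic convex function on the plane whose Newton direction is not a gradient. -/
noncomputable def quarticExample (x : Space 2) : ℝ :=
  x 0 ^ 2 / 2 + x 0 ^ 4 / 4 + x 1 ^ 2 / 2 + x 0 * x 1 / 2

theorem contDiff_quarticExample : ContDiff ℝ ∞ quarticExample := by
  have h0 := contDiff_coord 0
  have h1 := contDiff_coord 1
  unfold quarticExample
  exact ((((h0.pow 2).div_const 2).add ((h0.pow 4).div_const 4)).add
    ((h1.pow 2).div_const 2)).add ((h0.mul h1).div_const 2)

theorem gradient_quarticExample (x : Space 2) :
    gradient quarticExample x = !₂[x 0 + x 0 ^ 3 + x 1 / 2, x 1 + x 0 / 2] := by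
  refine gradient_eq_of_fderiv fun v => ?_
  have h0 := hasFDerivAt_coord 0 x
  have h1 := hasFDerivAt_coord 1 x
  have h : HasFDerivAt quarticExample _ x :=
    ((((h0.pow 2).mul_const (2⁻¹ : ℝ)).add ((h0.pow 4).mul_const (4⁻¹ : ℝ))).add
      ((h1.pow 2).mul_const (2⁻¹ : ℝ))).add ((h0.mul h1).mul_const (2⁻¹ : ℝ))
  rw [h.fderiv]
  simp
  ring

theorem hessian_quarticExample (x v : Space 2) :
    hessian quarticExample x v = !₂[(1 + 3 * x 0 ^ 2) * v 0 + v 1 / 2, v 0 / 2 + v 1] := by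
  have hd : DifferentiableAt ℝ (gradient quarticExample) x :=
    (contDiff_gradient contDiff_quarticExample).differentiable (by simp) x
  have h0 := hasFDerivAt_coord 0 x
  have h1 := hasFDerivAt_coord 1 x
  ext i
  rw [hessian, fderiv_coord hd]
  fin_cases i
  · simp only [gradient_quarticExample]
    have h : HasFDerivAt (fun y : Space 2 => y 0 + y 0 ^ 3 + y 1 / 2) _ x :=
      (h0.add (h0.pow 3)).add (h1.mul_const (2⁻¹ : ℝ))
    simp
    rw [h.fderiv]
    simp
    ring
  · simp only [gradient_quarticExample]
    have h : HasFDerivAt (fun y : Space 2 => y 1 + y 0 / 2) _ x := h1.add (h0.mul_const (2⁻¹ : ℝ))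
    simp
    rw [h.fderiv]
    simp
    ring

/-- At `x 0 = 0` the form is v₀² + v₀v₁ + v₁² = ‖v‖²/2 + (v₀ + v₁)²/2, and the quartic term only
adds to it. -/
theorem half_norm_sq_le_inner_hessian (x v : Space 2) :
    1 / 2 * ‖v‖ ^ 2 ≤ inner ℝ (hessian quarticExample x v) v := by
  rw [norm_sq_space_two, inner_space_two, hessian_quarticExample]
  simp
  nlinarith [sq_nonneg (v 0 + v 1), mul_nonneg (sq_nonneg (x 0)) (sq_nonneg (v 0))]

theorem isSmoothStrictlyConvex_quarticExample : IsSmoothStrictlyConvex quarticExample where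
  smooth := contDiff_quarticExample
  hessian_pos x v hv := by
    have := norm_pos_iff.2 hv
    exact lt_of_lt_of_le (by positivity) (half_norm_sq_le_inner_hessian x v)

/-- The formula is checked by applying the injective Hessian to both sides; the denominator is the
determinant of the Hessian. -/
theorem newtonDirection_quarticExample (x : Space 2) :
    newtonDirection quarticExample x =
      !₂[-((3 / 4 * x 0 + x 0 ^ 3) / (3 / 4 + 3 * x 0 ^ 2)),
        -x 1 - x 0 ^ 3 / (3 / 4 + 3 * x 0 ^ 2)] := by
  have hf := isSmoothStrictlyConvex_quarticExample
  refine (isInvertible_hessian hf x).injective ?_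
  rw [hessian_newtonDirection hf, hessian_quarticExample, gradient_quarticExample]
  have hD : (3 / 4 + 3 * x 0 ^ 2 : ℝ) ≠ 0 := by positivity
  ext i
  fin_cases i
  · simp; field_simp; ring
  · simp; field_simp; ring

theorem norm_sq_newtonDirection_le (x : Space 2) :
    newtonDirection quarticExample x 0 ^ 2 ≤ x 0 ^ 2 ∧
      newtonDirection quarticExample x 1 ^ 2 ≤ 2 * (x 0 ^ 2 + x 1 ^ 2) := by
  have hD : (0 : ℝ) < 3 / 4 + 3 * x 0 ^ 2 := by positivity
  rw [newtonDirection_quarticExample]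
  simp only [Matrix.cons_val_zero, Matrix.cons_val_one]
  set q := x 0 ^ 2 / (3 / 4 + 3 * x 0 ^ 2) with hq
  have hq0 : 0 ≤ q := by positivity
  have hq1 : q ≤ 1 := by rw [hq, div_le_one hD]; nlinarith [sq_nonneg (x 0)]
  set r := (3 / 4 + x 0 ^ 2) / (3 / 4 + 3 * x 0 ^ 2) with hr
  have hr0 : 0 ≤ r := by positivity
  have hr1 : r ≤ 1 := by rw [hr, div_le_one hD]; nlinarith [sq_nonneg (x 0)]
  have e0 : (3 / 4 * x 0 + x 0 ^ 3) / (3 / 4 + 3 * x 0 ^ 2) = r * x 0 := by rw [hr]; ring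
  have e1 : x 0 ^ 3 / (3 / 4 + 3 * x 0 ^ 2) = q * x 0 := by rw [hq]; ring
  rw [e0, e1]
  have hq2 : q ^ 2 ≤ 1 := pow_le_one₀ hq0 hq1
  have hr2 : r ^ 2 ≤ 1 := pow_le_one₀ hr0 hr1
  constructor
  · nlinarith [mul_le_mul_of_nonneg_right hr2 (sq_nonneg (x 0))]
  · nlinarith [mul_le_mul_of_nonneg_right hq2 (sq_nonneg (x 0)), sq_nonneg (x 1 - q * x 0)]

/-- The Hessian grows quadratically, which raises the polynomial degree from `k` to `k + 1`. -/
theorem integrable_gaussian_energy {v : Space 2 → Space 2} (hv : Continuous v) {C : ℝ} {k : ℕ}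
    (hb : ∀ x, ‖v x‖ ^ 2 ≤ C * (1 + ‖x‖ ^ 2) ^ k) :
    HasFiniteEnergy quarticExample (gaussianDensity 2) v := by
  have hc : Continuous fun x => inner ℝ (hessian quarticExample x (v x)) (v x) :=
    ((contDiff_hessian contDiff_quarticExample).continuous.clm_apply hv).inner hv
  refine integrable_gaussianDensity_mul hc (C := 4 * C) (k := k + 1) fun x => ?_
  have h0 : 0 ≤ inner ℝ (hessian quarticExample x (v x)) (v x) :=
    le_trans (by positivity) (half_norm_sq_le_inner_hessian x (v x))
  have h1 : inner ℝ (hessian quarticExample x (v x)) (v x) ≤ 4 * (1 + ‖x‖ ^ 2) * ‖v x‖ ^ 2 := by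
    rw [norm_sq_space_two, norm_sq_space_two, inner_space_two, hessian_quarticExample]
    simp
    nlinarith [sq_nonneg (v x 0 - v x 1), mul_nonneg (sq_nonneg (x 0)) (sq_nonneg (v x 0)),
      mul_nonneg (sq_nonneg (x 0)) (sq_nonneg (v x 1)),
      mul_nonneg (sq_nonneg (x 1)) (sq_nonneg (v x 0)),
      mul_nonneg (sq_nonneg (x 1)) (sq_nonneg (v x 1)), sq_nonneg (v x 0), sq_nonneg (v x 1)]
  rw [abs_of_nonneg h0]
  calc _ ≤ 4 * (1 + ‖x‖ ^ 2) * ‖v x‖ ^ 2 := h1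
    _ ≤ 4 * (1 + ‖x‖ ^ 2) * (C * (1 + ‖x‖ ^ 2) ^ k) := by gcongr; exact hb x
    _ = _ := by ring

theorem hasFiniteEnergy_newtonDirection :
    HasFiniteEnergy quarticExample (gaussianDensity 2) (newtonDirection quarticExample) := by
  refine integrable_gaussian_energy
    (contDiff_newtonDirection isSmoothStrictlyConvex_quarticExample).continuous
    (C := 3) (k := 1) fun x => ?_
  obtain ⟨h0, h1⟩ := norm_sq_newtonDirection_le x
  rw [norm_sq_space_two, norm_sq_space_two]
  nlinarith [sq_nonneg (x 0), sq_nonneg (x 1)]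

theorem integrable_gaussian_norm_sq {v : Space 2 → Space 2} (hv : Continuous v)
    (h : HasFiniteEnergy quarticExample (gaussianDensity 2) v) :
    Integrable fun x => gaussianDensity 2 x * ‖v x‖ ^ 2 := by
  have hρ := isSmoothDensity_gaussianDensity 2
  refine (h.const_mul 2).mono'
    (hρ.smooth.continuous.mul (hv.norm.pow 2)).aestronglyMeasurable
    (Eventually.of_forall fun x => ?_)
  have h0 := hρ.pos x
  have := mul_le_mul_of_nonneg_left (half_norm_sq_le_inner_hessian x (v x)) h0.le
  rw [Real.norm_of_nonneg (by positivity)]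
  linarith

theorem integrable_gaussian_mul {a b : Space 2 → ℝ} (ha : Continuous a) (hb : Continuous b)
    (h : Integrable fun x => gaussianDensity 2 x * a x ^ 2)
    (h' : Integrable fun x => gaussianDensity 2 x * b x ^ 2) :
    Integrable fun x => gaussianDensity 2 x * (a x * b x) := by
  have hρ := isSmoothDensity_gaussianDensity 2
  refine (h.fun_add h').mono' (hρ.smooth.continuous.mul (ha.mul hb)).aestronglyMeasurable
    (Eventually.of_forall fun x => ?_)
  rw [norm_mul, Real.norm_of_nonneg (hρ.pos x).le, ← mul_add, Real.norm_eq_abs]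
  refine mul_le_mul_of_nonneg_left ?_ (hρ.pos x).le
  rw [abs_le]
  constructor <;> nlinarith [sq_nonneg (a x + b x), sq_nonneg (a x - b x), sq_nonneg (a x),
    sq_nonneg (b x)]

theorem integrable_gaussian_inner {v w : Space 2 → Space 2} (hv : Continuous v) (hw : Continuous w)
    (h : Integrable fun x => gaussianDensity 2 x * ‖v x‖ ^ 2)
    (h' : Integrable fun x => gaussianDensity 2 x * ‖w x‖ ^ 2) :
    Integrable fun x => inner ℝ (gaussianDensity 2 x • v x) (w x) := by
  have hρ := isSmoothDensity_gaussianDensity 2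
  refine (integrable_gaussian_mul hv.norm hw.norm h h').mono'
    ((hρ.smooth.continuous.smul hv).inner hw).aestronglyMeasurable
    (Eventually.of_forall fun x => ?_)
  rw [real_inner_smul_left, norm_mul, Real.norm_of_nonneg (hρ.pos x).le, Real.norm_eq_abs]
  exact mul_le_mul_of_nonneg_left (abs_real_inner_le_norm _ _) (hρ.pos x).le

/-- The rotation field of the plane. -/
noncomputable def rotationField (x : Space 2) : Space 2 := !₂[-x 1, x 0]

theorem contDiff_rotationField : ContDiff ℝ ∞ rotationField := by
  refine contDiff_of_coord fun i => ?_
  fin_cases i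
  · exact (contDiff_coord 1).neg
  · exact contDiff_coord 0

/-- The rotation field is divergence free and orthogonal to the gradient of the radial density. -/
theorem isWeakDivFree_gaussian_rotationField :
    IsWeakDivFree fun x => gaussianDensity 2 x • rotationField x := by
  have hρ := (isSmoothDensity_gaussianDensity 2).smooth
  have hW : ContDiff ℝ ∞ fun x => gaussianDensity 2 x • rotationField x :=
    hρ.smul contDiff_rotationField
  refine isWeakDivFree_of_divergence_eq_zero (hW.of_le (by simp)) fun x => ?_
  have hd := hW.differentiable (by simp) x
  have hρd := (hρ.differentiable (by simp) x).hasFDerivAt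
  rw [divergence, Fin.sum_univ_two, fderiv_coord hd, fderiv_coord hd]
  have h0 : HasFDerivAt (fun y : Space 2 => (gaussianDensity 2 y • rotationField y) 0) _ x :=
    hρd.mul (hasFDerivAt_coord 1 x).neg
  have h1 : HasFDerivAt (fun y : Space 2 => (gaussianDensity 2 y • rotationField y) 1) _ x :=
    hρd.mul (hasFDerivAt_coord 0 x)
  rw [h0.fderiv, h1.fderiv]
  simp [fderiv_gaussianDensity, inner_space_two, rotationField]
  ring

/-- The saddle `(x₀² - x₁²) / 2`. -/
noncomputable def saddlePotential (x : Space 2) : ℝ := x 0 ^ 2 / 2 - x 1 ^ 2 / 2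

/-- The potential complementing the saddle: `∇²f ∇(saddle) + ∇(dual saddle)` is a rotation. -/
noncomputable def dualSaddlePotential (x : Space 2) : ℝ :=
  -(x 0 ^ 2) / 2 - 3 / 4 * x 0 ^ 4 + x 1 ^ 2 / 2

theorem contDiff_saddlePotential : ContDiff ℝ ∞ saddlePotential :=
  (((contDiff_coord 0).pow 2).div_const 2).sub (((contDiff_coord 1).pow 2).div_const 2)

theorem contDiff_dualSaddlePotential : ContDiff ℝ ∞ dualSaddlePotential :=
  ((((contDiff_coord 0).pow 2).neg.div_const 2).sub
    (contDiff_const.mul ((contDiff_coord 0).pow 4))).add (((contDiff_coord 1).pow 2).div_const 2)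

theorem gradient_saddlePotential (x : Space 2) : gradient saddlePotential x = !₂[x 0, -x 1] := by
  refine gradient_eq_of_fderiv fun v => ?_
  have h : HasFDerivAt saddlePotential _ x :=
    (((hasFDerivAt_coord 0 x).pow 2).mul_const (2⁻¹ : ℝ)).sub
      (((hasFDerivAt_coord 1 x).pow 2).mul_const (2⁻¹ : ℝ))
  rw [h.fderiv]
  simp
  ring

theorem gradient_dualSaddlePotential (x : Space 2) :
    gradient dualSaddlePotential x = !₂[-x 0 - 3 * x 0 ^ 3, x 1] := by
  refine gradient_eq_of_fderiv fun v => ?_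
  have h : HasFDerivAt dualSaddlePotential _ x :=
    ((((hasFDerivAt_coord 0 x).pow 2).neg.mul_const (2⁻¹ : ℝ)).sub
      (((hasFDerivAt_coord 0 x).pow 4).const_mul (3 / 4 : ℝ))).add
      (((hasFDerivAt_coord 1 x).pow 2).mul_const (2⁻¹ : ℝ))
  rw [h.fderiv]
  simp
  ring

/-- The algebraic core of the example. Pairing with `v = ξ` expresses the circulation of ξ through
its two fluxes, with and without the Hessian, and a field for which both are divergence free has
none. -/
theorem inner_rotationField_eq (x v : Space 2) :
    inner ℝ v (rotationField x) = 2 * inner ℝ (hessian quarticExample x v) (gradient saddlePotential x)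
      + 2 * inner ℝ v (gradient dualSaddlePotential x) := by
  simp only [inner_space_two, hessian_quarticExample, gradient_saddlePotential,
    gradient_dualSaddlePotential, rotationField]
  simp
  ring

theorem isPotential_saddlePotential :
    IsPotential quarticExample (gaussianDensity 2) saddlePotential := by
  refine ⟨contDiff_saddlePotential, integrable_gaussian_energy
    (contDiff_gradient contDiff_saddlePotential).continuous (C := 1) (k := 1) fun x => ?_⟩
  rw [norm_sq_space_two, norm_sq_space_two, gradient_saddlePotential]
  simp

theorem integrable_gaussian_rotationField :
    Integrable fun x => gaussianDensity 2 x * ‖rotationField x‖ ^ 2 := by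
  have hc := contDiff_rotationField.continuous
  refine integrable_gaussianDensity_mul (hc.norm.pow 2) (C := 1) (k := 1) fun x => ?_
  rw [norm_sq_space_two, norm_sq_space_two, rotationField]
  simp
  rw [abs_of_nonneg (by positivity)]
  linarith

theorem integrable_gaussian_dualSaddlePotential :
    Integrable fun x => gaussianDensity 2 x * dualSaddlePotential x ^ 2 := by
  refine integrable_gaussianDensity_mul (contDiff_dualSaddlePotential.continuous.pow 2) (C := 1)
    (k := 4) fun x => ?_
  rw [abs_of_nonneg (by positivity), norm_sq_space_two]
  have h : |dualSaddlePotential x| ≤ (1 + (x 0 ^ 2 + x 1 ^ 2)) ^ 2 := by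
    rw [dualSaddlePotential, abs_le]
    have := mul_nonneg (sq_nonneg (x 0)) (sq_nonneg (x 1))
    constructor <;> nlinarith [sq_nonneg (x 0), sq_nonneg (x 1), sq_nonneg (x 0 ^ 2),
      sq_nonneg (x 1 ^ 2)]
  rw [← sq_abs]
  calc |dualSaddlePotential x| ^ 2 ≤ ((1 + (x 0 ^ 2 + x 1 ^ 2)) ^ 2) ^ 2 := by gcongr
    _ = _ := by ring

theorem integrable_gaussian_gradient_dualSaddlePotential :
    Integrable fun x => gaussianDensity 2 x * ‖gradient dualSaddlePotential x‖ ^ 2 := by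
  have hc := (contDiff_gradient contDiff_dualSaddlePotential).continuous
  refine integrable_gaussianDensity_mul (hc.norm.pow 2) (C := 18) (k := 3) fun x => ?_
  rw [abs_of_nonneg (by positivity), norm_sq_space_two, norm_sq_space_two,
    gradient_dualSaddlePotential]
  simp
  set s := x 0 ^ 2 with hs
  set t := x 1 ^ 2 with ht
  have hs0 : 0 ≤ s := sq_nonneg _
  have ht0 : 0 ≤ t := sq_nonneg _
  have e : (-x 0 - 3 * x 0 ^ 3) ^ 2 = s * (1 + 3 * s) ^ 2 := by rw [hs]; ring
  rw [e]
  have h1 : s * (1 + 3 * s) ^ 2 ≤ 9 * (1 + s) ^ 3 := by nlinarith [mul_nonneg hs0 hs0]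
  have h2 : (1 + s) ^ 3 ≤ (1 + (s + t)) ^ 3 := by gcongr; linarith
  have h3 : t ≤ (1 + (s + t)) ^ 3 := by
    have : (1 + (s + t)) ^ 1 ≤ (1 + (s + t)) ^ 3 :=
      pow_le_pow_right₀ (by linarith) (by norm_num)
    linarith
  linarith

/-- The reflection `(x₀, x₁) ↦ (x₀, -x₁)`. -/
noncomputable def planeReflection : Space 2 ≃ₗᵢ[ℝ] Space 2 :=
  LinearIsometryEquiv.piLpCongrRight 2 fun i : Fin 2 =>
    if i = 1 then LinearIsometryEquiv.neg ℝ else LinearIsometryEquiv.refl ℝ ℝ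

theorem planeReflection_zero (x : Space 2) : planeReflection x 0 = x 0 := by
  simp [planeReflection]

theorem planeReflection_one (x : Space 2) : planeReflection x 1 = -x 1 := by
  simp [planeReflection]

/-- Averaging over the reflection in `x 1` removes the terms odd in `x 1` and leaves `-q`, with `q`
nonnegative, continuous and positive at (1, 0). -/
theorem integral_newtonDirection_rotationField_ne_zero
    (hi : Integrable fun x =>
      inner ℝ (gaussianDensity 2 x • newtonDirection quarticExample x) (rotationField x)) :
    ∫ x, inner ℝ (gaussianDensity 2 x • newtonDirection quarticExample x) (rotationField x) ≠ 0 := by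
  intro h0
  have hρ := isSmoothDensity_gaussianDensity 2
  set g : Space 2 → ℝ := fun x =>
    inner ℝ (gaussianDensity 2 x • newtonDirection quarticExample x) (rotationField x) with hg
  set q : Space 2 → ℝ := fun x =>
    gaussianDensity 2 x * (x 0 ^ 4 / (3 / 4 + 3 * x 0 ^ 2)) with hq
  have hD : ∀ x : Space 2, (0 : ℝ) < 3 / 4 + 3 * x 0 ^ 2 := fun x => by positivity
  have hmp := planeReflection.measurePreserving
  have hgi : ∫ x, g (planeReflection x) = 0 := by
    rw [hmp.integral_comp planeReflection.toHomeomorph.measurableEmbedding g, h0]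
  have hgI : Integrable fun x => g (planeReflection x) := hmp.integrable_comp_of_integrable hi
  have hρR : ∀ x, gaussianDensity 2 (planeReflection x) = gaussianDensity 2 x := fun x => by
    simp [gaussianDensity]
  have key : ∀ x, g x + g (planeReflection x) = -2 * q x := by
    intro x
    have hD' := (hD x).ne'
    simp only [hg, hq, real_inner_smul_left, inner_space_two, hρR]
    simp only [newtonDirection_quarticExample, rotationField, planeReflection_zero,
      planeReflection_one]
    simp
    field_simp
    ring
  have hsum : ∫ x, (-2 * q x) = 0 := by
    simp only [← key]
    rw [integral_add hi hgI, hgi]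
    simpa using h0
  have hqI : Integrable q := by
    have : Integrable fun x => -2 * q x := by simpa only [← key] using hi.fun_add hgI
    simpa using this.const_mul (-2)⁻¹
  have hq0 : ∫ x, q x = 0 := by rw [integral_const_mul] at hsum; linarith
  have hqc : Continuous q := by
    have := (contDiff_coord 0).continuous
    exact hρ.smooth.continuous.mul ((this.pow 4).div
      (continuous_const.add (continuous_const.mul (this.pow 2))) fun x => (hD x).ne')
  have hqn : 0 ≤ q := fun x => mul_nonneg (hρ.pos x).le (div_nonneg (by positivity) (hD x).le)
  have hae := (integral_eq_zero_iff_of_nonneg hqn hqI).1 hq0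
  have hz := congrFun ((Continuous.ae_eq_iff_eq volume hqc continuous_const).1 hae)
    (EuclideanSpace.single 0 1)
  have hp : 0 < q (EuclideanSpace.single 0 1) := mul_pos (hρ.pos _) (by simp; norm_num)
  exact hp.ne' hz

theorem exists_continuityRate_ne {Φ : Space 2 → ℝ}
    (hΦ : IsWassersteinNewtonPotential quarticExample (gaussianDensity 2) Φ) :
    ∃ x, continuityRate (gaussianDensity 2) (newtonDirection quarticExample) x ≠
      continuityRate (gaussianDensity 2) (gradient Φ) x := by
  by_contra! hcon
  have hf := isSmoothStrictlyConvex_quarticExample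
  have hρ := isSmoothDensity_gaussianDensity 2
  have hρs := hρ.smooth
  have hB := isEnergyForm_weightedHessian hf hρ
  have hNs := contDiff_newtonDirection hf
  have hgs := contDiff_gradient hΦ.potential.smooth
  set ξ : Space 2 → Space 2 := fun x => newtonDirection quarticExample x - gradient Φ x with hξ
  have hξs : ContDiff ℝ ∞ ξ := hNs.sub hgs
  have hξ2 : Integrable fun x => gaussianDensity 2 x * ‖ξ x‖ ^ 2 := by
    refine integrable_gaussian_norm_sq hξs.continuous ?_
    rw [← finEnergy_weightedHessian_iff hξs.continuous]
    exact ((finEnergy_weightedHessian_iff hNs.continuous).2 hasFiniteEnergy_newtonDirection).sub hB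
      ((finEnergy_weightedHessian_iff hgs.continuous).2 hΦ.potential.finite_energy)
  -- Equality of the two rates says exactly that ρ ξ is divergence free.
  have hdiv : ∀ x, divergence (fun x => gaussianDensity 2 x • ξ x) x = 0 := by
    intro x
    have h1 := hcon x
    simp only [continuityRate, neg_inj] at h1
    have d1 : DifferentiableAt ℝ (fun y => gaussianDensity 2 y • newtonDirection quarticExample y) x :=
      (hρs.smul hNs).differentiable (by simp) x
    have d2 : DifferentiableAt ℝ (fun y => gaussianDensity 2 y • gradient Φ y) x :=
      (hρs.smul hgs).differentiable (by simp) x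
    simp only [divergence, hξ, smul_sub, fderiv_fun_sub d1 d2] at h1 ⊢
    simp only [sub_apply, PiLp.sub_apply, Finset.sum_sub_distrib, h1, sub_self]
  have hW : ContDiff ℝ ∞ fun x => gaussianDensity 2 x • ξ x := hρs.smul hξs
  obtain ⟨L, hL0, hL⟩ := exists_norm_gradient_radialCutoff_le (E := Space 2)
  have iA := integrable_gaussian_inner hξs.continuous
    (contDiff_gradient contDiff_dualSaddlePotential).continuous hξ2
    integrable_gaussian_gradient_dualSaddlePotential
  -- `hdiv` is only pointwise, so the flux at infinity has to be excluded separately: the boundary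
  -- terms are dominated because `dualSaddlePotential` and `ξ` are both square integrable for the
  -- Gaussian.
  have hA : ∫ x, inner ℝ (gaussianDensity 2 x • ξ x) (gradient dualSaddlePotential x) = 0 := by
    refine (isWeakDivFree_of_divergence_eq_zero (hW.of_le (by simp))
      hdiv).integral_inner_gradient_eq_zero hW.continuous contDiff_dualSaddlePotential iA
      (G := fun x => L * |gaussianDensity 2 x * (dualSaddlePotential x * ‖ξ x‖)|)
      ((integrable_gaussian_mul contDiff_dualSaddlePotential.continuous hξs.continuous.norm
        integrable_gaussian_dualSaddlePotential hξ2).abs.const_mul L) fun a ha ha1 x => ?_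
    have h1 := abs_real_inner_le_norm (gaussianDensity 2 x • ξ x) (gradient (radialCutoff a) x)
    have h2 : ‖gradient (radialCutoff a) x‖ ≤ L :=
      (hL a ha x).trans (mul_le_of_le_one_left hL0 ha1)
    rw [norm_smul, Real.norm_of_nonneg (hρ.pos x).le] at h1
    rw [abs_mul, abs_mul, abs_mul, abs_of_nonneg (hρ.pos x).le, abs_of_nonneg (norm_nonneg (ξ x))]
    have h3 := (hρ.pos x).le
    calc |dualSaddlePotential x| * |inner ℝ (gaussianDensity 2 x • ξ x) (gradient (radialCutoff a) x)|
        ≤ |dualSaddlePotential x| * (gaussianDensity 2 x * ‖ξ x‖ * L) := by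
          gcongr
          exact h1.trans (by gcongr)
      _ = _ := by ring
  have iP : Integrable fun x => inner ℝ (gaussianDensity 2 x • hessian quarticExample x (ξ x))
      (gradient saddlePotential x) :=
    ((isWassersteinNewtonPotential_iff hf).1 hΦ).divergence_free.integrable _
      isPotential_saddlePotential
  have hP : ∫ x, inner ℝ (gaussianDensity 2 x • hessian quarticExample x (ξ x))
      (gradient saddlePotential x) = 0 :=
    ((isWassersteinNewtonPotential_iff hf).1 hΦ).divergence_free.no_flux _
      isPotential_saddlePotential
  have hRc := contDiff_rotationField.continuous
  have iR := integrable_gaussian_inner hRc hgs.continuous integrable_gaussian_rotationField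
    (integrable_gaussian_norm_sq hgs.continuous hΦ.potential.finite_energy)
  -- Nothing is known about the growth of `Φ`, but the boundary terms vanish identically, rotation
  -- being tangential to the level sets of the cutoff; hence the dominating function 0.
  have hR : ∫ x, inner ℝ (gaussianDensity 2 x • rotationField x) (gradient Φ x) = 0 := by
    refine isWeakDivFree_gaussian_rotationField.integral_inner_gradient_eq_zero
      (hρs.continuous.smul hRc) hΦ.potential.smooth iR (integrable_zero _ ℝ volume)
      fun a _ _ x => ?_
    have h1 : inner ℝ x (gaussianDensity 2 x • rotationField x) = 0 := by
      rw [real_inner_smul_right, inner_space_two, rotationField]; simp; right; ring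
    rw [inner_gradient_radialCutoff_eq_zero a h1]; simp
  have key : ∀ x, inner ℝ (gaussianDensity 2 x • newtonDirection quarticExample x)
      (rotationField x) = inner ℝ (gaussianDensity 2 x • rotationField x) (gradient Φ x) +
      (2 * inner ℝ (gaussianDensity 2 x • hessian quarticExample x (ξ x))
        (gradient saddlePotential x) +
      2 * inner ℝ (gaussianDensity 2 x • ξ x) (gradient dualSaddlePotential x)) := by
    intro x
    have h1 := inner_rotationField_eq x (ξ x)
    have h2 : inner ℝ (newtonDirection quarticExample x) (rotationField x) =
        inner ℝ (rotationField x) (gradient Φ x) + inner ℝ (ξ x) (rotationField x) := by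
      simp only [hξ, inner_sub_left, real_inner_comm (gradient Φ x)]; ring
    simp only [real_inner_smul_left]
    rw [h2, h1]; ring
  have iS := (iP.const_mul 2).fun_add (iA.const_mul 2)
  refine integral_newtonDirection_rotationField_ne_zero ?_ ?_
  · simp only [key]
    exact iR.fun_add iS
  · simp only [key]
    rw [integral_add iR iS, integral_add (iP.const_mul 2) (iA.const_mul 2), integral_const_mul,
      integral_const_mul, hR, hP, hA]
    simp

end PlanarExample

end NewtonDecomp

theorem mainTheorem10 :
    -- existence and uniqueness of the decomposition
    (∀ (d : ℕ) (f ρ : NewtonDecomp.Space d → ℝ),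
      NewtonDecomp.IsSmoothStrictlyConvex f →
      NewtonDecomp.IsSmoothDensity ρ →
      NewtonDecomp.HasFiniteEnergy f ρ (NewtonDecomp.newtonDirection f) →
      ∃ (Φ : NewtonDecomp.Space d → ℝ) (ξ : NewtonDecomp.Space d → NewtonDecomp.Space d),
        NewtonDecomp.IsNewtonDecomposition f ρ Φ ξ ∧
        (∀ (Φ' : NewtonDecomp.Space d → ℝ) (ξ' : NewtonDecomp.Space d → NewtonDecomp.Space d),
          NewtonDecomp.IsNewtonDecomposition f ρ Φ' ξ' →
            (∃ c : ℝ, ∀ x, Φ' x = Φ x + c) ∧ ξ' = ξ) ∧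
        (∀ Φ' : NewtonDecomp.Space d → ℝ,
          NewtonDecomp.IsWassersteinNewtonPotential f ρ Φ' ↔ ∃ c : ℝ, ∀ x, Φ' x = Φ x + c)) ∧
    -- the two Newton flows differ in general
    (∃ f ρ Φ : NewtonDecomp.Space 2 → ℝ,
      NewtonDecomp.IsSmoothStrictlyConvex f ∧
      NewtonDecomp.IsSmoothDensity ρ ∧
      NewtonDecomp.HasFiniteEnergy f ρ (NewtonDecomp.newtonDirection f) ∧
      NewtonDecomp.IsWassersteinNewtonPotential f ρ Φ ∧
      ∃ x, NewtonDecomp.continuityRate ρ (NewtonDecomp.newtonDirection f) x ≠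
        NewtonDecomp.continuityRate ρ (gradient Φ) x) := by
  refine ⟨fun d f ρ hf hρ hE => NewtonDecomp.newton_decomposition hf hρ hE, ?_⟩
  obtain ⟨Φ, hΦ⟩ := NewtonDecomp.exists_wassersteinNewtonPotential
    NewtonDecomp.isSmoothStrictlyConvex_quarticExample
    (NewtonDecomp.isSmoothDensity_gaussianDensity 2) NewtonDecomp.hasFiniteEnergy_newtonDirection
  exact ⟨_, _, Φ, NewtonDecomp.isSmoothStrictlyConvex_quarticExample,
    NewtonDecomp.isSmoothDensity_gaussianDensity 2, NewtonDecomp.hasFiniteEnergy_newtonDirection,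
    hΦ, NewtonDecomp.exists_continuityRate_ne hΦ⟩
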